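/- **Setting.** Let $r>6$ be an integer and let $V_1,V_2:\mathbb R\to\mathbb R$ and $V_c:\mathbb R^2\to\mathbb R$ be of class $C^{r+1}$, where for $i=1,2$: $V_i(0)=0$, $qV_i'(q)>0$ for $q\ne0$, $V_i''(0)\neq 0$, and $V_i(q)\to\infty$ as $|q|\to\infty$. Let $q_1^w<0$. For $\epsilon\ge 0$ the *wall system* is the Hamiltonian flow of $$H_\epsilon=\tfrac{p_1^2}{2}+V_1(q_1)+\tfrac{p_2^2}{2}+V_2(q_2)+\epsilon V_c(q_1,q_2)$$ in $q_1>q_1^w$ with elastic reflection $p_1\mapsto-p_1$ at $q_1=q_1^w$. Let $(\theta,I)=S_2(q_2,p_2)$ be the action-angle variables of $H_2=\frac{p_2^2}{2}+V_2(q_2)$: $I=\frac1{2\pi}\oint p_2\,dq_2$ is the action of the level set through $(q_2,p_2)$, and $\theta\in\mathbb R/2\pi\mathbb Z$ is the frequency of this level set times the time elapsed since the passage through its maximal $q_2$ (so $\theta=0$ on $p_2=0,\dot p_2<0$). Let $E>V_1(q_1^w)$ and let $R$ be such that $|q_1|,|q_2|<R$ whenever $q_1\ge q_1^w$ and $V_1(q_1)+V_2(q_2)\le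 E$. Let $\Sigma_E=\Sigma_E^\epsilon$ be the set of points with $q_1\ge q_1^w$, $|q_1|,|q_2|<R$, $H_\epsilon=E$, $p_1=0$, $\dot p_1<0$ (the box only discards far-away parts of the energy surface that an unbounded $V_c$ may create). Points of $\Sigma_E$ are described by their cylinder coordinates $(\theta,I)=S_2(q_2,p_2)$, and $\mathcal F_\epsilon$ denotes the first return map to $\Sigma_E$ of the wall system. The *singularity curve* $\sigma^\epsilon$ is the set of all points of $\Sigma_E$ (in the coordinates $(\theta,I)$) whose trajectory touches the wall tangentially ($q_1=q_1^w$, $p_1=0$) before its first return to $\Sigma_E$. Let $I_{tan}(E)$ be the action of the level set $H_2=E-V_1(q_1^w)$. A *dividing circle* is a continuous simple closed curve on the cylinder on which $\theta$ takes every value. **Theorem.** There are $\epsilon_0>0$, a constant $C$, and functions $I_{tan}^\epsilon,\bar I_{tan}^\epsilon:\mathbb R\to\mathbb R$ such that for all $\epsilon\in[0,\epsilon_0]$: 1. $\sigma^\epsilon$ is a dividing circle, and it is the graph $\sigma^\epsilon=\{(\theta,I_{tan}^\epsilon(\theta))\}$ (thus this circle is isolated: it contains all tangent initial conditions, there are no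 others). 2. It divides $\Sigma_E$ into an impacting and a non-impacting region: if a point of $\Sigma_E$ with coordinates $(\theta,I)$ satisfies $I<I_{tan}^\epsilon(\theta)$, then before its first return its trajectory hits the wall transversally and never touches it tangentially; if $I>I_{tan}^\epsilon(\theta)$, then its trajectory does not meet the wall before its first return. If $I\le I_{tan}^\epsilon(\theta)$, the first return exists and is unique. 3. The image of the singularity curve is a graph, $\mathcal F_\epsilon\sigma^\epsilon=\{(\theta,\bar I_{tan}^\epsilon(\theta))\}$. 4. $I_{tan}^\epsilon$ and $\bar I_{tan}^\epsilon$ are $2\pi$-periodic, of class $C^r$, and $C^r$ $\epsilon$-close to the constant $I_{tan}(E)$: all derivatives of orders $0,\dots,r$ of $I_{tan}^\epsilon-I_{tan}(E)$ and of $\bar I_{tan}^\epsilon-I_{tan}(E)$ are bounded by $C\epsilon$. 5. $\bar I_{tan}^\epsilon(\theta)=I_{tan}^\epsilon(-\theta)$ for all $\theta$. Moreover, for every $\eta>0$ there is $\epsilon_1>0$ such that for all $\epsilon\in[0,\epsilon_1]$ every point of $\Sigma_E$ with $q_1\ge\eta$ has a unique first return to $\Sigma_E$. -/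

import Mathlib

open Set Filter Topology

noncomputable section

/-- The separable potentials `V₁`, `V₂` (of class `C^{r+1}`, with a single and simple minimum at `0`,
tending to infinity), the `C^{r+1}` coupling potential `Vc`, and a vertical wall `q₁ = w`, `w < 0`. -/
structure WallSystem (r : ℕ) where
  V₁ : ℝ → ℝ
  V₂ : ℝ → ℝ
  Vc : ℝ × ℝ → ℝ
  w : ℝ
  contDiff_V₁ : ContDiff ℝ ((r + 1 : ℕ) : WithTop ℕ∞) V₁
  contDiff_V₂ : ContDiff ℝ ((r + 1 : ℕ) : WithTop ℕ∞) V₂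
  contDiff_Vc : ContDiff ℝ ((r + 1 : ℕ) : WithTop ℕ∞) Vc
  V₁_zero : V₁ 0 = 0
  V₂_zero : V₂ 0 = 0
  V₁_deriv : ∀ q, q ≠ 0 → 0 < q * deriv V₁ q
  V₂_deriv : ∀ q, q ≠ 0 → 0 < q * deriv V₂ q
  V₁_simple : deriv (deriv V₁) 0 ≠ 0
  V₂_simple : deriv (deriv V₂) 0 ≠ 0
  V₁_coercive : Tendsto V₁ (cocompact ℝ) atTop
  V₂_coercive : Tendsto V₂ (cocompact ℝ) atTop
  w_neg : w < 0

/-- Phase space points `(q₁, p₁, q₂, p₂)`. -/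
@[ext]
structure PhasePt where
  q₁ : ℝ
  p₁ : ℝ
  q₂ : ℝ
  p₂ : ℝ

/-! ### Action-angle variables of `p² / 2 + V q` with `V` having a single well at `0` -/

/-- The action `(1 / 2π) ∮ p dq` of the level set of energy `h`. The square root vanishes outside of
the projection `{x | V x ≤ h}` of the level set, so the integral is over `[q_min, q_max]`. As a
function of `h` this is the inverse of the energy as a function of the action. -/
def levelAction (V : ℝ → ℝ) (h : ℝ) : ℝ :=
  (1 / Real.pi) * ∫ x, √(2 * (h - V x))

/-- The period `2 ∫ dx / √(2 (h - V x))` over `(q_min, q_max)`; the integrand vanishes outside. -/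
def levelPeriod (V : ℝ → ℝ) (h : ℝ) : ℝ :=
  2 * ∫ x, (√(2 * (h - V x)))⁻¹

/-- The travel time `∫ dx / √(2 (h - V x))` over `(q, q_max)`. -/
def travelTime (V : ℝ → ℝ) (h q : ℝ) : ℝ :=
  ∫ x in Ioi q, (√(2 * (h - V x)))⁻¹

/-- The energy `p² / 2 + V q`. -/
def energy₁ (V : ℝ → ℝ) (q p : ℝ) : ℝ := p ^ 2 / 2 + V q

/-- The action variable of the point `(q, p)`. -/
def actionVar (V : ℝ → ℝ) (q p : ℝ) : ℝ := levelAction V (energy₁ V q p)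

/-- The angle variable of the point `(q, p)`: the frequency times the time elapsed since
the passage through `q = q_max`, so that it vanishes on `p = 0`, `p' < 0`. -/
def angleVar (V : ℝ → ℝ) (q p : ℝ) : Real.Angle :=
  let h := energy₁ V q p
  let τ := (2 * Real.pi / levelPeriod V h) * travelTime V h q
  if 0 < p then ((-τ : ℝ) : Real.Angle) else (τ : Real.Angle)

namespace WallSystem

variable {r : ℕ} (S : WallSystem r)

/-- The Hamiltonian, to the right of the wall. -/
def ham (ε : ℝ) (z : PhasePt) : ℝ :=
  z.p₁ ^ 2 / 2 + S.V₁ z.q₁ + (z.p₂ ^ 2 / 2 + S.V₂ z.q₂) + ε * S.Vc (z.q₁, z.q₂)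

/-- `p₁' = -∂H/∂q₁`. -/
def force₁ (ε : ℝ) (z : PhasePt) : ℝ :=
  -deriv S.V₁ z.q₁ - ε * deriv (fun x => S.Vc (x, z.q₂)) z.q₁

/-- `p₂' = -∂H/∂q₂`. -/
def force₂ (ε : ℝ) (z : PhasePt) : ℝ :=
  -deriv S.V₂ z.q₂ - ε * deriv (fun y => S.Vc (z.q₁, y)) z.q₂

/-- `z` restricted to `[0, T]` is a trajectory of the wall system: Hamilton's equations hold to the
right of the wall, and at a contact with the wall `p₁` jumps to its negative. The value of `p₁` at
a contact time is the one after the reflection. -/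
structure IsWallArc (ε T : ℝ) (z : ℝ → PhasePt) : Prop where
  right_of_wall : ∀ t ∈ Icc 0 T, S.w ≤ (z t).q₁
  cont_q₁ : ContinuousOn (fun t => (z t).q₁) (Icc 0 T)
  ode_q₂ : ∀ t ∈ Icc 0 T, HasDerivWithinAt (fun s => (z s).q₂) (z t).p₂ (Icc 0 T) t
  ode_p₂ : ∀ t ∈ Icc 0 T, HasDerivWithinAt (fun s => (z s).p₂) (S.force₂ ε (z t)) (Icc 0 T) t
  ode_q₁ : ∀ t ∈ Icc 0 T, S.w < (z t).q₁ →
    HasDerivWithinAt (fun s => (z s).q₁) (z t).p₁ (Icc 0 T) t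
  ode_p₁ : ∀ t ∈ Icc 0 T, S.w < (z t).q₁ →
    HasDerivWithinAt (fun s => (z s).p₁) (S.force₁ ε (z t)) (Icc 0 T) t
  after_q₁ : ∀ t ∈ Icc 0 T, (z t).q₁ = S.w →
    HasDerivWithinAt (fun s => (z s).q₁) (z t).p₁ (Icc t T) t
  after_p₁ : ∀ t ∈ Icc 0 T, (z t).q₁ = S.w →
    HasDerivWithinAt (fun s => (z s).p₁) (S.force₁ ε (z t)) (Icc t T) t
  reflect : ∀ t ∈ Icc 0 T, (z t).q₁ = S.w →
    Tendsto (fun s => (z s).p₁) (𝓝[Ico 0 t] t) (𝓝 (-(z t).p₁))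

/-- The section `Σ_E` : `p₁ = 0`, `p₁' < 0`, on the part over the box `|q₁|, |q₂| < R` of the
energy surface `H = E`. -/
def sect (ε E R : ℝ) : Set PhasePt :=
  {z | S.w ≤ z.q₁ ∧ |z.q₁| < R ∧ |z.q₂| < R ∧ z.p₁ = 0 ∧ S.force₁ ε z < 0 ∧ S.ham ε z = E}

/-- The cylinder coordinates `(θ, I)` of a phase space point. -/
def chart (z : PhasePt) : Real.Angle × ℝ :=
  (angleVar S.V₂ z.q₂ z.p₂, actionVar S.V₂ z.q₂ z.p₂)

/-- `z₁` is the first return to `Σ_E` of the wall trajectory of `z₀`. -/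
def IsFirstReturn (ε E R : ℝ) (z₀ z₁ : PhasePt) : Prop :=
  ∃ T > 0, ∃ z : ℝ → PhasePt, S.IsWallArc ε T z ∧ z 0 = z₀ ∧ z T = z₁ ∧
    z₁ ∈ S.sect ε E R ∧ ∀ t ∈ Ioo 0 T, z t ∉ S.sect ε E R

/-- The wall trajectory of `z₀` is at the wall with `p₁ = v` (after the reflection) at some time
before its first return to `Σ_E`. -/
def MeetsWall (ε E R : ℝ) (z₀ : PhasePt) (v : ℝ) : Prop :=
  ∃ T > 0, ∃ z : ℝ → PhasePt, S.IsWallArc ε T z ∧ z 0 = z₀ ∧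
    (∀ t ∈ Ioc 0 T, z t ∉ S.sect ε E R) ∧ (z T).q₁ = S.w ∧ (z T).p₁ = v

/-- The trajectory touches the wall tangentially before its first return. -/
def Touches (ε E R : ℝ) (z₀ : PhasePt) : Prop := S.MeetsWall ε E R z₀ 0

/-- The trajectory hits the wall transversally before its first return. -/
def Impacts (ε E R : ℝ) (z₀ : PhasePt) : Prop := ∃ v, v ≠ 0 ∧ S.MeetsWall ε E R z₀ v

/-- The singularity curve `σ^ε(E)`, in the coordinates `(θ, I)`. -/
def singularityCurve (ε E R : ℝ) : Set (Real.Angle × ℝ) :=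
  S.chart '' {z | z ∈ S.sect ε E R ∧ S.Touches ε E R z}

/-- The image of a subset of the cylinder under the return map, in the coordinates `(θ, I)`. -/
def returnImage (ε E R : ℝ) (A : Set (Real.Angle × ℝ)) : Set (Real.Angle × ℝ) :=
  {x | ∃ z ∈ S.sect ε E R, S.chart z ∈ A ∧ ∃ z', S.IsFirstReturn ε E R z z' ∧ S.chart z' = x}

/-- The tangency action. -/
def tangencyAction (E : ℝ) : ℝ := levelAction S.V₂ (E - S.V₁ S.w)

end WallSystem

/-- A simple closed curve on the cylinder which meets every angle. -/
def IsDividingCircle (A : Set (Real.Angle × ℝ)) : Prop :=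
  ∃ γ : Circle → Real.Angle × ℝ, Continuous γ ∧ Function.Injective γ ∧ range γ = A ∧
    range (fun s => (γ s).1) = univ

/-- The graph over the circle of a `2π`-periodic function of the angle. -/
def cylinderGraph (f : ℝ → ℝ) : Set (Real.Angle × ℝ) :=
  range fun θ : ℝ => ((θ : Real.Angle), f θ)

/-- `f` is a `2π`-periodic `C^r` function at `C^r`-distance at most `δ` from the constant `c`. -/
def PeriodicCrClose (r : ℕ) (f : ℝ → ℝ) (c δ : ℝ) : Prop :=
  Function.Periodic f (2 * Real.pi) ∧ ContDiff ℝ (r : WithTop ℕ∞) f ∧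
    ∀ k ≤ r, ∀ θ, |iteratedDeriv k (fun x => f x - c) θ| ≤ δ

end

/-! The wall system is compared with the wall-free flow of `H_ε` on a compact part of phase space
(`WallSystem.FreeFlow`), which is `C^r` in time, in `ε` and in the initial point. Smoothness of
flows is obtained from the implicit function theorem for the Picard operator on `C([-1, 1], E)`
(`exists_contDiff_flow`).

A trajectory which starts on the section descends in `q₁`; it can meet the wall before its first
return only during this first descent (`WallSystem.IsWallArc.p₁_neg_of_contact`,
`WallSystem.FreeFlow.meetsWall_iff`). Indeed, a second descent would start at a point with
`p₁ = 0` off the section, that is at an equilibrium of the first degree of freedom, whose energy is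
too low to climb to the wall: during a descent the energy of the first degree of freedom changes only
by `O(ε)`, however long it takes, since the change is bounded by the distance travelled
(`energy_drift`). So the contact with the wall is decided by the turning point `G < 0` of the
wall-free descent: the trajectory impacts, touches or misses the wall according to `G < w`,
`G = w` or `G > w` (`WallSystem.FreeFlow.IsDescent.touches_iff`). After the descent the trajectory
is reflected, or turns around, and ascends to the section; this gives a unique first return
(`WallSystem.FreeFlow.exists_isReturnPath`).

Near the energy `h = E - V₁ w` of the second degree of freedom, the section is parametrized by
`(θ, h)` in a `C^r` way, because the action-angle chart is `C^r` (`nonempty_actionAngle`) and `q₁`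
is a simple root of the energy equation. The energy of the second degree of freedom changes along
the flow by `-ε` times the integral of `p₂ ∂₂V_c`, whence `V₁ G = E - h + ε κ(θ, ε, h)` with `κ`
of class `C^r` (`WallSystem.FreeFlow.exists_turning_energy`). The tangency condition `V₁ G = V₁ w`
becomes `h = E - V₁ w + ε κ`, and it has a unique solution `h = E - V₁ w + ε K(θ, ε)` for small
`ε` (`exists_perturbed_root`). The explicit factor `ε` gives the bounds `C ε` on all derivatives
up to the order `r`, without loss of smoothness (`exists_periodicCrClose`). The action is an
increasing `C^r` function of `h`, so that it orders the points of the section like `h`; far from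
the tangency energy the drift estimate suffices.

Finally, the wall-free flow is reversible under `(p₁, p₂) ↦ (-p₁, -p₂)`, and a tangential
trajectory is wall-free up to its return, since the reflection is void at `p₁ = 0`. Read
backwards, it is again tangential (`WallSystem.FreeFlow.IsReturnPath.reverse`). As the reversal
maps `θ` to `-θ` and preserves the action, the image of the singularity curve is the reflected
graph. -/

noncomputable section

universe u

/-! ### Superposition operators and fixed points -/

section Superposition

/-- The pointwise application `(A, v) ↦ (τ ↦ A τ (v τ))` as a continuous bilinear map. -/
def pointwiseApply (K : Type*) [TopologicalSpace K] [CompactSpace K]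
    (E F : Type*) [NormedAddCommGroup E] [NormedSpace ℝ E]
    [NormedAddCommGroup F] [NormedSpace ℝ F] : C(K, E →L[ℝ] F) →L[ℝ] C(K, E) →L[ℝ] C(K, F) :=
  LinearMap.mkContinuous₂
    (LinearMap.mk₂ ℝ (fun (A : C(K, E →L[ℝ] F)) (v : C(K, E)) =>
        (⟨fun τ => A τ (v τ), by fun_prop⟩ : C(K, F)))
      (fun A A' v => by ext; simp) (fun c A v => by ext; simp)
      (fun A v v' => by ext; simp) (fun c A v => by ext; simp)) 1
    (fun A v => by
      rw [one_mul]
      refine (ContinuousMap.norm_le _ (by positivity)).2 fun τ => ?_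
      exact ((A τ).le_opNorm _).trans (mul_le_mul (A.norm_coe_le_norm τ) (v.norm_coe_le_norm τ)
        (norm_nonneg _) (norm_nonneg A)))

variable {K : Type*} [TopologicalSpace K]

/-- The superposition operator `x ↦ f ∘ x` on continuous functions. -/
def superpose {E F : Type*} [TopologicalSpace E] [TopologicalSpace F] (f : E → F)
    (hf : Continuous f) (x : C(K, E)) : C(K, F) := (⟨f, hf⟩ : C(E, F)).comp x

@[simp] lemma superpose_apply {E F : Type*} [TopologicalSpace E] [TopologicalSpace F] (f : E → F)
    (hf : Continuous f) (x : C(K, E)) (τ : K) : superpose f hf x τ = f (x τ) := rfl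

lemma continuous_superpose {E F : Type*} [TopologicalSpace E] [TopologicalSpace F] (f : E → F)
    (hf : Continuous f) : Continuous (superpose f hf : C(K, E) → C(K, F)) :=
  ContinuousMap.continuous_postcomp _

lemma hasFDerivAt_superpose [CompactSpace K] {E : Type*} [NormedAddCommGroup E] [NormedSpace ℝ E]
    {F : Type*} [NormedAddCommGroup F] [NormedSpace ℝ F] {f : E → F}
    (hf : ContDiff ℝ 1 f) (x : C(K, E)) :
    HasFDerivAt (superpose f hf.continuous : C(K, E) → C(K, F))
      (pointwiseApply K E F (superpose (fderiv ℝ f) (hf.continuous_fderiv one_ne_zero) x)) x := by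
  have hc : Continuous (superpose (fderiv ℝ f) (hf.continuous_fderiv one_ne_zero) :
      C(K, E) → C(K, E →L[ℝ] F)) := continuous_superpose _ _
  rw [hasFDerivAt_iff_isLittleO_nhds_zero, Asymptotics.isLittleO_iff]
  intro c hc0
  obtain ⟨δ, hδ, H⟩ := (Metric.continuous_iff (α := C(K, E)) (β := C(K, E →L[ℝ] F))).1 hc x c hc0
  filter_upwards [Metric.ball_mem_nhds (0 : C(K, E)) hδ] with v hv
  rw [mem_ball_zero_iff] at hv
  refine (ContinuousMap.norm_le _ (by positivity)).2 fun τ => ?_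
  have hseg : ∀ y ∈ Metric.ball (x τ) δ, ‖fderiv ℝ f y - fderiv ℝ f (x τ)‖ ≤ c := by
    -- a nearby point `y` is the value at `τ` of a constant shift of the function `x`
    intro y hy
    have h1 := H (x + ContinuousMap.const K (y - x τ)) (by
      rw [dist_eq_norm, add_sub_cancel_left]
      refine lt_of_le_of_lt ((ContinuousMap.norm_le _ (norm_nonneg (y - x τ))).2 fun _ => ?_)
        (by simpa [dist_eq_norm] using hy)
      simp)
    have h2 := (ContinuousMap.dist_apply_le_dist τ).trans h1.le
    simpa [dist_eq_norm] using h2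
  have hvτ : x τ + v τ ∈ Metric.ball (x τ) δ := by
    simpa [dist_eq_norm] using lt_of_le_of_lt (v.norm_coe_le_norm τ) hv
  have := (convex_ball (x τ) δ).norm_image_sub_le_of_norm_fderiv_le' (𝕜 := ℝ)
    (fun y _ => hf.differentiable one_ne_zero y) hseg (Metric.mem_ball_self hδ) hvτ
  simp only [add_sub_cancel_left] at this
  exact this.trans (mul_le_mul_of_nonneg_left (v.norm_coe_le_norm τ) hc0.le)

end Superposition

/-- The superposition operator of a `C^n` map is `C^n`: its derivative is built from the
superposition operator of the derivative, which allows an induction on `n`. Both spaces live in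
one universe since the induction passes from `F` to `E →L[ℝ] F`. -/
lemma contDiff_superpose {K : Type*} [TopologicalSpace K] [CompactSpace K] {E : Type u}
    [NormedAddCommGroup E] [NormedSpace ℝ E] (n : ℕ) : ∀ {F : Type u} [NormedAddCommGroup F]
    [NormedSpace ℝ F] {f : E → F} (hf : ContDiff ℝ n f),
    ContDiff ℝ n (superpose f hf.continuous : C(K, E) → C(K, F)) := by
  induction n with
  | zero =>
    intro F _ _ f hf
    exact contDiff_zero.2 (continuous_superpose _ _)
  | succ n ih =>
    intro F _ _ f hf
    have h1 : ContDiff ℝ 1 f := hf.of_le (by norm_cast; omega)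
    have hd := fun x => hasFDerivAt_superpose (K := K) h1 x
    push_cast
    rw [contDiff_succ_iff_fderiv]
    refine ⟨fun x => (hd x).differentiableAt, by simp, ?_⟩
    have hfd : ContDiff ℝ n (fderiv ℝ f) := hf.fderiv_right (by push_cast; exact le_rfl)
    have : fderiv ℝ (superpose f hf.continuous : C(K, E) → C(K, F)) = fun x =>
        pointwiseApply K E F (superpose (fderiv ℝ f) hfd.continuous x) :=
      funext fun x => (hd x).fderiv
    rw [this]
    exact (pointwiseApply K E F).contDiff.comp (ih hfd)

/-- The fixed point of a `C^n` family of uniform contractions depends `C^n` on the parameter. -/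
lemma contDiffAt_fixedPoint {P X : Type*} [NormedAddCommGroup P] [NormedSpace ℝ P]
    [CompleteSpace P] [NormedAddCommGroup X] [NormedSpace ℝ X] [CompleteSpace X] {n : ℕ}
    (hn : n ≠ 0) {G : P × X → X} (hG : ContDiff ℝ n G) {U : Set P} (hU : IsOpen U) {g : P → X}
    (hLip : ∀ p ∈ U, LipschitzWith (1 / 2) fun x => G (p, x)) (hg : ∀ p ∈ U, G (p, g p) = g p)
    {p : P} (hp : p ∈ U) : ContDiffAt ℝ n g p := by
  have hn' : (n : WithTop ℕ∞) ≠ 0 := by exact_mod_cast hn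
  set f : P × X → X := fun v => v.2 - G v with hf
  have hfC : ContDiff ℝ n f := contDiff_snd.sub hG
  set u : P × X := (p, g p)
  have hfu : f u = 0 := by simp [hf, u, hg p hp]
  set L := fderiv ℝ G u ∘L .inr ℝ P X
  have hL : HasFDerivAt (fun x => G (p, x)) L (g p) :=
    ((hG.differentiable hn' u).hasFDerivAt).comp (g p) (hasFDerivAt_prodMk_right p (g p))
  have hLn : ‖L‖ < 1 := by
    have := hL.le_of_lipschitz (hLip p hp)
    refine lt_of_le_of_lt this ?_
    norm_num
  have hinv : (fderiv ℝ f u ∘L .inr ℝ P X).IsInvertible := by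
    have : fderiv ℝ f u ∘L .inr ℝ P X = 1 - L := by
      have h1 : fderiv ℝ f u = .snd ℝ P X - fderiv ℝ G u := by
        rw [hf, fderiv_fun_sub differentiableAt_snd (hG.differentiable hn' u), fderiv_snd]
      rw [h1]; ext x; simp [L]
    rw [this]
    obtain ⟨A, hA⟩ := isUnit_one_sub_of_norm_lt_one hLn
    exact ⟨ContinuousLinearEquiv.unitsEquiv ℝ X A, by rw [← hA]; rfl⟩
  have hC : ContDiffAt ℝ n f u := hfC.contDiffAt
  refine (hC.contDiffAt_implicitFunction hn' hinv).congr_of_eventuallyEq ?_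
  filter_upwards [hU.mem_nhds hp, hC.eventually_apply_implicitFunction hn' hinv] with q hq hq2
  rw [hfu] at hq2
  have h3 : G (q, hC.implicitFunction hn' hinv q) = hC.implicitFunction hn' hinv q :=
    (sub_eq_zero.1 hq2).symm
  have hc : ContractingWith (1 / 2) fun x => G (q, x) := ⟨by
    rw [← NNReal.coe_lt_coe]; norm_num, hLip q hq⟩
  exact hc.fixedPoint_unique' (hg q hq) h3

/-! ### Smooth dependence of flows -/

section Volterra

open MeasureTheory

/-- The time interval `[-1, 1]`. -/
abbrev UnitTime : Type := Icc (-1 : ℝ) 1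

lemma neg_one_le_one_real : (-1 : ℝ) ≤ 1 := by norm_num

variable {E : Type u} [NormedAddCommGroup E]

/-- A function on `[-1, 1]`, extended to the line by constants. -/
def extendTime (x : C(UnitTime, E)) (t : ℝ) : E := x (projIcc (-1) 1 neg_one_le_one_real t)

lemma continuous_extendTime (x : C(UnitTime, E)) : Continuous (extendTime x) :=
  x.continuous.comp continuous_projIcc

lemma extendTime_coe (x : C(UnitTime, E)) (t : UnitTime) : extendTime x t = x t := by
  simp [extendTime]

variable [NormedSpace ℝ E]

/-- The primitive vanishing at `0`, as an operator on continuous functions on `[-1, 1]`. -/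
def primitiveCLM (E : Type u) [NormedAddCommGroup E] [NormedSpace ℝ E] :
    C(UnitTime, E) →L[ℝ] C(UnitTime, E) :=
  LinearMap.mkContinuous
    { toFun := fun x => ⟨fun t => ∫ s in (0 : ℝ)..t, extendTime x s,
        (intervalIntegral.continuous_primitive
          (fun _ _ => (continuous_extendTime x).intervalIntegrable _ _) 0).comp
          continuous_subtype_val⟩
      map_add' := fun x y => by
        ext t
        exact intervalIntegral.integral_add ((continuous_extendTime x).intervalIntegrable _ _)
          ((continuous_extendTime y).intervalIntegrable _ _)
      map_smul' := fun c x => by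
        ext t
        exact intervalIntegral.integral_smul c _ } 1
    (fun x => by
      rw [one_mul]
      refine (ContinuousMap.norm_le _ (norm_nonneg x)).2 fun t => ?_
      refine (intervalIntegral.norm_integral_le_of_norm_le_const
        (fun s _ => x.norm_coe_le_norm _)).trans ?_
      rw [sub_zero]
      exact mul_le_of_le_one_right (norm_nonneg x) (abs_le.2 ⟨t.2.1, t.2.2⟩))

lemma primitiveCLM_apply (x : C(UnitTime, E)) (t : UnitTime) :
    primitiveCLM E x t = ∫ s in (0 : ℝ)..t, extendTime x s := rfl

/-- Multiplication by the weight `exp (c |t|)`. -/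
def weightCLM (E : Type u) [NormedAddCommGroup E] [NormedSpace ℝ E] (c : ℝ) :
    C(UnitTime, E) →L[ℝ] C(UnitTime, E) :=
  pointwiseApply UnitTime E E
    ⟨fun t => Real.exp (c * |(t : ℝ)|) • ContinuousLinearMap.id ℝ E, by fun_prop⟩

lemma weightCLM_apply (c : ℝ) (x : C(UnitTime, E)) (t : UnitTime) :
    weightCLM E c x t = Real.exp (c * |(t : ℝ)|) • x t := rfl

lemma weightCLM_neg_apply (c : ℝ) (x : C(UnitTime, E)) :
    weightCLM E c (weightCLM E (-c) x) = x := by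
  ext t
  simp only [weightCLM_apply, smul_smul, ← Real.exp_add]
  simp

lemma abs_integral_exp_abs_le {c : ℝ} (hc : 0 < c) (t : ℝ) :
    |∫ s in (0 : ℝ)..t, Real.exp (c * |s|)| ≤ Real.exp (c * |t|) / c := by
  have key : ∀ t : ℝ, 0 ≤ t → ∫ s in (0 : ℝ)..t, Real.exp (c * |s|) =
      (Real.exp (c * t) - 1) / c := by
    intro t ht
    have h1 : ∫ s in (0 : ℝ)..t, Real.exp (c * |s|) = ∫ s in (0 : ℝ)..t, Real.exp (c * s) :=
      intervalIntegral.integral_congr fun s hs => by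
        rw [uIcc_of_le ht] at hs
        simp only [abs_of_nonneg hs.1]
    rw [h1, intervalIntegral.integral_comp_mul_left (fun s => Real.exp s) hc.ne', integral_exp]
    simp [div_eq_inv_mul]
  have h2 : |∫ s in (0 : ℝ)..t, Real.exp (c * |s|)| = (Real.exp (c * |t|) - 1) / c := by
    have h0 : 0 ≤ (Real.exp (c * |t|) - 1) / c :=
      div_nonneg (sub_nonneg.2 (Real.one_le_exp (by positivity))) hc.le
    rcases le_total 0 t with ht | ht
    · rw [key t ht, ← abs_of_nonneg ht, abs_of_nonneg (by simpa using h0)]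
      simp
    · have h3 := intervalIntegral.integral_comp_neg (a := 0) (b := t)
        (fun s => Real.exp (c * |s|))
      simp only [abs_neg, neg_zero] at h3
      rw [h3, intervalIntegral.integral_symm, key (-t) (by linarith), abs_neg,
        ← abs_of_nonpos ht, abs_of_nonneg h0]
  rw [h2]
  gcongr
  linarith

/-- The integral operator of the initial value problem `x' = s f x`, `x 0 = z`, conjugated by the
weight `exp (c |t|)`, which makes it a contraction for large `c`. -/
def picardMap (f : E → E) (hf : Continuous f) (c : ℝ) (v : (ℝ × E) × C(UnitTime, E)) :
    C(UnitTime, E) :=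
  weightCLM E (-c) (ContinuousMap.const _ v.1.2 +
    v.1.1 • primitiveCLM E (superpose f hf (weightCLM E c v.2)))

lemma contDiff_picardMap {n : ℕ} {f : E → E} (hf : ContDiff ℝ n f) (c : ℝ) :
    ContDiff ℝ n (picardMap f hf.continuous c) := by
  have hconst : ContDiff ℝ n fun z : E => (ContinuousMap.const UnitTime z : C(UnitTime, E)) := by
    let T : E →L[ℝ] C(UnitTime, E) := LinearMap.mkContinuous
      { toFun := fun z => ContinuousMap.const UnitTime z
        map_add' := fun _ _ => rfl
        map_smul' := fun _ _ => rfl } 1 (fun z => by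
          rw [one_mul]
          exact (ContinuousMap.norm_le _ (norm_nonneg z)).2 fun t => le_rfl)
    exact T.contDiff
  have h1 : ContDiff ℝ n fun v : (ℝ × E) × C(UnitTime, E) =>
      primitiveCLM E (superpose f hf.continuous (weightCLM E c v.2)) :=
    (primitiveCLM E).contDiff.comp ((contDiff_superpose n hf).comp
      ((weightCLM E c).contDiff.comp contDiff_snd))
  have h2 : ContDiff ℝ n fun v : (ℝ × E) × C(UnitTime, E) => v.1.1 :=
    contDiff_fst.comp contDiff_fst
  exact (weightCLM E (-c)).contDiff.comp
    ((hconst.comp (contDiff_snd.comp contDiff_fst)).add (h2.fun_smul h1))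

lemma lipschitzWith_picardMap {f : E → E} {L : NNReal} (hL : LipschitzWith L f) {c s : ℝ}
    (hc : 0 < c) (hs : |s| * L * 2 ≤ c) (z : E) :
    LipschitzWith (1 / 2) fun x => picardMap f hL.continuous c ((s, z), x) := by
  refine LipschitzWith.of_dist_le_mul fun x y => ?_
  rw [dist_eq_norm, dist_eq_norm]
  refine (ContinuousMap.norm_le _ (by positivity)).2 fun t => ?_
  set X := superpose f hL.continuous (weightCLM E c x)
  set Y := superpose f hL.continuous (weightCLM E c y)
  have h1 : (picardMap f hL.continuous c ((s, z), x) - picardMap f hL.continuous c ((s, z), y)) t =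
      Real.exp (-c * |(t : ℝ)|) • s • ∫ u in (0 : ℝ)..t, extendTime (X - Y) u := by
    rw [← primitiveCLM_apply, map_sub]
    simp only [picardMap, ContinuousMap.sub_apply, weightCLM_apply, ContinuousMap.add_apply,
      ContinuousMap.smul_apply, ContinuousMap.const_apply, ← smul_sub, add_sub_add_left_eq_sub]
    rfl
  have h2 : ‖∫ u in (0 : ℝ)..t, extendTime (X - Y) u‖ ≤
      |∫ u in (0 : ℝ)..t, (L * ‖x - y‖) * Real.exp (c * |u|)| := by
    refine intervalIntegral.norm_integral_le_abs_of_norm_le ?_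
      (Continuous.intervalIntegrable (by fun_prop) _ _)
    refine (ae_restrict_mem measurableSet_uIoc).mono fun u hu => ?_
    have hu' : u ∈ Icc (-1 : ℝ) 1 := by
      have ht := t.2
      rcases le_total 0 (t : ℝ) with h | h
      · rw [uIoc_of_le h] at hu; exact ⟨by linarith [hu.1], hu.2.trans ht.2⟩
      · rw [uIoc_of_ge h] at hu; exact ⟨by linarith [hu.1, ht.1], by linarith [hu.2]⟩
    have h3 : extendTime (X - Y) u = X ⟨u, hu'⟩ - Y ⟨u, hu'⟩ := extendTime_coe (X - Y) ⟨u, hu'⟩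
    rw [h3, ← dist_eq_norm]
    refine (hL.dist_le_mul _ _).trans ?_
    rw [mul_assoc]
    refine mul_le_mul_of_nonneg_left ?_ L.2
    rw [dist_eq_norm, weightCLM_apply, weightCLM_apply, ← smul_sub, norm_smul, mul_comm,
      Real.norm_of_nonneg (Real.exp_pos _).le]
    exact mul_le_mul_of_nonneg_right ((x - y).norm_coe_le_norm ⟨u, hu'⟩) (Real.exp_pos _).le
  rw [intervalIntegral.integral_const_mul, abs_mul, abs_of_nonneg (by positivity)] at h2
  have h4 := abs_integral_exp_abs_le hc (t : ℝ)
  rw [h1, norm_smul, norm_smul, Real.norm_of_nonneg (Real.exp_pos _).le, Real.norm_eq_abs]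
  calc Real.exp (-c * |(t : ℝ)|) * (|s| * ‖∫ u in (0 : ℝ)..t, extendTime (X - Y) u‖)
      ≤ Real.exp (-c * |(t : ℝ)|) * (|s| * (L * ‖x - y‖ * (Real.exp (c * |(t : ℝ)|) / c))) := by
        gcongr
        exact h2.trans (by gcongr)
    _ = (|s| * L / c) * ‖x - y‖ := by
        rw [neg_mul, Real.exp_neg]
        field_simp
    _ ≤ _ := by
        gcongr
        rw [div_le_iff₀ hc]
        push_cast
        linarith

/-- Solutions of `x' = s f x`, `x 0 = z` on `[-1, 1]`, depending `C^n` on `(s, z)`. The speed `s`,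
up to an arbitrary bound `S`, replaces the time: the flow at time `s` is the value of the solution
at `1`. -/
lemma exists_contDiffAt_solution [CompleteSpace E] {n : ℕ} (hn : n ≠ 0) {f : E → E}
    (hf : ContDiff ℝ n f) {L : NNReal} (hL : LipschitzWith L f) (S : ℝ) :
    ∃ X : ℝ × E → C(UnitTime, E), ∀ p : ℝ × E, |p.1| < S → ContDiffAt ℝ n X p ∧
      ∀ t : UnitTime, X p t = p.2 + p.1 • ∫ u in (0 : ℝ)..t, f (extendTime (X p) u) := by
  classical
  set c : ℝ := |S| * L * 2 + 1
  have hc : 0 < c := by positivity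
  have hLip : ∀ p ∈ {p : ℝ × E | |p.1| < S},
      LipschitzWith (1 / 2) fun x => picardMap f hf.continuous c (p, x) := by
    intro p hp
    refine lipschitzWith_picardMap hL hc ?_ p.2
    have : |p.1| ≤ |S| := hp.le.trans (le_abs_self S)
    have : |p.1| * L * 2 ≤ |S| * L * 2 := by gcongr
    linarith
  have hfix : ∀ p : ℝ × E, ∃ y, p ∈ {p : ℝ × E | |p.1| < S} →
      picardMap f hf.continuous c (p, y) = y := by
    intro p
    by_cases hp : p ∈ {p : ℝ × E | |p.1| < S}
    · have hcon : ContractingWith (1 / 2) fun x => picardMap f hf.continuous c (p, x) :=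
        ⟨by rw [← NNReal.coe_lt_coe]; norm_num, hLip p hp⟩
      exact ⟨ContractingWith.fixedPoint _ hcon, fun _ => hcon.fixedPoint_isFixedPt⟩
    · exact ⟨0, fun h => absurd h hp⟩
  choose y hy using hfix
  have hopen : IsOpen {p : ℝ × E | |p.1| < S} :=
    isOpen_lt (continuous_abs.comp continuous_fst) continuous_const
  refine ⟨fun p => weightCLM E c (y p), fun p hp => ⟨?_, fun t => ?_⟩⟩
  · exact (weightCLM E c).contDiff.contDiffAt.comp p
      (contDiffAt_fixedPoint hn (contDiff_picardMap hf c) hopen hLip hy hp)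
  · have h1 := congrArg (weightCLM E c) (hy p hp)
    rw [picardMap, weightCLM_neg_apply] at h1
    have h2 := DFunLike.congr_fun h1 t
    rw [← h2]
    rfl

end Volterra

/-- A globally Lipschitz `C^n` vector field has a global `C^n` flow. -/
theorem exists_contDiff_flow {E : Type u} [NormedAddCommGroup E] [NormedSpace ℝ E]
    [CompleteSpace E] {n : ℕ} (hn : n ≠ 0) {f : E → E} (hf : ContDiff ℝ n f) {L : NNReal}
    (hL : LipschitzWith L f) :
    ∃ φ : ℝ → E → E, ContDiff ℝ n (fun p : ℝ × E => φ p.1 p.2) ∧ (∀ z, φ 0 z = z) ∧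
      ∀ t z, HasDerivAt (fun s => φ s z) (f (φ t z)) t := by
  choose X hX using exists_contDiffAt_solution hn hf hL
  have hderiv : ∀ S : ℝ, ∀ p : ℝ × E, |p.1| < S → ∀ t ∈ Ioo (-1 : ℝ) 1,
      HasDerivAt (extendTime (X S p)) (p.1 • f (extendTime (X S p) t)) t := by
    intro S p hp t ht
    have h1 : HasDerivAt (fun t => p.2 + p.1 • ∫ u in (0 : ℝ)..t, f (extendTime (X S p) u))
        (p.1 • f (extendTime (X S p) t)) t :=
      (((hf.continuous.comp (continuous_extendTime (X S p))).integral_hasStrictDerivAt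
        0 t).hasDerivAt.const_smul p.1).const_add p.2
    refine h1.congr_of_eventuallyEq ?_
    filter_upwards [isOpen_Ioo.mem_nhds ht] with u hu
    have := (hX S p hp).2 ⟨u, Ioo_subset_Icc_self hu⟩
    rw [← extendTime_coe] at this
    exact this
  have hzero : ∀ S : ℝ, ∀ p : ℝ × E, |p.1| < S → extendTime (X S p) 0 = p.2 := by
    intro S p hp
    have := (hX S p hp).2 ⟨0, by norm_num, by norm_num⟩
    rw [← extendTime_coe] at this
    simpa using this
  -- the solution at time `u` of the equation with speed `s` depends only on `s u`
  have huniq : ∀ S S' s s' u u' : ℝ, ∀ z : E, |s| < S → |s'| < S' → u ∈ Icc (-1 : ℝ) 1 →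
      u' ∈ Icc (-1 : ℝ) 1 → s * u = s' * u' →
      extendTime (X S (s, z)) u = extendTime (X S' (s', z)) u' := by
    intro S S' s s' u u' z hs hs' hu hu' he
    have hmem : ∀ u ∈ Icc (-1 : ℝ) 1, ∀ t ∈ Ioo (-1 : ℝ) 1, t * u ∈ Ioo (-1 : ℝ) 1 := by
      intro u hu t ht
      rw [mem_Ioo, ← abs_lt] at ht ⊢
      rw [abs_mul]
      exact lt_of_le_of_lt (mul_le_of_le_one_right (abs_nonneg t) (abs_le.2 hu)) ht
    have hd : ∀ S s u : ℝ, |s| < S → u ∈ Icc (-1 : ℝ) 1 → ∀ t ∈ Ioo (-1 : ℝ) 1,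
        HasDerivAt (fun t => extendTime (X S (s, z)) (t * u))
          ((s * u) • f (extendTime (X S (s, z)) (t * u))) t := by
      intro S s u hs hu t ht
      have := (hderiv S (s, z) hs (t * u) (hmem u hu t ht)).scomp t
        ((hasDerivAt_id t).mul_const u)
      simpa [smul_smul, mul_comm, Function.comp_def] using this
    have hE := ODE_solution_unique_of_mem_Icc (v := fun _ x => (s * u) • f x)
      (s := fun _ => univ) (K := ‖s * u‖₊ * L) (a := -1) (b := 1) (t₀ := 0)
      (f := fun t => extendTime (X S (s, z)) (t * u))
      (g := fun t => extendTime (X S' (s', z)) (t * u'))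
      (fun t _ => by
        rw [lipschitzOnWith_univ]
        exact (lipschitzWith_smul (s * u)).comp hL)
      (by norm_num) (((continuous_extendTime _).comp (by fun_prop)).continuousOn)
      (hd S s u hs hu) (fun _ _ => trivial)
      (((continuous_extendTime _).comp (by fun_prop)).continuousOn)
      (fun t ht => by simpa only [he] using hd S' s' u' hs' hu' t ht) (fun _ _ => trivial)
      (by simp [hzero S (s, z) hs, hzero S' (s', z) hs'])
    simpa using hE (right_mem_Icc.2 neg_one_le_one_real)
  have h11 : (1 : ℝ) ∈ Icc (-1 : ℝ) 1 := by norm_num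
  refine ⟨fun t z => extendTime (X (|t| + 1) (t, z)) 1, ?_, fun z => ?_, fun t z => ?_⟩
  · rw [contDiff_iff_contDiffAt]
    rintro ⟨t, z⟩
    have hev : ContDiff ℝ n fun x : C(UnitTime, E) => extendTime x 1 := by
      let e : C(UnitTime, E) →L[ℝ] E :=
        ContinuousMap.evalCLM ℝ (projIcc (-1 : ℝ) 1 neg_one_le_one_real 1)
      exact e.contDiff
    have h1 : ContDiffAt ℝ n (fun p : ℝ × E => extendTime (X (|t| + 2) p) 1) (t, z) :=
      ContDiffAt.comp (g := fun x : C(UnitTime, E) => extendTime x 1) (t, z)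
        hev.contDiffAt (hX (|t| + 2) (t, z) (by simp)).1
    refine h1.congr_of_eventuallyEq ?_
    have : ∀ᶠ p : ℝ × E in 𝓝 (t, z), |p.1| < |t| + 2 :=
      (isOpen_lt (continuous_abs.comp continuous_fst) continuous_const).mem_nhds (by simp)
    filter_upwards [this] with p hp
    exact huniq _ _ _ _ _ _ _ (by simp) hp h11 h11 rfl
  · have h1 := huniq _ _ 0 0 1 0 z (lt_add_one |(0 : ℝ)|) (lt_add_one |(0 : ℝ)|) h11
      (by norm_num) (by simp)
    exact h1.trans (hzero _ _ (by simp))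
  · set T := |t| + 1 with hT
    have hT0 : 0 < T := by positivity
    have hTt : t / T ∈ Ioo (-1 : ℝ) 1 := by
      rw [mem_Ioo, ← abs_lt, abs_div, abs_of_pos hT0, div_lt_one hT0]
      linarith
    have hTT : |T| < |T| + 1 := by simp
    have h1 := (hderiv (|T| + 1) (T, z) hTT (t / T) hTt).scomp t ((hasDerivAt_id t).div_const T)
    have heq : ∀ s : ℝ, |s| < T → extendTime (X (|s| + 1) (s, z)) 1 =
        extendTime (X (|T| + 1) (T, z)) (s / T) := by
      intro s hs
      refine huniq _ _ _ _ _ _ _ (by simp) hTT h11 ?_ (by field_simp)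
      rw [mem_Icc, ← abs_le, abs_div, abs_of_pos hT0, div_le_one hT0]
      exact hs.le
    simp only [smul_smul, one_div, inv_mul_cancel₀ hT0.ne', one_smul, Function.comp_def, id] at h1
    simp only
    rw [heq t (by simp [hT])]
    refine h1.congr_of_eventuallyEq ?_
    filter_upwards [(isOpen_lt continuous_abs continuous_const).mem_nhds
      (show |t| < T by simp [hT])] with s hs
    exact heq s hs

/-- The flow of a globally Lipschitz `C^n` vector field together with the integrals of a `C^n`
function along its trajectories, which are an additional coordinate of an extended flow. -/
theorem exists_contDiff_flow_integral {E : Type} [NormedAddCommGroup E] [NormedSpace ℝ E]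
    [CompleteSpace E] {n : ℕ} (hn : n ≠ 0) {f : E → E} (hf : ContDiff ℝ n f) {L : NNReal}
    (hL : LipschitzWith L f) {g : E → ℝ} (hg : ContDiff ℝ n g) {M : NNReal}
    (hM : LipschitzWith M g) :
    ∃ φ : ℝ → E → E, ∃ k : ℝ → E → ℝ, ContDiff ℝ n (fun p : ℝ × E => φ p.1 p.2) ∧
      ContDiff ℝ n (fun p : ℝ × E => k p.1 p.2) ∧ (∀ z, φ 0 z = z) ∧ (∀ z, k 0 z = 0) ∧
      (∀ t z, HasDerivAt (fun s => φ s z) (f (φ t z)) t) ∧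
      ∀ t z, HasDerivAt (fun s => k s z) (g (φ t z)) t := by
  obtain ⟨Φ, hΦ, h0, hd⟩ := exists_contDiff_flow (E := E × ℝ) hn (f := fun x => (f x.1, g x.1))
    ((hf.comp contDiff_fst).prodMk (hg.comp contDiff_fst))
    ((hL.comp LipschitzWith.prod_fst).prodMk (hM.comp LipschitzWith.prod_fst))
  have hc : ContDiff ℝ n fun p : ℝ × E => Φ p.1 (p.2, 0) :=
    hΦ.comp (contDiff_fst.prodMk (contDiff_snd.prodMk contDiff_const))
  refine ⟨fun t z => (Φ t (z, 0)).1, fun t z => (Φ t (z, 0)).2, hc.fst, hc.snd,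
    fun z => by simp [h0], fun z => by simp [h0], fun t z => ?_, fun t z => ?_⟩
  · exact (hasFDerivAt_fst.comp_hasDerivAt t (hd t (z, 0)) :)
  · exact (hasFDerivAt_snd.comp_hasDerivAt t (hd t (z, 0)) :)

/-! ### Implicit functions and first zeros -/

section ImplicitFunctions

variable {P : Type*} [NormedAddCommGroup P] [NormedSpace ℝ P] [CompleteSpace P] {n : ℕ}

/-- A continuous solution `g` of the scalar equation `F (p, g p) = const` is `C^n` where the
derivative in the unknown does not vanish. -/
lemma contDiffAt_of_implicit (hn : n ≠ 0) {F : P × ℝ → ℝ} {g : P → ℝ} {p : P}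
    (hF : ContDiffAt ℝ n F (p, g p)) {d : ℝ} (hd : HasDerivAt (fun y => F (p, y)) d (g p))
    (hd0 : d ≠ 0) (hg : ContinuousAt g p) (h0 : ∀ᶠ q in 𝓝 p, F (q, g q) = F (p, g p)) :
    ContDiffAt ℝ n g p := by
  have hn' : (n : WithTop ℕ∞) ≠ 0 := by exact_mod_cast hn
  have hinv : (fderiv ℝ F (p, g p) ∘L .inr ℝ P ℝ).IsInvertible := by
    have h1 : HasFDerivAt (fun y => F (p, y)) (fderiv ℝ F (p, g p) ∘L .inr ℝ P ℝ) (g p) :=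
      (hF.differentiableAt hn').hasFDerivAt.comp (g p) (hasFDerivAt_prodMk_right p (g p))
    have h2 := h1.unique hd.hasFDerivAt
    refine ⟨ContinuousLinearEquiv.unitsEquivAut ℝ (Units.mk0 d hd0), ?_⟩
    rw [h2]
    ext
    simp
  refine (hF.contDiffAt_implicitFunction hn' hinv).congr_of_eventuallyEq ?_
  have h3 : Tendsto (fun q => (q, g q)) (𝓝 p) (𝓝 (p, g p)) := by
    rw [nhds_prod_eq]
    exact tendsto_id.prodMk hg
  filter_upwards [h3.eventually (hF.eventually_apply_eq_iff_implicitFunction hn' hinv), h0]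
    with q hq hq0
  exact (hq.1 hq0).symm

/-- The root of a family of increasing functions with a sign change on a fixed interval. -/
lemma exists_contDiffAt_root (hn : n ≠ 0) {F : P × ℝ → ℝ} {U : Set P} (hU : IsOpen U) {a b : ℝ}
    (hab : a < b) (hF : ∀ p ∈ U, ∀ y ∈ Ioo a b, ContDiffAt ℝ n F (p, y))
    (hc : ∀ p ∈ U, ContinuousOn (fun y => F (p, y)) (Icc a b))
    (hd : ∀ p ∈ U, ∀ y ∈ Ioo a b, 0 < deriv (fun y => F (p, y)) y)
    (ha : ∀ p ∈ U, F (p, a) < 0) (hb : ∀ p ∈ U, 0 < F (p, b)) :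
    ∃ g : P → ℝ, ∀ p ∈ U, g p ∈ Ioo a b ∧ F (p, g p) = 0 ∧ ContDiffAt ℝ n g p ∧
      ∀ y ∈ Icc a b, (F (p, y) < 0 ↔ y < g p) ∧ (F (p, y) = 0 ↔ y = g p) := by
  classical
  have hmono : ∀ p ∈ U, StrictMonoOn (fun y => F (p, y)) (Icc a b) := fun p hp =>
    strictMonoOn_of_deriv_pos (convex_Icc a b) (hc p hp) (by simpa using hd p hp)
  have hex : ∀ p, ∃ y, p ∈ U → y ∈ Ioo a b ∧ F (p, y) = 0 := by
    intro p
    by_cases hp : p ∈ U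
    · obtain ⟨y, hy, hy0⟩ := intermediate_value_Ioo hab.le (hc p hp) ⟨ha p hp, hb p hp⟩
      exact ⟨y, fun _ => ⟨hy, hy0⟩⟩
    · exact ⟨0, fun h => absurd h hp⟩
  choose g hg using hex
  have hlt : ∀ p ∈ U, ∀ y ∈ Icc a b, (F (p, y) < 0 ↔ y < g p) := fun p hp y hy => by
    rw [← (hmono p hp).lt_iff_lt hy (Ioo_subset_Icc_self (hg p hp).1)]
    simp only [(hg p hp).2]
  have heq : ∀ p ∈ U, ∀ y ∈ Icc a b, (F (p, y) = 0 ↔ y = g p) := fun p hp y hy => by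
    rw [← (hmono p hp).injOn.eq_iff hy (Ioo_subset_Icc_self (hg p hp).1)]
    simp only [(hg p hp).2]
  refine ⟨g, fun p hp => ⟨(hg p hp).1, (hg p hp).2, ?_, fun y hy =>
    ⟨hlt p hp y hy, heq p hp y hy⟩⟩⟩
  have hgp := (hg p hp).1
  have hn' : (n : WithTop ℕ∞) ≠ 0 := by exact_mod_cast hn
  have hFp : ∀ y ∈ Ioo a b, ContinuousAt (fun q => F (q, y)) p := fun y hy =>
    ContinuousAt.comp (f := fun q : P => (q, y)) (hF p hp y hy).continuousAt (by fun_prop)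
  have hcont : ContinuousAt g p := by
    refine tendsto_order.2 ⟨fun l hl => ?_, fun l hl => ?_⟩
    · obtain ⟨m, hm, hm'⟩ := exists_between (max_lt hl hgp.1)
      have hmI : m ∈ Ioo a b := ⟨(le_max_right _ _).trans_lt hm, hm'.trans hgp.2⟩
      filter_upwards [hU.mem_nhds hp, (hFp m hmI).eventually_lt continuousAt_const
        ((hlt p hp m (Ioo_subset_Icc_self hmI)).2 hm')] with q hq hq1
      exact ((le_max_left _ _).trans_lt hm).trans
        ((hlt q hq m (Ioo_subset_Icc_self hmI)).1 hq1)
    · obtain ⟨m, hm, hm'⟩ := exists_between (lt_min hl hgp.2)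
      have hmI : m ∈ Ioo a b := ⟨hgp.1.trans hm, hm'.trans_le (min_le_right _ _)⟩
      have h0 : 0 < F (p, m) := by
        rcases lt_trichotomy (F (p, m)) 0 with h | h | h
        · exact absurd ((hlt p hp m (Ioo_subset_Icc_self hmI)).1 h) hm.not_gt
        · exact absurd ((heq p hp m (Ioo_subset_Icc_self hmI)).1 h) hm.ne'
        · exact h
      filter_upwards [hU.mem_nhds hp, continuousAt_const.eventually_lt (hFp m hmI) h0]
        with q hq hq1
      refine lt_of_lt_of_le ?_ (hm'.le.trans (min_le_left _ _))
      by_contra h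
      rcases (not_lt.1 h).eq_or_lt with h | h
      · exact hq1.ne' ((heq q hq m (Ioo_subset_Icc_self hmI)).2 h)
      · exact hq1.not_gt ((hlt q hq m (Ioo_subset_Icc_self hmI)).2 h)
  have hdiff : DifferentiableAt ℝ (fun y => F (p, y)) (g p) :=
    DifferentiableAt.comp (g p) ((hF p hp _ hgp).differentiableAt hn')
      ((differentiableAt_const p).prodMk differentiableAt_id)
  refine contDiffAt_of_implicit hn (hF p hp _ hgp) hdiff.hasDerivAt (hd p hp _ hgp).ne' hcont ?_
  filter_upwards [hU.mem_nhds hp] with q hq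
  rw [(hg q hq).2, (hg p hp).2]

omit [NormedSpace ℝ P] [CompleteSpace P] in
/-- A trajectory which leaves `0` downwards and stays negative on `(0, b]` does so together with
the nearby ones. -/
lemma eventually_forall_neg {y F : P × ℝ → ℝ} {U : Set P} (hU : IsOpen U)
    (hy : ContinuousOn y (U ×ˢ univ)) (hF : ContinuousOn F (U ×ˢ univ))
    (hd : ∀ p ∈ U, ∀ t, HasDerivAt (fun t => y (p, t)) (F (p, t)) t)
    (h0 : ∀ p ∈ U, y (p, 0) = 0) {p : P} (hp : p ∈ U) (hF0 : F (p, 0) < 0) {b : ℝ}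
    (hneg : ∀ t ∈ Ioc 0 b, y (p, t) < 0) :
    ∀ᶠ q in 𝓝 p, ∀ t ∈ Ioc 0 b, y (q, t) < 0 := by
  have hopen : IsOpen (U ×ˢ (univ : Set ℝ)) := hU.prod isOpen_univ
  have hF1 : ∀ᶠ v in 𝓝 (p, (0 : ℝ)), F v < 0 :=
    (hF.continuousAt (hopen.mem_nhds ⟨hp, trivial⟩)).eventually_lt continuousAt_const hF0
  rw [nhds_prod_eq] at hF1
  obtain ⟨pa, hpa, pb, hpb, hab⟩ := eventually_prod_iff.1 hF1
  obtain ⟨δ, hδ, hδb⟩ := Metric.eventually_nhds_iff.1 hpb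
  have hcomp : ∀ᶠ q in 𝓝 p, ∀ t ∈ Icc (δ / 2) b, y (q, t) < 0 := by
    refine isCompact_Icc.eventually_forall_of_forall_eventually fun t ht => ?_
    have := (hy.continuousAt (hopen.mem_nhds ⟨hp, trivial⟩)).eventually_lt
      (continuousAt_const (y := (0 : ℝ))) (hneg t ⟨by linarith [ht.1], ht.2⟩)
    exact this
  filter_upwards [hU.mem_nhds hp, hpa, hcomp] with q hq hqa hqc t ht
  rcases le_total (δ / 2) t with h | h
  · exact hqc t ⟨h, ht.2⟩
  · have hanti : StrictAntiOn (fun t => y (q, t)) (Icc 0 (δ / 2)) := by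
      refine strictAntiOn_of_deriv_neg (convex_Icc _ _)
        (fun t _ => (hd q hq t).continuousAt.continuousWithinAt) fun t ht => ?_
      rw [interior_Icc] at ht
      rw [(hd q hq t).deriv]
      exact hab hqa (hδb (by rw [Real.dist_eq, sub_zero, abs_of_pos ht.1]; linarith [ht.2]))
    have := hanti (left_mem_Icc.2 (by linarith)) ⟨ht.1.le, h⟩ ht.1
    simpa [h0 q hq] using this

/-- The first positive zero of a trajectory which leaves `0` downwards and returns transversally
depends `C^n` on parameters. -/
lemma contDiffAt_firstZero (hn : n ≠ 0) {y F : P × ℝ → ℝ} {U : Set P} (hU : IsOpen U)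
    (hy : ContDiffOn ℝ n y (U ×ˢ univ)) (hF : ContinuousOn F (U ×ˢ univ))
    (hd : ∀ p ∈ U, ∀ t, HasDerivAt (fun t => y (p, t)) (F (p, t)) t)
    (h0 : ∀ p ∈ U, y (p, 0) = 0) (hF0 : ∀ p ∈ U, F (p, 0) < 0) {τ : P → ℝ}
    (hτ : ∀ p ∈ U, 0 < τ p ∧ y (p, τ p) = 0 ∧ 0 < F (p, τ p) ∧ ∀ t ∈ Ioo 0 (τ p), y (p, t) < 0)
    {p : P} (hp : p ∈ U) : ContDiffAt ℝ n τ p := by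
  obtain ⟨hτ0, hyτ, hFτ, hneg⟩ := hτ p hp
  have hopen : IsOpen (U ×ˢ (univ : Set ℝ)) := hU.prod isOpen_univ
  have hcont : ContinuousAt τ p := by
    refine tendsto_order.2 ⟨fun l hl => ?_, fun l hl => ?_⟩
    · obtain ⟨m, hm, hm'⟩ := exists_between (max_lt hl hτ0)
      have hm0 : 0 < m := (le_max_right _ _).trans_lt hm
      filter_upwards [hU.mem_nhds hp, eventually_forall_neg hU hy.continuousOn hF hd h0 hp
        (hF0 p hp) (b := m) fun t ht => hneg t ⟨ht.1, ht.2.trans_lt hm'⟩] with q hq hq1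
      refine ((le_max_left _ _).trans_lt hm).trans (lt_of_not_ge fun h => ?_)
      exact (hq1 (τ q) ⟨(hτ q hq).1, h⟩).ne (hτ q hq).2.1
    · have hpos : ∀ᶠ t in 𝓝[>] τ p, 0 < y (p, t) := by
        have h1 := (hd p hp (τ p)).hasDerivWithinAt (s := Ioi (τ p))
        have h2 := (hasDerivWithinAt_iff_tendsto_slope' (by simp)).1 h1
        filter_upwards [h2.eventually (lt_mem_nhds hFτ), self_mem_nhdsWithin] with t ht ht'
        rw [slope_def_field, hyτ, sub_zero] at ht
        exact (div_pos_iff_of_pos_right (sub_pos.2 ht')).1 ht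
      obtain ⟨m, hm, hml⟩ := (hpos.and (Ioo_mem_nhdsGT hl)).exists
      have hc : ContinuousAt (fun q => y (q, m)) p :=
        ContinuousAt.comp (f := fun q : P => (q, m))
          (hy.continuousOn.continuousAt (hopen.mem_nhds ⟨hp, trivial⟩)) (by fun_prop)
      filter_upwards [hU.mem_nhds hp, continuousAt_const.eventually_lt hc hm] with q hq hq1
      refine lt_of_le_of_lt (not_lt.1 fun h => ?_) hml.2
      exact hq1.not_gt ((hτ q hq).2.2.2 m ⟨hτ0.trans hml.1, h⟩)
  refine contDiffAt_of_implicit hn (hy.contDiffAt (hopen.mem_nhds ⟨hp, trivial⟩))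
    (hd p hp (τ p)) hFτ.ne' hcont ?_
  filter_upwards [hU.mem_nhds hp] with q hq
  rw [hyτ, (hτ q hq).2.1]

end ImplicitFunctions

/-! ### Derivatives in the angle -/

section IteratedDeriv

/-- The partial derivative in the first variable. -/
lemma contDiffOn_deriv_fst {m : ℕ} {W : ℝ × ℝ → ℝ} {J : Set ℝ} (hJ : IsOpen J)
    (hW : ContDiffOn ℝ (m + 1 : ℕ) W (univ ×ˢ J)) :
    ContDiffOn ℝ m (fun p => deriv (fun x => W (x, p.2)) p.1) (univ ×ˢ J) := by
  have ho : IsOpen ((univ : Set ℝ) ×ˢ J) := isOpen_univ.prod hJ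
  have h1 : ContDiffOn ℝ m (fun p => fderiv ℝ W p (1, 0)) (univ ×ˢ J) :=
    (hW.fderiv_of_isOpen ho (by push_cast; exact le_rfl)).clm_apply contDiffOn_const
  refine h1.congr fun p hp => ?_
  have h2 : HasFDerivAt W (fderiv ℝ W p) (p.1, p.2) :=
    ((hW.contDiffAt (ho.mem_nhds hp)).differentiableAt (by simp)).hasFDerivAt
  have h3 := h2.comp_hasDerivAt p.1 ((hasDerivAt_id p.1).prodMk (hasDerivAt_const p.1 p.2))
  exact h3.deriv

lemma contDiffOn_iteratedDeriv_fst {W : ℝ × ℝ → ℝ} {J : Set ℝ} (hJ : IsOpen J) (k : ℕ) :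
    ∀ {m : ℕ}, ContDiffOn ℝ (m + k : ℕ) W (univ ×ˢ J) →
    ContDiffOn ℝ m (fun p => iteratedDeriv k (fun x => W (x, p.2)) p.1) (univ ×ˢ J) := by
  induction k with
  | zero => intro m hW; simpa using hW
  | succ k ih =>
    intro m hW
    have := contDiffOn_deriv_fst hJ (ih (m := m + 1) (by
      convert hW using 2
      ring))
    simpa only [iteratedDeriv_succ] using this

lemma Function.Periodic.iteratedDeriv {f : ℝ → ℝ} {c : ℝ} (hf : Function.Periodic f c) (k : ℕ) :
    Function.Periodic (iteratedDeriv k f) c := by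
  intro x
  have h1 : (fun x => f (x + c)) = f := funext hf
  have h2 := congrFun (iteratedDeriv_comp_add_const k f c) x
  rw [h1] at h2
  exact h2.symm

end IteratedDeriv

/-! ### Oscillators with one degree of freedom -/

section Oscillator

/-- A potential well with its minimum at `0`. -/
structure IsWell (V : ℝ → ℝ) : Prop where
  contDiff : ContDiff ℝ 1 V
  zero : V 0 = 0
  deriv_mul_pos : ∀ q, q ≠ 0 → 0 < q * deriv V q

variable {V : ℝ → ℝ}

namespace IsWell

lemma neg (hV : IsWell V) : IsWell fun q => V (-q) where
  contDiff := hV.contDiff.comp contDiff_neg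
  zero := by simp [hV.zero]
  deriv_mul_pos q hq := by
    have := hV.deriv_mul_pos (-q) (neg_ne_zero.2 hq)
    rw [deriv_comp_neg]
    linarith

lemma differentiable (hV : IsWell V) : Differentiable ℝ V := hV.contDiff.differentiable one_ne_zero

lemma hasDerivAt (hV : IsWell V) (q : ℝ) : HasDerivAt V (deriv V q) q :=
  (hV.differentiable q).hasDerivAt

lemma continuous_deriv (hV : IsWell V) : Continuous (deriv V) := hV.contDiff.continuous_deriv le_rfl

lemma deriv_pos (hV : IsWell V) {q : ℝ} (hq : 0 < q) : 0 < deriv V q :=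
  (pos_iff_pos_of_mul_pos (hV.deriv_mul_pos q hq.ne')).1 hq

lemma deriv_neg (hV : IsWell V) {q : ℝ} (hq : q < 0) : deriv V q < 0 :=
  (neg_iff_neg_of_mul_pos (hV.deriv_mul_pos q hq.ne)).1 hq

lemma strictMonoOn (hV : IsWell V) : StrictMonoOn V (Ici 0) :=
  strictMonoOn_of_deriv_pos (convex_Ici 0) hV.contDiff.continuous.continuousOn fun q hq =>
    hV.deriv_pos (by simpa using hq)

lemma strictAntiOn (hV : IsWell V) : StrictAntiOn V (Iic 0) :=
  strictAntiOn_of_deriv_neg (convex_Iic 0) hV.contDiff.continuous.continuousOn fun q hq =>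
    hV.deriv_neg (by simpa using hq)

lemma pos (hV : IsWell V) {q : ℝ} (hq : q ≠ 0) : 0 < V q := by
  rw [← hV.zero]
  rcases hq.lt_or_gt with h | h
  · exact hV.strictAntiOn (mem_Iic.2 h.le) (mem_Iic.2 le_rfl) h
  · exact hV.strictMonoOn (mem_Ici.2 le_rfl) (mem_Ici.2 h.le) h

lemma nonneg (hV : IsWell V) (q : ℝ) : 0 ≤ V q := by
  rcases eq_or_ne q 0 with rfl | h
  · exact hV.zero.ge
  · exact (hV.pos h).le

lemma exists_lt_of_abs_le (hV : IsWell V) {e : ℝ} (he : 0 < e) :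
    ∃ c > 0, ∀ q, |q| ≤ c → V q < e := by
  have h1 : ∀ᶠ q in 𝓝 (0 : ℝ), V q < e :=
    hV.contDiff.continuous.continuousAt.eventually_lt continuousAt_const (by rwa [hV.zero])
  obtain ⟨δ, hδ, h⟩ := Metric.eventually_nhds_iff.1 h1
  refine ⟨δ / 2, by positivity, fun q hq => h ?_⟩
  rw [Real.dist_eq, sub_zero]
  linarith

lemma exists_lt_abs_deriv (hV : IsWell V) {c : ℝ} (hc : 0 < c) (B : ℝ) :
    ∃ ν > 0, ∀ q, |q| ≤ B → (c ≤ q → ν < deriv V q) ∧ (q ≤ -c → deriv V q < -ν) := by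
  have hK : IsCompact {q : ℝ | |q| ≤ B ∧ c ≤ |q|} := by
    refine (isCompact_Icc (a := -B) (b := B)).of_isClosed_subset ?_ fun q hq => abs_le.1 hq.1
    exact (isClosed_le continuous_abs continuous_const).inter
      (isClosed_le continuous_const continuous_abs)
  rcases Set.eq_empty_or_nonempty {q : ℝ | |q| ≤ B ∧ c ≤ |q|} with h | h
  · refine ⟨1, one_pos, fun q hq => ⟨fun h1 => ?_, fun h1 => ?_⟩⟩
    · exact absurd (show q ∈ {q : ℝ | |q| ≤ B ∧ c ≤ |q|} from ⟨hq, h1.trans (le_abs_self q)⟩)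
        (by simp [h])
    · exact absurd (show q ∈ {q : ℝ | |q| ≤ B ∧ c ≤ |q|} from
        ⟨hq, (le_neg.1 h1).trans (neg_le_abs q)⟩) (by simp [h])
  · obtain ⟨q₀, hq₀, hmin⟩ := hK.exists_isMinOn h
      (continuous_abs.comp hV.continuous_deriv).continuousOn
    have h0 : q₀ ≠ 0 := fun h => by
      have := hq₀.2
      rw [h, abs_zero] at this
      linarith
    have hpos : 0 < |deriv V q₀| := abs_pos.2 fun h => by
      have := hV.deriv_mul_pos q₀ h0
      rw [h, mul_zero] at this
      exact this.false
    refine ⟨|deriv V q₀| / 2, by positivity, fun q hq => ⟨fun h1 => ?_, fun h1 => ?_⟩⟩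
    · have := hmin (show q ∈ _ from ⟨hq, h1.trans (le_abs_self q)⟩)
      have h2 := hV.deriv_pos (hc.trans_le h1)
      simp only [Function.comp_apply, mem_ofPred_eq, abs_of_pos h2] at this
      linarith
    · have := hmin (show q ∈ _ from ⟨hq, (le_neg.1 h1).trans (neg_le_abs q)⟩)
      have h2 := hV.deriv_neg (q := q) (by linarith)
      simp only [Function.comp_apply, mem_ofPred_eq, abs_of_neg h2] at this
      linarith

end IsWell

/-- In a phase of motion to the left of a forced oscillator, the energy changes by at most `ν`
times the distance travelled, however long this takes. -/
lemma energy_drift (hV : IsWell V) {x y F : ℝ → ℝ} {ν s t : ℝ} (hst : s ≤ t)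
    (hx : ∀ u ∈ Icc s t, HasDerivAt x (y u) u) (hy : ∀ u ∈ Icc s t, HasDerivAt y (F u) u)
    (hν : ∀ u ∈ Icc s t, |F u + deriv V (x u)| ≤ ν) (hneg : ∀ u ∈ Ioo s t, y u ≤ 0) :
    |y t ^ 2 / 2 + V (x t) - (y s ^ 2 / 2 + V (x s))| ≤ ν * (x s - x t) := by
  have hE : ∀ u ∈ Icc s t, HasDerivAt (fun u => y u ^ 2 / 2 + V (x u))
      (y u * (F u + deriv V (x u))) u := by
    intro u hu
    have h1 := (((hy u hu).pow 2).div_const 2).add ((hV.hasDerivAt (x u)).comp u (hx u hu))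
    refine h1.congr_deriv ?_
    simp only [Nat.cast_ofNat, Nat.add_one_sub_one, pow_one]
    ring
  have h1 : AntitoneOn (fun u => y u ^ 2 / 2 + V (x u) + ν * x u) (Icc s t) := by
    refine antitoneOn_of_deriv_nonpos (convex_Icc s t) (fun u hu =>
      ((hE u hu).add ((hx u hu).const_mul ν)).continuousAt.continuousWithinAt) (fun u hu => ?_)
      fun u hu => ?_
    · rw [interior_Icc] at hu
      exact ((hE u (Ioo_subset_Icc_self hu)).add ((hx u
        (Ioo_subset_Icc_self hu)).const_mul ν)).differentiableAt.differentiableWithinAt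
    · rw [interior_Icc] at hu
      have hu' := Ioo_subset_Icc_self hu
      have h2 := ((hE u hu').add ((hx u hu').const_mul ν)).deriv
      simp only [Pi.add_def] at h2
      rw [h2]
      nlinarith [hneg u hu, (abs_le.1 (hν u hu')).1]
  have h2 : MonotoneOn (fun u => y u ^ 2 / 2 + V (x u) - ν * x u) (Icc s t) := by
    refine monotoneOn_of_deriv_nonneg (convex_Icc s t) (fun u hu =>
      ((hE u hu).sub ((hx u hu).const_mul ν)).continuousAt.continuousWithinAt) (fun u hu => ?_)
      fun u hu => ?_
    · rw [interior_Icc] at hu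
      exact ((hE u (Ioo_subset_Icc_self hu)).sub ((hx u
        (Ioo_subset_Icc_self hu)).const_mul ν)).differentiableAt.differentiableWithinAt
    · rw [interior_Icc] at hu
      have hu' := Ioo_subset_Icc_self hu
      have h2 := ((hE u hu').sub ((hx u hu').const_mul ν)).deriv
      simp only [Pi.sub_def] at h2
      rw [h2]
      nlinarith [hneg u hu, (abs_le.1 (hν u hu')).2]
  have h3 := h1 (left_mem_Icc.2 hst) (right_mem_Icc.2 hst) hst
  have h4 := h2 (left_mem_Icc.2 hst) (right_mem_Icc.2 hst) hst
  simp only at h3 h4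
  rw [abs_le]
  constructor <;> nlinarith

/-- A trajectory of a weakly forced oscillator which starts to the left from `x ≥ η` turns around
at a point with `x ≤ -c`. By the energy drift it crosses `|x| ≤ c` with a definite speed, and
outside of this interval the force is bounded away from `0`. -/
lemma exists_turning (hV : IsWell V) {η c₀ : ℝ} (hη : 0 < η) (hc₀ : 0 < c₀) (B : ℝ) :
    ∃ c > 0, c ≤ c₀ ∧ ∃ ν > 0,
      (∀ q, |q| ≤ B → (c ≤ q → ν < deriv V q) ∧ (q ≤ -c → deriv V q < -ν)) ∧
      ∀ x y F : ℝ → ℝ, (∀ t, HasDerivAt x (y t) t) → (∀ t, HasDerivAt y (F t) t) →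
        (∀ t, |F t + deriv V (x t)| ≤ ν) → (∀ t, |x t| ≤ B) → η ≤ x 0 →
        (∃ δ > 0, ∀ t ∈ Ioo 0 δ, y t < 0) →
        ∃ t > 0, y t = 0 ∧ (∀ s ∈ Ioo 0 t, y s < 0) ∧ x t ≤ -c ∧ 0 < F t := by
  have he : 0 < V η / 2 := half_pos (hV.pos hη.ne')
  obtain ⟨c₁, hc₁, hVc⟩ := hV.exists_lt_of_abs_le (half_pos he)
  set c := min c₁ c₀
  have hc : 0 < c := lt_min hc₁ hc₀
  obtain ⟨ν₁, hν₁, hder⟩ := hV.exists_lt_abs_deriv hc B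
  set ν := min (ν₁ / 2) (V η / 2 / (2 * |B| + 1)) with hνdef
  have hν : 0 < ν := lt_min (by positivity) (by positivity)
  have hνν : ν ≤ ν₁ / 2 := min_le_left _ _
  have hνe : ν * (2 * |B|) ≤ V η / 2 := by
    have h1 : ν ≤ V η / 2 / (2 * |B| + 1) := min_le_right _ _
    rw [le_div_iff₀ (by positivity)] at h1
    nlinarith
  refine ⟨c, hc, min_le_right _ _, ν, hν, fun q hq => ⟨fun h => ?_, fun h => ?_⟩, ?_⟩
  · linarith [(hder q hq).1 h]
  · linarith [(hder q hq).2 h]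
  intro x y F hx hy hF hB hx0 ⟨δ, hδ, hyδ⟩
  have hBx : ∀ t, -|B| ≤ x t ∧ x t ≤ |B| := fun t =>
    abs_le.1 ((hB t).trans (le_abs_self B))
  -- in the first descent the energy stays above `V η / 2`, hence above the potential on `[-c, c]`
  have hdrift : ∀ t, 0 ≤ t → (∀ s ∈ Ioo 0 t, y s < 0) → V η / 2 ≤ y t ^ 2 / 2 + V (x t) := by
    intro t ht hs
    have h1 := energy_drift hV ht (fun u _ => hx u) (fun u _ => hy u) (fun u _ => hF u)
      fun u hu => (hs u hu).le
    have h2 : V η ≤ V (x 0) := hV.strictMonoOn.monotoneOn (mem_Ici.2 hη.le)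
      (mem_Ici.2 (hη.le.trans hx0)) hx0
    have h3 := (abs_le.1 h1).1
    have h4 : ν * (x 0 - x t) ≤ ν * (2 * |B|) := by
      gcongr
      linarith [(hBx 0).2, (hBx t).1]
    nlinarith [sq_nonneg (y 0)]
  have hFright : ∀ t, c ≤ x t → F t ≤ -ν := fun t ht => by
    linarith [(abs_le.1 (hF t)).2, (hder _ (hB t)).1 ht]
  have hFleft : ∀ t, x t ≤ -c → ν ≤ F t := fun t ht => by
    linarith [(abs_le.1 (hF t)).1, (hder _ (hB t)).2 ht]
  -- a derivative bounded away from zero makes a function unbounded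
  have hgrow : ∀ f f' : ℝ → ℝ, ∀ t₀ m D : ℝ, (∀ t, HasDerivAt f (f' t) t) → 0 < m →
      (∀ t, t₀ ≤ t → m ≤ f' t) → (∀ t, t₀ ≤ t → f t ≤ D) → False := by
    intro f f' t₀ m D hf hm hf' hD
    set T := (D - f t₀) / m + 1
    have hT : 0 < T :=
      add_pos_of_nonneg_of_pos (div_nonneg (sub_nonneg.2 (hD t₀ le_rfl)) hm.le) one_pos
    have h1 := (convex_Ici t₀).mul_sub_le_image_sub_of_le_deriv
      (fun t _ => (hf t).continuousAt.continuousWithinAt)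
      (fun t _ => (hf t).differentiableAt.differentiableWithinAt) (C := m) (fun t ht => by
        rw [interior_Ici] at ht
        rw [(hf t).deriv]
        exact hf' t (le_of_lt ht)) t₀ self_mem_Ici (t₀ + T) (mem_Ici.2 (by linarith)) (by linarith)
    have h2 := hD (t₀ + T) (by linarith)
    have h3 : m * T = D - f t₀ + m := by simp only [T]; field_simp
    rw [add_sub_cancel_left, h3] at h1
    linarith
  have hyc : Continuous y := continuous_iff_continuousAt.2 fun t => (hy t).continuousAt
  have hex : ∃ t > 0, y t = 0 := by
    by_contra hno
    push Not at hno
    have hyneg : ∀ t > 0, y t < 0 := by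
      intro t ht
      by_contra h
      have h1 : y (min (δ / 2) t) ≤ 0 := by
        rcases le_total (δ / 2) t with h2 | h2
        · rw [min_eq_left h2]; exact (hyδ _ ⟨by linarith, by linarith⟩).le
        · rw [min_eq_right h2]
          exact (hyδ _ ⟨ht, by linarith⟩).le
      obtain ⟨s, hs, hs0⟩ := intermediate_value_Icc (min_le_right (δ / 2) t) hyc.continuousOn
        ⟨h1, not_lt.1 h⟩
      exact hno s (lt_of_lt_of_le (lt_min (by linarith) ht) hs.1) hs0
    have hanti : StrictAntiOn x (Ici 0) :=
      strictAntiOn_of_deriv_neg (convex_Ici 0) (fun t _ => (hx t).continuousAt.continuousWithinAt)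
        fun t ht => by
          rw [interior_Ici] at ht
          rw [(hx t).deriv]
          exact hyneg t ht
    -- a descent which never ends would eventually stay in `x ≤ -c`, in `|x| ≤ c` or in `x ≥ c`
    by_cases h1 : ∃ t₁ ≥ 0, x t₁ < c
    · obtain ⟨t₁, ht₁, hxt₁⟩ := h1
      have hlt : ∀ t, t₁ ≤ t → x t < c := fun t ht =>
        (hanti.antitoneOn (mem_Ici.2 ht₁) (mem_Ici.2 (ht₁.trans ht)) ht).trans_lt hxt₁
      by_cases h2 : ∃ t₂ ≥ t₁, x t₂ ≤ -c
      · obtain ⟨t₂, ht₂, hxt₂⟩ := h2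
        refine hgrow y F (max t₂ 1) ν 0 hy hν (fun t ht => hFleft t ?_)
          fun t ht => (hyneg t (lt_of_lt_of_le one_pos ((le_max_right _ _).trans ht))).le
        exact (hanti.antitoneOn (mem_Ici.2 (ht₁.trans ht₂))
          (mem_Ici.2 ((ht₁.trans ht₂).trans ((le_max_left _ _).trans ht)))
          ((le_max_left _ _).trans ht)).trans hxt₂
      · push Not at h2
        refine hgrow (fun t => -x t) (fun t => -y t) (max t₁ 1) (√(V η / 2)) |B|
          (fun t => (hx t).neg) (Real.sqrt_pos.2 he) (fun t ht => ?_) fun t _ => by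
            linarith [(hBx t).1]
        have ht0 : 0 < t := lt_of_lt_of_le one_pos ((le_max_right _ _).trans ht)
        have h3 := hdrift t ht0.le fun s hs => hyneg s hs.1
        have ht1 := (le_max_left _ _).trans ht
        have h4 := hVc (x t) ((abs_le.2 ⟨(h2 t ht1).le, (hlt t ht1).le⟩).trans (min_le_left _ _))
        refine Real.sqrt_le_iff.2 ⟨(neg_pos.2 (hyneg t ht0)).le, ?_⟩
        nlinarith
    · push Not at h1
      have hyanti : AntitoneOn y (Ici 0) :=
        antitoneOn_of_deriv_nonpos (convex_Ici 0) hyc.continuousOn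
          (fun t _ => (hy t).differentiableAt.differentiableWithinAt) fun t ht => by
            rw [interior_Ici] at ht
            rw [(hy t).deriv]
            linarith [hFright t (h1 t (le_of_lt ht))]
      refine hgrow (fun t => -x t) (fun t => -y t) 1 (-y 1) |B| (fun t => (hx t).neg)
        (neg_pos.2 (hyneg 1 one_pos)) (fun t ht => ?_) fun t _ => by linarith [(hBx t).1]
      exact neg_le_neg (hyanti (mem_Ici.2 zero_le_one) (mem_Ici.2 (zero_le_one.trans ht)) ht)
  obtain ⟨T, hT, hyT⟩ := hex
  have hδT : δ / 2 ≤ T := by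
    by_contra h
    exact (hyδ T ⟨hT, by linarith⟩).ne hyT
  have hK : IsCompact (Icc (δ / 2) T ∩ y ⁻¹' {0}) :=
    isCompact_Icc.inter_right (isClosed_singleton.preimage hyc)
  obtain ⟨t, ⟨ht, hyt⟩, hmin⟩ := hK.exists_isLeast ⟨T, ⟨hδT, le_rfl⟩, hyT⟩
  have hyt : y t = 0 := hyt
  have ht0 : 0 < t := by linarith [ht.1]
  have hbefore : ∀ s ∈ Ioo 0 t, y s < 0 := by
    intro s hs
    by_contra h
    rcases lt_or_ge s (δ / 2) with h1 | h1
    · exact h (hyδ s ⟨hs.1, by linarith⟩)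
    · obtain ⟨u, hu, hu0⟩ := intermediate_value_Icc h1 hyc.continuousOn
        ⟨(hyδ (δ / 2) ⟨by linarith, by linarith⟩).le, not_lt.1 h⟩
      exact (hmin ⟨⟨hu.1, hu.2.trans (hs.2.le.trans ht.2)⟩, hu0⟩).not_gt (hu.2.trans_lt hs.2)
  have hFt : 0 ≤ F t := by
    have h1 := (hasDerivWithinAt_iff_tendsto_slope' (s := Iio t) (by simp)).1
      (hy t).hasDerivWithinAt
    refine ge_of_tendsto h1 ?_
    filter_upwards [Ioo_mem_nhdsLT ht0] with s hs
    rw [slope_def_field, hyt, sub_zero]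
    exact div_nonneg_of_nonpos (hbefore s hs).le (by linarith [hs.2])
  have hdt := hdrift t ht0.le hbefore
  rw [hyt] at hdt
  have hxt : x t ≤ -c := by
    by_contra h
    rcases lt_or_ge (x t) c with h1 | h1
    · have := hVc (x t) ((abs_le.2 ⟨(not_le.1 h).le, h1.le⟩).trans (min_le_left _ _))
      linarith
    · linarith [hFright t h1]
  exact ⟨t, ht0, hyt, hbefore, hxt, hν.trans_le (hFleft t hxt)⟩

end Oscillator

/-! ### Levels of one degree of freedom -/

/-- The flow of the vector field `f`, cut off outside of a ball, with the integrals of `g` along the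
trajectories; `K` is a Lipschitz constant of the cut-off field. -/
lemma exists_cutoff_flow {E : Type} [NormedAddCommGroup E] [NormedSpace ℝ E]
    [FiniteDimensional ℝ E] {n : ℕ} (hn : n ≠ 0) {f : E → E} (hf : ContDiff ℝ n f) {g : E → ℝ}
    (hg : ContDiff ℝ n g) (ρ : ℝ) :
    ∃ (χ : E → ℝ) (K : NNReal) (φ : ℝ → E → E) (k : ℝ → E → ℝ),
      (∀ z, ‖z‖ ≤ ρ → χ z = 1) ∧ LipschitzWith K (fun z => χ z • f z) ∧
      ContDiff ℝ n (fun x : ℝ × E => φ x.1 x.2) ∧ ContDiff ℝ n (fun x : ℝ × E => k x.1 x.2) ∧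
      (∀ z, φ 0 z = z) ∧ (∀ z, k 0 z = 0) ∧
      (∀ t z, HasDerivAt (fun s => φ s z) (χ (φ t z) • f (φ t z)) t) ∧
      ∀ t z, HasDerivAt (fun s => k s z) (χ (φ t z) • g (φ t z)) t := by
  have : CompleteSpace E := FiniteDimensional.complete ℝ E
  have hn' : (n : WithTop ℕ∞) ≠ 0 := by exact_mod_cast hn
  let b : ContDiffBump (0 : E) := ⟨|ρ| + 1, |ρ| + 2, by positivity, by linarith⟩
  have hb : ContDiff ℝ n (b : E → ℝ) := b.contDiff
  obtain ⟨K, hK⟩ := (hb.smul hf).lipschitzWith_of_hasCompactSupport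
    (b.hasCompactSupport.smul_right (f' := f)) hn'
  obtain ⟨M, hM⟩ := (hb.smul hg).lipschitzWith_of_hasCompactSupport
    (b.hasCompactSupport.smul_right (f' := g)) hn'
  obtain ⟨φ, k, h1, h2, h3, h4, h5, h6⟩ :=
    exists_contDiff_flow_integral hn (hb.smul hf) hK (hb.smul hg) hM
  refine ⟨b, K, φ, k, fun z hz => b.one_of_mem_closedBall ?_, hK, h1, h2, h3, h4, h5, h6⟩
  rw [mem_closedBall_zero_iff]
  exact hz.trans (by linarith [le_abs_self ρ])

lemma exists_forall_Ioo_neg {y : ℝ → ℝ} {d : ℝ} (hy : HasDerivAt y d 0) (hd : d < 0)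
    (h0 : y 0 = 0) : ∃ δ > 0, ∀ t ∈ Ioo 0 δ, y t < 0 := by
  have h1 := (hasDerivWithinAt_iff_tendsto_slope' (s := Ioi 0) (by simp)).1 hy.hasDerivWithinAt
  have h2 := h1.eventually (gt_mem_nhds hd)
  obtain ⟨δ, hδ, h3⟩ := mem_nhdsGT_iff_exists_Ioo_subset.1 h2
  refine ⟨δ, hδ, fun t ht => ?_⟩
  have h4 : slope y 0 t < 0 := h3 ht
  rw [slope_def_field, h0, sub_zero, sub_zero] at h4
  by_contra h5
  exact absurd (div_nonneg (not_lt.1 h5) ht.1.le) h4.not_ge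

/-- The flow of `p² / 2 + V q` on the energies at most `H`, with the integrals `k` of `p²`, which
yield the action. -/
structure LevelFlow (V : ℝ → ℝ) (n : ℕ) (H : ℝ) where
  q : ℝ → ℝ × ℝ → ℝ
  p : ℝ → ℝ × ℝ → ℝ
  k : ℝ → ℝ × ℝ → ℝ
  contDiff_q : ContDiff ℝ n fun x : ℝ × ℝ × ℝ => q x.1 x.2
  contDiff_p : ContDiff ℝ n fun x : ℝ × ℝ × ℝ => p x.1 x.2
  contDiff_k : ContDiff ℝ n fun x : ℝ × ℝ × ℝ => k x.1 x.2
  q_zero : ∀ z, q 0 z = z.1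
  p_zero : ∀ z, p 0 z = z.2
  k_zero : ∀ z, k 0 z = 0
  deriv_q : ∀ z, energy₁ V z.1 z.2 ≤ H → ∀ t, HasDerivAt (fun s => q s z) (p t z) t
  deriv_p : ∀ z, energy₁ V z.1 z.2 ≤ H → ∀ t, HasDerivAt (fun s => p s z) (-deriv V (q t z)) t
  deriv_k : ∀ z, energy₁ V z.1 z.2 ≤ H → ∀ t, HasDerivAt (fun s => k s z) (p t z ^ 2) t
  energy : ∀ z, energy₁ V z.1 z.2 ≤ H → ∀ t, energy₁ V (q t z) (p t z) = energy₁ V z.1 z.2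
  unique : ∀ x y : ℝ → ℝ, (∀ t, HasDerivAt x (y t) t) → (∀ t, HasDerivAt y (-deriv V (x t)) t) →
    energy₁ V (x 0) (y 0) ≤ H → ∀ t, x t = q t (x 0, y 0) ∧ y t = p t (x 0, y 0)

variable {V : ℝ → ℝ} {n : ℕ}

lemma exists_forall_lt_of_coercive (hcoer : Tendsto V (cocompact ℝ) atTop) (H : ℝ) :
    ∃ B > 0, ∀ q, B ≤ |q| → H < V q := by
  have h1 := hcoer.eventually_gt_atTop H
  rw [← Metric.cobounded_eq_cocompact] at h1
  obtain ⟨B, -, hB⟩ := Filter.hasBasis_cobounded_norm.eventually_iff.1 h1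
  exact ⟨max B 1, by positivity, fun q hq => hB ((le_max_left _ _).trans hq)⟩

lemma hasDerivAt_energy₁ (hV : IsWell V) {x y : ℝ → ℝ} {c d : ℝ} {t : ℝ} (hx : HasDerivAt x c t)
    (hy : HasDerivAt y d t) :
    HasDerivAt (fun s => energy₁ V (x s) (y s)) (y t * d + deriv V (x t) * c) t := by
  have h1 := ((hy.pow 2).div_const 2).add ((hV.hasDerivAt (x t)).comp t hx)
  refine h1.congr_deriv ?_
  simp only [Nat.cast_ofNat, Nat.add_one_sub_one, pow_one]
  ring

theorem nonempty_levelFlow (hn : n ≠ 0) (hV : IsWell V) (hVn : ContDiff ℝ (n + 1 : ℕ) V)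
    (hcoer : Tendsto V (cocompact ℝ) atTop) (H : ℝ) : Nonempty (LevelFlow V n H) := by
  obtain ⟨B, hB, hBV⟩ := exists_forall_lt_of_coercive hcoer H
  have hVd : ContDiff ℝ n (deriv V) := by
    have : ContDiff ℝ (n + 1) V := by exact_mod_cast hVn
    exact (contDiff_succ_iff_deriv.1 this).2.2
  set ρ := max B (√(2 * H))
  have hbdd : ∀ x y : ℝ, energy₁ V x y ≤ H → ‖((x, y) : ℝ × ℝ)‖ ≤ ρ := by
    intro x y h
    unfold energy₁ at h
    refine max_le_max ?_ ?_
    · by_contra hx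
      have := hBV x (not_le.1 hx).le
      nlinarith [sq_nonneg y]
    · refine Real.le_sqrt_of_sq_le ?_
      rw [Real.norm_eq_abs, sq_abs]
      nlinarith [hV.nonneg x]
  obtain ⟨χ, K, φ, k, h1, hK, hφ, hk, hφ0, hk0, hdφ, hdk⟩ := exists_cutoff_flow hn
    (f := fun z : ℝ × ℝ => (z.2, -deriv V z.1)) (g := fun z : ℝ × ℝ => z.2 ^ 2)
    (contDiff_snd.prodMk (hVd.comp contDiff_fst).neg) (contDiff_snd.pow 2) ρ
  have hq : ∀ t z, HasDerivAt (fun s => (φ s z).1) (χ (φ t z) • (φ t z).2) t := fun t z =>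
    (hasFDerivAt_fst.comp_hasDerivAt t (hdφ t z) :)
  have hp : ∀ t z, HasDerivAt (fun s => (φ s z).2) (χ (φ t z) • -deriv V (φ t z).1) t := fun t z =>
    (hasFDerivAt_snd.comp_hasDerivAt t (hdφ t z) :)
  have hconst : ∀ f : ℝ → ℝ, (∀ t, HasDerivAt f 0 t) → ∀ t, f t = f 0 := fun f hf t =>
    is_const_of_deriv_eq_zero (fun t => (hf t).differentiableAt) (fun t => (hf t).deriv) t 0
  have hE : ∀ z t, energy₁ V (φ t z).1 (φ t z).2 = energy₁ V z.1 z.2 := by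
    intro z t
    have := hconst (fun t => energy₁ V (φ t z).1 (φ t z).2)
      (fun t => (hasDerivAt_energy₁ hV (hq t z) (hp t z)).congr_deriv (by simp; ring)) t
    simpa [hφ0] using this
  have hχ : ∀ z, energy₁ V z.1 z.2 ≤ H → ∀ t, χ (φ t z) = 1 := fun z hz t =>
    h1 _ (hbdd _ _ ((hE z t).trans_le hz))
  refine ⟨⟨fun t z => (φ t z).1, fun t z => (φ t z).2, k, hφ.fst, hφ.snd, hk,
    fun z => by simp [hφ0],
    fun z => by simp [hφ0], hk0, fun z hz t => by simpa [hχ z hz t] using hq t z,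
    fun z hz t => by simpa [hχ z hz t] using hp t z,
    fun z hz t => by simpa [hχ z hz t] using hdk t z, fun z _ t => hE z t, ?_⟩⟩
  intro x y hx hy h0 t
  have hExy : ∀ t, energy₁ V (x t) (y t) = energy₁ V (x 0) (y 0) := hconst _ fun t =>
    (hasDerivAt_energy₁ hV (hx t) (hy t)).congr_deriv (by ring)
  have := ODE_solution_unique_univ (v := fun _ z => χ z • ((z.2, -deriv V z.1) : ℝ × ℝ))
    (s := fun _ => univ) (K := K) (f := fun t => (x t, y t)) (g := fun t => φ t (x 0, y 0))
    (t₀ := 0) (fun _ => hK.lipschitzOnWith) (fun t => ⟨by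
      rw [h1 _ (hbdd _ _ ((hExy t).trans_le h0)), one_smul]
      exact (hx t).prodMk (hy t), trivial⟩) (fun t => ⟨hdφ t _, trivial⟩) (by simp [hφ0])
  have := congrFun this t
  exact ⟨congrArg Prod.fst this, congrArg Prod.snd this⟩

section LevelAction

lemma hasCompactSupport_sqrt_energy (hcoer : Tendsto V (cocompact ℝ) atTop) (h : ℝ) :
    HasCompactSupport fun x => √(2 * (h - V x)) := by
  obtain ⟨B, hB, hBV⟩ := exists_forall_lt_of_coercive hcoer h
  refine HasCompactSupport.intro (isCompact_Icc (a := -B) (b := B)) fun x hx => ?_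
  rw [mem_Icc, ← abs_le, not_le] at hx
  exact Real.sqrt_eq_zero_of_nonpos (by linarith [hBV x hx.le])

lemma strictMonoOn_levelAction (hV : IsWell V) (hcoer : Tendsto V (cocompact ℝ) atTop) :
    StrictMonoOn (levelAction V) (Ici 0) := by
  intro a ha b hb hab
  have ha : 0 ≤ a := ha
  have hc := hV.contDiff.continuous
  have hca := hasCompactSupport_sqrt_energy hcoer a
  have hcb := hasCompactSupport_sqrt_energy hcoer b
  have hcont : ∀ h : ℝ, Continuous fun x => √(2 * (h - V x)) := fun h => by fun_prop
  have hle : ∀ x, √(2 * (a - V x)) ≤ √(2 * (b - V x)) := fun x =>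
    Real.sqrt_le_sqrt (by linarith)
  have hpos : 0 < ∫ x, (√(2 * (b - V x)) - √(2 * (a - V x))) := by
    refine ((hcont b).sub (hcont a)).integral_pos_of_hasCompactSupport_nonneg_nonzero
      (x := 0) ?_ (fun x => sub_nonneg.2 (hle x)) ?_
    · exact hcb.sub hca
    · rw [hV.zero]
      have : √(2 * (a - 0)) < √(2 * (b - 0)) := Real.sqrt_lt_sqrt (by linarith) (by linarith)
      exact (sub_pos.2 this).ne'
  rw [MeasureTheory.integral_sub ((hcont b).integrable_of_hasCompactSupport hcb)
    ((hcont a).integrable_of_hasCompactSupport hca)] at hpos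
  unfold levelAction
  have : 0 < 1 / Real.pi := by positivity
  nlinarith

end LevelAction

/-! ### Action-angle variables -/

/-- The inverse `(q, p)` of the action-angle chart of `p² / 2 + V q`, as functions of the lifted
angle `s` and of the energy `h ∈ (0, H)`. -/
structure ActionAngle (V : ℝ → ℝ) (n : ℕ) (H : ℝ) where
  q : ℝ → ℝ → ℝ
  p : ℝ → ℝ → ℝ
  contDiffOn_q : ContDiffOn ℝ n (fun x : ℝ × ℝ => q x.1 x.2) (univ ×ˢ Ioo 0 H)
  contDiffOn_p : ContDiffOn ℝ n (fun x : ℝ × ℝ => p x.1 x.2) (univ ×ˢ Ioo 0 H)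
  energy : ∀ s, ∀ h ∈ Ioo 0 H, energy₁ V (q s h) (p s h) = h
  periodic_q : ∀ s, ∀ h ∈ Ioo 0 H, q (s + 2 * Real.pi) h = q s h
  periodic_p : ∀ s, ∀ h ∈ Ioo 0 H, p (s + 2 * Real.pi) h = p s h
  q_neg : ∀ s, ∀ h ∈ Ioo 0 H, q (-s) h = q s h
  p_neg : ∀ s, ∀ h ∈ Ioo 0 H, p (-s) h = -p s h
  angle : ∀ s, ∀ h ∈ Ioo 0 H, angleVar V (q s h) (p s h) = (s : Real.Angle)
  surj : ∀ x y, energy₁ V x y ∈ Ioo 0 H → ∃ s, x = q s (energy₁ V x y) ∧ y = p s (energy₁ V x y)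
  contDiffOn_action : ContDiffOn ℝ n (levelAction V) (Ioo 0 H)

variable {V : ℝ → ℝ} {n : ℕ}

section Orbit

open MeasureTheory

/-- The half of a level orbit on which `q` decreases from its maximum to its minimum. -/
structure IsHalfOrbit (V q p : ℝ → ℝ) (h τ : ℝ) : Prop where
  pos : 0 < τ
  deriv_q : ∀ t, HasDerivAt q (p t) t
  energy : ∀ t, energy₁ V (q t) (p t) = h
  max_pos : 0 < q 0
  p_zero : p 0 = 0
  min_neg : q τ < 0
  p_end : p τ = 0
  p_neg : ∀ t ∈ Ioo 0 τ, p t < 0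

namespace IsHalfOrbit

variable {q p : ℝ → ℝ} {h τ : ℝ}

lemma strictAntiOn (O : IsHalfOrbit V q p h τ) : StrictAntiOn q (Icc 0 τ) :=
  strictAntiOn_of_deriv_neg (convex_Icc 0 τ)
    (fun t _ => (O.deriv_q t).continuousAt.continuousWithinAt) fun t ht => by
      rw [interior_Icc] at ht
      rw [(O.deriv_q t).deriv]
      exact O.p_neg t ht

lemma le_of_max_le (O : IsHalfOrbit V q p h τ) (hV : IsWell V) {x : ℝ} (hx : q 0 ≤ x) :
    h ≤ V x := by
  have h1 := O.energy 0
  rw [energy₁, O.p_zero] at h1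
  have := hV.strictMonoOn.monotoneOn (mem_Ici.2 O.max_pos.le)
    (mem_Ici.2 (O.max_pos.le.trans hx)) hx
  linarith

lemma le_of_le_min (O : IsHalfOrbit V q p h τ) (hV : IsWell V) {x : ℝ} (hx : x ≤ q τ) :
    h ≤ V x := by
  have h1 := O.energy τ
  rw [energy₁, O.p_end] at h1
  have := hV.strictAntiOn.antitoneOn (mem_Iic.2 (hx.trans O.min_neg.le))
    (mem_Iic.2 O.min_neg.le) hx
  linarith

lemma sqrt_eq (O : IsHalfOrbit V q p h τ) (t : ℝ) : √(2 * (h - V (q t))) = |p t| := by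
  rw [← Real.sqrt_sq_eq_abs, ← O.energy t, energy₁]
  congr 1
  ring

/-- Change of variables from position to time in integrals over a part of the level set. -/
lemma integral_image (O : IsHalfOrbit V q p h τ) (g : ℝ → ℝ) {t : ℝ} (ht : t ∈ Icc 0 τ) :
    ∫ x in Ioo (q t) (q 0), g √(2 * (h - V x)) = ∫ s in Ioo 0 t, |p s| • g |p s| := by
  have hsub : Icc 0 t ⊆ Icc 0 τ := Icc_subset_Icc_right ht.2
  have hanti := O.strictAntiOn.mono hsub
  have himage : q '' Ioo 0 t = Ioo (q t) (q 0) := by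
    refine Subset.antisymm ?_ (intermediate_value_Ioo' ht.1
      fun s _ => (O.deriv_q s).continuousAt.continuousWithinAt)
    rintro _ ⟨s, hs, rfl⟩
    have h1 := Ioo_subset_Icc_self hs
    exact ⟨hanti h1 (right_mem_Icc.2 ht.1) hs.2, hanti (left_mem_Icc.2 ht.1) h1 hs.1⟩
  rw [← himage, integral_image_eq_integral_abs_deriv_smul measurableSet_Ioo
    (fun s _ => (O.deriv_q s).hasDerivWithinAt) (hanti.injOn.mono Ioo_subset_Icc_self)]
  simp_rw [O.sqrt_eq]

lemma integral_inv_sqrt (O : IsHalfOrbit V q p h τ) {t : ℝ} (ht : t ∈ Icc 0 τ) :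
    ∫ x in Ioo (q t) (q 0), (√(2 * (h - V x)))⁻¹ = t := by
  rw [O.integral_image (fun v => v⁻¹) ht]
  have : ∫ s in Ioo 0 t, |p s| • |p s|⁻¹ = ∫ _ in Ioo 0 t, (1 : ℝ) :=
    setIntegral_congr_fun measurableSet_Ioo fun s hs => by
      simp only [smul_eq_mul]
      exact mul_inv_cancel₀ (abs_pos.2 (O.p_neg s ⟨hs.1, hs.2.trans_le ht.2⟩).ne).ne'
  rw [this]
  simp [ht.1]

lemma travelTime_eq (O : IsHalfOrbit V q p h τ) (hV : IsWell V) {t : ℝ} (ht : t ∈ Icc 0 τ) :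
    travelTime V h (q t) = t := by
  refine Eq.trans ?_ (O.integral_inv_sqrt ht)
  refine setIntegral_eq_of_subset_of_forall_sdiff_eq_zero measurableSet_Ioi Ioo_subset_Ioi_self
    fun x hx => ?_
  have h1 : q 0 ≤ x := by
    by_contra h1
    exact hx.2 ⟨hx.1, not_le.1 h1⟩
  rw [Real.sqrt_eq_zero_of_nonpos (by linarith [O.le_of_max_le hV h1]), inv_zero]

lemma eq_zero_of_notMem (O : IsHalfOrbit V q p h τ) (hV : IsWell V) {x : ℝ}
    (hx : x ∉ Ioo (q τ) (q 0)) : √(2 * (h - V x)) = 0 := by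
  refine Real.sqrt_eq_zero_of_nonpos ?_
  rcases le_or_gt x (q τ) with h1 | h1
  · linarith [O.le_of_le_min hV h1]
  · linarith [O.le_of_max_le hV (not_lt.1 fun h2 => hx ⟨h1, h2⟩)]

lemma levelPeriod_eq (O : IsHalfOrbit V q p h τ) (hV : IsWell V) : levelPeriod V h = 2 * τ := by
  rw [levelPeriod, ← setIntegral_eq_integral_of_forall_compl_eq_zero (s := Ioo (q τ) (q 0)),
    O.integral_inv_sqrt ⟨O.pos.le, le_rfl⟩]
  intro x hx
  rw [O.eq_zero_of_notMem hV hx, inv_zero]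

lemma levelAction_eq (O : IsHalfOrbit V q p h τ) (hV : IsWell V) {k : ℝ → ℝ}
    (hp : Continuous p) (hk : ∀ t, HasDerivAt k (p t ^ 2) t) (hk0 : k 0 = 0) :
    levelAction V h = 1 / Real.pi * k τ := by
  rw [levelAction, ← setIntegral_eq_integral_of_forall_compl_eq_zero (s := Ioo (q τ) (q 0))
    (fun x hx => O.eq_zero_of_notMem hV hx),
    O.integral_image (fun v => v) ⟨O.pos.le, le_rfl⟩, ← integral_Ioc_eq_integral_Ioo,
    ← intervalIntegral.integral_of_le O.pos.le]
  have h1 := intervalIntegral.integral_eq_sub_of_hasDerivAt (a := 0) (b := τ) (fun t _ => hk t)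
    (Continuous.intervalIntegrable (by fun_prop) _ _)
  rw [hk0, sub_zero] at h1
  rw [← h1]
  congr 2
  ext t
  rw [smul_eq_mul, abs_mul_abs_self, sq]

lemma angleVar_eq (O : IsHalfOrbit V q p h τ) (hV : IsWell V) (hqneg : ∀ t, q (-t) = q t)
    (hpneg : ∀ t, p (-t) = -p t) (hqper : ∀ t, q (t + 2 * τ) = q t)
    (hpper : ∀ t, p (t + 2 * τ) = p t) (t : ℝ) :
    angleVar V (q t) (p t) = ((Real.pi / τ * t : ℝ) : Real.Angle) := by
  have hpi := O.pos
  -- the claim on the fundamental interval `(-τ, τ]`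
  have key : ∀ t ∈ Ioc (-τ) τ,
      angleVar V (q t) (p t) = ((Real.pi / τ * t : ℝ) : Real.Angle) := by
    intro t ht
    have hc : 2 * Real.pi / (2 * τ) = Real.pi / τ := by field_simp
    simp only [angleVar, O.energy, O.levelPeriod_eq hV, hc]
    rcases le_or_gt 0 t with h0 | h0
    · have hp : ¬ 0 < p t := by
        rcases h0.eq_or_lt with rfl | h0
        · rw [O.p_zero]; exact lt_irrefl 0
        rcases ht.2.eq_or_lt with rfl | h1
        · rw [O.p_end]; exact lt_irrefl 0
        · exact (O.p_neg t ⟨h0, h1⟩).not_gt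
      rw [if_neg hp, O.travelTime_eq hV ⟨h0, ht.2⟩]
    · have hp : 0 < p t := by
        have := O.p_neg (-t) ⟨by linarith, by linarith [ht.1]⟩
        rw [hpneg] at this
        linarith
      rw [if_pos hp, ← hqneg t, O.travelTime_eq hV ⟨by linarith, by linarith [ht.1]⟩]
      congr 1
      ring
  obtain ⟨m, hm, -⟩ := existsUnique_add_zsmul_mem_Ioc (show 0 < 2 * τ by linarith) t (-τ)
  have hm' : t + m * (2 * τ) ∈ Ioc (-τ) τ := by
    have e : -τ + 2 * τ = τ := by ring
    rwa [zsmul_eq_mul, e] at hm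
  have h1 := key _ hm'
  have hq : Function.Periodic q (2 * τ) := hqper
  have hp : Function.Periodic p (2 * τ) := hpper
  rw [hq.int_mul m t, hp.int_mul m t] at h1
  rw [h1, Real.Angle.angle_eq_iff_two_pi_dvd_sub]
  exact ⟨m, by field_simp; ring⟩

end IsHalfOrbit

end Orbit

/-- Below any energy `H` the action-angle chart of a `C^(n+1)` well is `C^n`: the orbits start at
their right turning points, time is scaled by the half period, and the action is an integral of
`p²` over the half orbit. -/
theorem nonempty_actionAngle (hn : n ≠ 0) (hV : IsWell V) (hVn : ContDiff ℝ (n + 1 : ℕ) V)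
    (hcoer : Tendsto V (cocompact ℝ) atTop) (H : ℝ) : Nonempty (ActionAngle V n H) := by
  obtain ⟨F⟩ := nonempty_levelFlow hn hV hVn hcoer H
  obtain ⟨B, hB, hBV⟩ := exists_forall_lt_of_coercive hcoer H
  -- the right turning point of the level set of energy `h`
  obtain ⟨a, ha⟩ := exists_contDiffAt_root hn (F := fun v : ℝ × ℝ => V v.2 - v.1)
    (isOpen_Ioo (a := 0) (b := H)) hB
    (fun h _ y _ => (((hVn.of_le (by norm_cast; omega)).comp contDiff_snd).sub
      contDiff_fst).contDiffAt)
    (fun h _ => (hV.contDiff.continuous.sub continuous_const).continuousOn)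
    (fun h _ y hy => by simpa using hV.deriv_pos hy.1)
    (fun h hh => by simpa [hV.zero] using hh.1)
    (fun h hh => by simpa using hh.2.trans (hBV B (le_abs_self B)))
  have haV : ∀ h ∈ Ioo 0 H, V (a h) = h := fun h hh => by linarith [(ha h hh).2.1]
  have ha0 : ∀ h ∈ Ioo 0 H, 0 < a h := fun h hh => (ha h hh).1.1
  have haE : ∀ h ∈ Ioo 0 H, energy₁ V (a h, (0 : ℝ)).1 (a h, (0 : ℝ)).2 ≤ H := fun h hh => by
    simp [energy₁, haV h hh, hh.2.le]
  have hen : ∀ h ∈ Ioo 0 H, ∀ t, energy₁ V (F.q t (a h, 0)) (F.p t (a h, 0)) = h := fun h hh t => by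
    rw [F.energy _ (haE h hh)]
    simp [energy₁, haV h hh]
  -- the half period is the first time at which the momentum vanishes again
  have hτ : ∀ h, ∃ τ, h ∈ Ioo 0 H → 0 < τ ∧ F.p τ (a h, 0) = 0 ∧
      0 < -deriv V (F.q τ (a h, 0)) ∧ (∀ t ∈ Ioo 0 τ, F.p t (a h, 0) < 0) ∧
      F.q τ (a h, 0) < 0 := by
    intro h
    by_cases hh : h ∈ Ioo 0 H
    · obtain ⟨c, hc, -, ν, hν, -, H1⟩ := exists_turning hV (ha0 h hh) one_pos B
      obtain ⟨τ, h1, h2, h3, h4, h5⟩ := H1 (fun t => F.q t (a h, 0)) (fun t => F.p t (a h, 0))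
        (fun t => -deriv V (F.q t (a h, 0))) (F.deriv_q _ (haE h hh)) (F.deriv_p _ (haE h hh))
        (fun t => by simpa using hν.le) (fun t => by
          by_contra h1
          have h2 := hBV _ (not_le.1 h1).le
          have h3 := hen h hh t
          rw [energy₁] at h3
          nlinarith [sq_nonneg (F.p t (a h, 0)), hh.2]) (by simp [F.q_zero])
        (exists_forall_Ioo_neg (F.deriv_p _ (haE h hh) 0) (by
          simpa [F.q_zero] using hV.deriv_pos (ha0 h hh)) (F.p_zero _))
      exact ⟨τ, fun _ => ⟨h1, h2, h5, h3, by linarith⟩⟩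
    · exact ⟨0, fun h1 => absurd h1 hh⟩
  choose τ hτ using hτ
  have hO : ∀ h ∈ Ioo 0 H,
      IsHalfOrbit V (fun t => F.q t (a h, 0)) (fun t => F.p t (a h, 0)) h (τ h) := fun h hh =>
    { pos := (hτ h hh).1
      deriv_q := F.deriv_q _ (haE h hh)
      energy := hen h hh
      max_pos := by simpa [F.q_zero] using ha0 h hh
      p_zero := F.p_zero _
      min_neg := (hτ h hh).2.2.2.2
      p_end := (hτ h hh).2.1
      p_neg := (hτ h hh).2.2.2.1 }
  -- symmetry of the orbit under time reversal at the two turning points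
  have hrev : ∀ h ∈ Ioo 0 H, ∀ T, F.p T (a h, 0) = 0 → ∀ t,
      F.q (T + t) (a h, 0) = F.q (T - t) (a h, 0) ∧
      F.p (T + t) (a h, 0) = -F.p (T - t) (a h, 0) := by
    intro h hh T hT t
    have hq := F.deriv_q _ (haE h hh)
    have hp := F.deriv_p _ (haE h hh)
    have hle : energy₁ V (F.q T (a h, 0)) (F.p T (a h, 0)) ≤ H := (hen h hh T).trans_le hh.2.le
    have h1 := F.unique (fun t => F.q (T + t) (a h, 0)) (fun t => F.p (T + t) (a h, 0))
      (fun t => (hq (T + t)).comp_const_add T t) (fun t => (hp (T + t)).comp_const_add T t)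
      (by simpa using hle) t
    have h2 := F.unique (fun t => F.q (T - t) (a h, 0)) (fun t => -F.p (T - t) (a h, 0))
      (fun t => by simpa using (hq (T - t)).comp_const_sub T t)
      (fun t => ((hp (T - t)).comp_const_sub T t).fun_neg.congr_deriv (by simp))
      (by simpa [hT] using hle) t
    simp only [add_zero, sub_zero, hT, neg_zero] at h1 h2
    exact ⟨h1.1.trans h2.1.symm, by linarith [h1.2, h2.2]⟩
  have hqneg : ∀ h ∈ Ioo 0 H, ∀ t, F.q (-t) (a h, 0) = F.q t (a h, 0) := fun h hh t => by
    simpa using ((hrev h hh 0 (F.p_zero _) t).1).symm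
  have hpneg : ∀ h ∈ Ioo 0 H, ∀ t, F.p (-t) (a h, 0) = -F.p t (a h, 0) := fun h hh t => by
    have := (hrev h hh 0 (F.p_zero _) t).2
    simp only [zero_add, zero_sub] at this
    linarith
  have hqper : ∀ h ∈ Ioo 0 H, ∀ t, F.q (t + 2 * τ h) (a h, 0) = F.q t (a h, 0) := fun h hh t => by
    have := (hrev h hh (τ h) (hτ h hh).2.1 (τ h + t)).1
    rw [show τ h + (τ h + t) = t + 2 * τ h by ring, show τ h - (τ h + t) = -t by ring,
      hqneg h hh] at this
    exact this
  have hpper : ∀ h ∈ Ioo 0 H, ∀ t, F.p (t + 2 * τ h) (a h, 0) = F.p t (a h, 0) := fun h hh t => by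
    have := (hrev h hh (τ h) (hτ h hh).2.1 (τ h + t)).2
    rw [show τ h + (τ h + t) = t + 2 * τ h by ring, show τ h - (τ h + t) = -t by ring,
      hpneg h hh, neg_neg] at this
    exact this
  -- smoothness of the turning point and of the half period
  have haC : ∀ h ∈ Ioo 0 H, ContDiffAt ℝ n a h := fun h hh => (ha h hh).2.2.1
  have haOn : ContDiffOn ℝ n a (Ioo 0 H) := fun h hh => (haC h hh).contDiffWithinAt
  have hlift : ContDiffOn ℝ n (fun v : ℝ × ℝ => (v.2, (a v.1, (0 : ℝ)))) (Ioo 0 H ×ˢ univ) :=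
    contDiffOn_snd.prodMk ((haOn.comp contDiffOn_fst fun v hv => hv.1).prodMk contDiffOn_const)
  have hτC : ∀ h ∈ Ioo 0 H, ContDiffAt ℝ n τ h := by
    intro h hh
    refine contDiffAt_firstZero hn isOpen_Ioo (y := fun v : ℝ × ℝ => F.p v.2 (a v.1, 0))
      (F := fun v => -deriv V (F.q v.2 (a v.1, 0))) (F.contDiff_p.comp_contDiffOn hlift)
      (hV.continuous_deriv.comp_continuousOn
        (F.contDiff_q.comp_contDiffOn hlift).continuousOn).neg
      (fun h hh t => F.deriv_p _ (haE h hh) t) (fun h hh => F.p_zero _)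
      (fun h hh => by simpa [F.q_zero] using hV.deriv_pos (ha0 h hh))
      (fun h hh => ⟨(hτ h hh).1, (hτ h hh).2.1, (hτ h hh).2.2.1, (hτ h hh).2.2.2.1⟩) hh
  have hτOn : ContDiffOn ℝ n τ (Ioo 0 H) := fun h hh => (hτC h hh).contDiffWithinAt
  have hpar : ContDiffOn ℝ n (fun v : ℝ × ℝ => (τ v.2 / Real.pi * v.1, (a v.2, (0 : ℝ))))
      (univ ×ˢ Ioo 0 H) := by
    have h1 : ContDiffOn ℝ n (fun v : ℝ × ℝ => τ v.2) (univ ×ˢ Ioo 0 H) :=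
      hτOn.comp contDiffOn_snd fun v hv => hv.2
    have h2 : ContDiffOn ℝ n (fun v : ℝ × ℝ => a v.2) (univ ×ˢ Ioo 0 H) :=
      haOn.comp contDiffOn_snd fun v hv => hv.2
    exact ((h1.div_const _).mul contDiffOn_fst).prodMk (h2.prodMk contDiffOn_const)
  have hangle : ∀ h ∈ Ioo 0 H, ∀ t, angleVar V (F.q t (a h, 0)) (F.p t (a h, 0)) =
      ((Real.pi / τ h * t : ℝ) : Real.Angle) := fun h hh =>
    (hO h hh).angleVar_eq hV (hqneg h hh) (hpneg h hh) (hqper h hh) (hpper h hh)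
  have hshift : ∀ h ∈ Ioo 0 H, ∀ s, τ h / Real.pi * (s + 2 * Real.pi) =
      τ h / Real.pi * s + 2 * τ h := fun h _ s => by field_simp
  refine ⟨⟨fun s h => F.q (τ h / Real.pi * s) (a h, 0), fun s h => F.p (τ h / Real.pi * s) (a h, 0),
    F.contDiff_q.comp_contDiffOn hpar, F.contDiff_p.comp_contDiffOn hpar,
    fun s h hh => hen h hh _, fun s h hh => ?_, fun s h hh => ?_, fun s h hh => ?_,
    fun s h hh => ?_, fun s h hh => ?_, fun x y hxy => ?_, ?_⟩⟩
  · simp only [hshift h hh, hqper h hh]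
  · simp only [hshift h hh, hpper h hh]
  · simp only [mul_neg, hqneg h hh]
  · simp only [mul_neg, hpneg h hh]
  · rw [hangle h hh]
    congr 1
    have := (hτ h hh).1.ne'
    field_simp
  · set h := energy₁ V x y with hdef
    have O := hO h hxy
    have hVx : V x ≤ h := by rw [hdef, energy₁]; nlinarith [sq_nonneg y]
    have hx : x ∈ Icc (F.q (τ h) (a h, 0)) (F.q 0 (a h, 0)) := by
      have hq0 := O.energy 0
      have hqτ := O.energy (τ h)
      simp only [energy₁, O.p_zero, O.p_end] at hq0 hqτ
      refine ⟨not_lt.1 fun hlt => ?_, not_lt.1 fun hlt => ?_⟩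
      · have := hV.strictAntiOn (mem_Iic.2 (hlt.le.trans O.min_neg.le))
          (mem_Iic.2 O.min_neg.le) hlt
        linarith
      · have := hV.strictMonoOn (mem_Ici.2 O.max_pos.le)
          (mem_Ici.2 (O.max_pos.le.trans hlt.le)) hlt
        linarith
    obtain ⟨t, ht, htx⟩ := intermediate_value_Icc' O.pos.le
      (fun s _ => (O.deriv_q s).continuousAt.continuousWithinAt) hx
    have hpt : F.p t (a h, 0) ≤ 0 := by
      rcases ht.1.eq_or_lt with h0 | h0
      · rw [← h0]; exact O.p_zero.le
      rcases ht.2.eq_or_lt with h1 | h1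
      · rw [h1]; exact O.p_end.le
      · exact (O.p_neg t ⟨h0, h1⟩).le
    have hsq : F.p t (a h, 0) ^ 2 = y ^ 2 := by
      have h1 := hen h hxy t
      simp only at htx
      rw [energy₁, htx] at h1
      have h2 : h = y ^ 2 / 2 + V x := hdef
      linarith
    have htime : ∀ t, τ h / Real.pi * (Real.pi / τ h * t) = t := fun t => by
      have := O.pos.ne'
      field_simp
    rcases le_or_gt y 0 with hy | hy
    · refine ⟨Real.pi / τ h * t, ?_, ?_⟩
      · rw [htime]; exact htx.symm
      · rw [htime]
        have := (sq_eq_sq_iff_abs_eq_abs _ _).1 hsq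
        rw [abs_of_nonpos hpt, abs_of_nonpos hy] at this
        linarith
    · refine ⟨Real.pi / τ h * (-t), ?_, ?_⟩
      · rw [htime, hqneg h hxy]; exact htx.symm
      · rw [htime, hpneg h hxy]
        have := (sq_eq_sq_iff_abs_eq_abs _ _).1 hsq
        rw [abs_of_nonpos hpt, abs_of_pos hy] at this
        linarith
  · have h1 : ContDiffOn ℝ n (fun h => 1 / Real.pi * F.k (τ h) (a h, 0)) (Ioo 0 H) :=
      contDiffOn_const.mul (F.contDiff_k.comp_contDiffOn
        (hτOn.prodMk (haOn.prodMk contDiffOn_const)))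
    refine h1.congr fun h hh => ?_
    exact (hO h hh).levelAction_eq hV (continuous_iff_continuousAt.2 fun t =>
      (F.deriv_p _ (haE h hh) t).continuousAt) (F.deriv_k _ (haE h hh)) (F.k_zero _)

/-! ### The wall-free flow -/

namespace WallSystem

variable {r : ℕ} (S : WallSystem r)

lemma isWell_V₁ : IsWell S.V₁ where
  contDiff := S.contDiff_V₁.of_le (by norm_cast; omega)
  zero := S.V₁_zero
  deriv_mul_pos := S.V₁_deriv

lemma isWell_V₂ : IsWell S.V₂ where
  contDiff := S.contDiff_V₂.of_le (by norm_cast; omega)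
  zero := S.V₂_zero
  deriv_mul_pos := S.V₂_deriv

/-- The partial derivative of the coupling potential in `q₁`. -/
def d₁Vc (x y : ℝ) : ℝ := deriv (fun x => S.Vc (x, y)) x

/-- The partial derivative of the coupling potential in `q₂`. -/
def d₂Vc (x y : ℝ) : ℝ := deriv (fun y => S.Vc (x, y)) y

lemma force₁_eq (ε : ℝ) (z : PhasePt) :
    S.force₁ ε z = -deriv S.V₁ z.q₁ - ε * S.d₁Vc z.q₁ z.q₂ := rfl

lemma force₂_eq (ε : ℝ) (z : PhasePt) :
    S.force₂ ε z = -deriv S.V₂ z.q₂ - ε * S.d₂Vc z.q₁ z.q₂ := rfl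

lemma hasFDerivAt_Vc (v : ℝ × ℝ) : HasFDerivAt S.Vc (fderiv ℝ S.Vc v) v :=
  (S.contDiff_Vc.differentiable (by norm_cast) v).hasFDerivAt

lemma hasDerivAt_Vc_fst (x y : ℝ) :
    HasDerivAt (fun x => S.Vc (x, y)) (fderiv ℝ S.Vc (x, y) (1, 0)) x :=
  (S.hasFDerivAt_Vc (x, y)).comp_hasDerivAt x ((hasDerivAt_id x).prodMk (hasDerivAt_const x y))

lemma hasDerivAt_Vc_snd (x y : ℝ) :
    HasDerivAt (fun y => S.Vc (x, y)) (fderiv ℝ S.Vc (x, y) (0, 1)) y :=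
  (S.hasFDerivAt_Vc (x, y)).comp_hasDerivAt y ((hasDerivAt_const y x).prodMk (hasDerivAt_id y))

lemma d₁Vc_eq (x y : ℝ) : S.d₁Vc x y = fderiv ℝ S.Vc (x, y) (1, 0) :=
  (S.hasDerivAt_Vc_fst x y).deriv

lemma d₂Vc_eq (x y : ℝ) : S.d₂Vc x y = fderiv ℝ S.Vc (x, y) (0, 1) :=
  (S.hasDerivAt_Vc_snd x y).deriv

lemma contDiff_fderiv_Vc : ContDiff ℝ r (fderiv ℝ S.Vc) :=
  S.contDiff_Vc.fderiv_right (by push_cast; exact le_rfl)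

lemma contDiff_d₁Vc : ContDiff ℝ r fun v : ℝ × ℝ => S.d₁Vc v.1 v.2 := by
  simp only [d₁Vc_eq]
  exact S.contDiff_fderiv_Vc.clm_apply contDiff_const

lemma contDiff_d₂Vc : ContDiff ℝ r fun v : ℝ × ℝ => S.d₂Vc v.1 v.2 := by
  simp only [d₂Vc_eq]
  exact S.contDiff_fderiv_Vc.clm_apply contDiff_const

lemma contDiff_deriv_V₁ : ContDiff ℝ r (deriv S.V₁) := by
  have : ContDiff ℝ (r + 1) S.V₁ := by exact_mod_cast S.contDiff_V₁
  exact (contDiff_succ_iff_deriv.1 this).2.2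

lemma contDiff_deriv_V₂ : ContDiff ℝ r (deriv S.V₂) := by
  have : ContDiff ℝ (r + 1) S.V₂ := by exact_mod_cast S.contDiff_V₂
  exact (contDiff_succ_iff_deriv.1 this).2.2

lemma hasDerivWithinAt_Vc {x y : ℝ → ℝ} {x' y' t : ℝ} {s : Set ℝ} (hx : HasDerivWithinAt x x' s t)
    (hy : HasDerivWithinAt y y' s t) :
    HasDerivWithinAt (fun u => S.Vc (x u, y u))
      (S.d₁Vc (x t) (y t) * x' + S.d₂Vc (x t) (y t) * y') s t := by
  have h1 := (S.hasFDerivAt_Vc (x t, y t)).comp_hasDerivWithinAt t (hx.prodMk hy)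
  refine h1.congr_deriv ?_
  have h2 : ((x', y') : ℝ × ℝ) = x' • ((1, 0) : ℝ × ℝ) + y' • ((0, 1) : ℝ × ℝ) := by simp
  rw [h2, map_add, map_smul, map_smul, d₁Vc_eq, d₂Vc_eq]
  simp only [smul_eq_mul]
  ring

/-- The derivative of the energy along a curve. -/
lemma hasDerivWithinAt_ham (ε : ℝ) {z : ℝ → PhasePt} {a b c d t : ℝ} {s : Set ℝ}
    (h1 : HasDerivWithinAt (fun u => (z u).q₁) a s t)
    (h2 : HasDerivWithinAt (fun u => (z u).p₁) b s t)
    (h3 : HasDerivWithinAt (fun u => (z u).q₂) c s t)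
    (h4 : HasDerivWithinAt (fun u => (z u).p₂) d s t) :
    HasDerivWithinAt (fun u => S.ham ε (z u))
      ((z t).p₁ * b - S.force₁ ε (z t) * a + ((z t).p₂ * d - S.force₂ ε (z t) * c)) s t := by
  have e1 := (S.isWell_V₁.hasDerivAt (z t).q₁).comp_hasDerivWithinAt t h1
  have e2 := (S.isWell_V₂.hasDerivAt (z t).q₂).comp_hasDerivWithinAt t h3
  have := ((((h2.pow 2).div_const 2).add e1).add (((h4.pow 2).div_const 2).add e2)).add
    ((S.hasDerivWithinAt_Vc h1 h3).const_mul ε)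
  refine this.congr_deriv ?_
  rw [force₁_eq, force₂_eq]
  simp only [Nat.cast_ofNat, Nat.add_one_sub_one, pow_one]
  ring

/-- The part of phase space over the box `|q₁|, |q₂| < B` on which the energy is at most `E + 1`. -/
def dom (E B ε : ℝ) : Set PhasePt := {z | |z.q₁| < B ∧ |z.q₂| < B ∧ S.ham ε z ≤ E + 1}

/-- The wall-free flow `φ t ε z` of `H_ε` on a box `|q₁|, |q₂| < B`, for small `ε`, together with
the integrals `k t ε z` of `p₂ ∂₂V_c` along the trajectories, which measure the change of the energy
of the second degree of freedom. -/
structure FreeFlow (E R : ℝ) where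
  φ : ℝ → ℝ → PhasePt → PhasePt
  k : ℝ → ℝ → PhasePt → ℝ
  B : ℝ
  ε₀ : ℝ
  M : ℝ
  R_le : R ≤ B
  ε₀_pos : 0 < ε₀
  M_pos : 0 < M
  Vc_le : ∀ x y, |x| ≤ B → |y| ≤ B → |S.Vc (x, y)| ≤ M
  d₁Vc_le : ∀ x y, |x| ≤ B → |y| ≤ B → |S.d₁Vc x y| ≤ M
  contDiff_q₁ : ContDiff ℝ r fun x : ℝ × ℝ × ℝ × ℝ × ℝ × ℝ =>
    (φ x.1 x.2.1 ⟨x.2.2.1, x.2.2.2.1, x.2.2.2.2.1, x.2.2.2.2.2⟩).q₁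
  contDiff_p₁ : ContDiff ℝ r fun x : ℝ × ℝ × ℝ × ℝ × ℝ × ℝ =>
    (φ x.1 x.2.1 ⟨x.2.2.1, x.2.2.2.1, x.2.2.2.2.1, x.2.2.2.2.2⟩).p₁
  contDiff_q₂ : ContDiff ℝ r fun x : ℝ × ℝ × ℝ × ℝ × ℝ × ℝ =>
    (φ x.1 x.2.1 ⟨x.2.2.1, x.2.2.2.1, x.2.2.2.2.1, x.2.2.2.2.2⟩).q₂
  contDiff_k : ContDiff ℝ r fun x : ℝ × ℝ × ℝ × ℝ × ℝ × ℝ =>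
    k x.1 x.2.1 ⟨x.2.2.1, x.2.2.2.1, x.2.2.2.2.1, x.2.2.2.2.2⟩
  zero : ∀ ε z, φ 0 ε z = z
  k_zero : ∀ ε z, k 0 ε z = 0
  mem : ∀ ε, |ε| ≤ ε₀ → ∀ z ∈ S.dom E B ε, ∀ t, φ t ε z ∈ S.dom E B ε
  ham_eq : ∀ ε, |ε| ≤ ε₀ → ∀ z ∈ S.dom E B ε, ∀ t, S.ham ε (φ t ε z) = S.ham ε z
  deriv_q₁ : ∀ ε, |ε| ≤ ε₀ → ∀ z ∈ S.dom E B ε, ∀ t,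
    HasDerivAt (fun s => (φ s ε z).q₁) (φ t ε z).p₁ t
  deriv_p₁ : ∀ ε, |ε| ≤ ε₀ → ∀ z ∈ S.dom E B ε, ∀ t,
    HasDerivAt (fun s => (φ s ε z).p₁) (S.force₁ ε (φ t ε z)) t
  deriv_q₂ : ∀ ε, |ε| ≤ ε₀ → ∀ z ∈ S.dom E B ε, ∀ t,
    HasDerivAt (fun s => (φ s ε z).q₂) (φ t ε z).p₂ t
  deriv_p₂ : ∀ ε, |ε| ≤ ε₀ → ∀ z ∈ S.dom E B ε, ∀ t,
    HasDerivAt (fun s => (φ s ε z).p₂) (S.force₂ ε (φ t ε z)) t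
  deriv_k : ∀ ε, |ε| ≤ ε₀ → ∀ z ∈ S.dom E B ε, ∀ t,
    HasDerivAt (fun s => k s ε z) ((φ t ε z).p₂ * S.d₂Vc (φ t ε z).q₁ (φ t ε z).q₂) t
  unique : ∀ ε, |ε| ≤ ε₀ → ∀ (a b : ℝ) (z : ℝ → PhasePt),
    ContinuousOn (fun t => (z t).q₁) (Icc a b) → ContinuousOn (fun t => (z t).p₁) (Icc a b) →
    ContinuousOn (fun t => (z t).q₂) (Icc a b) → ContinuousOn (fun t => (z t).p₂) (Icc a b) →
    (∀ t ∈ Ico a b, HasDerivWithinAt (fun s => (z s).q₁) (z t).p₁ (Ici t) t) →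
    (∀ t ∈ Ico a b, HasDerivWithinAt (fun s => (z s).p₁) (S.force₁ ε (z t)) (Ici t) t) →
    (∀ t ∈ Ico a b, HasDerivWithinAt (fun s => (z s).q₂) (z t).p₂ (Ici t) t) →
    (∀ t ∈ Ico a b, HasDerivWithinAt (fun s => (z s).p₂) (S.force₂ ε (z t)) (Ici t) t) →
    (∀ t ∈ Ico a b, z t ∈ S.dom E B ε) → ∀ t ∈ Icc a b, z t = φ (t - a) ε (z a)

/-- The parameter `ε` is carried along as a constant coordinate, and the field is cut off outside of
a ball which contains the energy surface over the box. -/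
theorem nonempty_freeFlow (hr : r ≠ 0) (E R : ℝ) : Nonempty (S.FreeFlow E R) := by
  obtain ⟨B₁, hB₁, hV₁⟩ := exists_forall_lt_of_coercive S.V₁_coercive (E + 2)
  obtain ⟨B₂, hB₂, hV₂⟩ := exists_forall_lt_of_coercive S.V₂_coercive (E + 2)
  set B := max R (max B₁ B₂)
  have hB : 0 < B := hB₁.trans_le ((le_max_left _ _).trans (le_max_right _ _))
  have hBV₁ : ∀ q, |q| = B → E + 2 < S.V₁ q := fun q hq =>
    hV₁ q (((le_max_left _ _).trans (le_max_right _ _)).trans hq.ge)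
  have hBV₂ : ∀ q, |q| = B → E + 2 < S.V₂ q := fun q hq =>
    hV₂ q (((le_max_right _ _).trans (le_max_right _ _)).trans hq.ge)
  have hK : IsCompact (Metric.closedBall (0 : ℝ × ℝ) B) := isCompact_closedBall 0 B
  have hmemK : ∀ x y : ℝ, |x| ≤ B → |y| ≤ B → (x, y) ∈ Metric.closedBall (0 : ℝ × ℝ) B :=
    fun x y hx hy => by
      rw [mem_closedBall_zero_iff]
      exact max_le hx hy
  obtain ⟨M₀, hM₀⟩ := hK.exists_bound_of_continuousOn S.contDiff_Vc.continuous.continuousOn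
  obtain ⟨M₁, hM₁⟩ := hK.exists_bound_of_continuousOn S.contDiff_d₁Vc.continuous.continuousOn
  set M := max (max M₀ M₁) 1
  have hM : 0 < M := one_pos.trans_le (le_max_right _ _)
  have hVc : ∀ x y, |x| ≤ B → |y| ≤ B → |S.Vc (x, y)| ≤ M := fun x y hx hy =>
    (hM₀ _ (hmemK x y hx hy)).trans ((le_max_left _ _).trans (le_max_left _ _))
  have hd₁ : ∀ x y, |x| ≤ B → |y| ≤ B → |S.d₁Vc x y| ≤ M := fun x y hx hy =>
    (hM₁ _ (hmemK x y hx hy)).trans ((le_max_right _ _).trans (le_max_left _ _))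
  set ε₀ := 1 / (2 * M)
  have hε₀ : 0 < ε₀ := by positivity
  have hεV : ∀ ε, |ε| ≤ ε₀ → ∀ x y, |x| ≤ B → |y| ≤ B → |ε * S.Vc (x, y)| ≤ 1 / 2 := by
    intro ε hε x y hx hy
    rw [abs_mul]
    calc |ε| * |S.Vc (x, y)| ≤ ε₀ * M := by gcongr; exact hVc x y hx hy
      _ = 1 / 2 := by simp only [ε₀]; field_simp
  set P := √(2 * (E + 2))
  set ρ := max ε₀ (max B P)
  have hbdd : ∀ ε, |ε| ≤ ε₀ → ∀ z ∈ S.dom E B ε,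
      ‖((ε, z.q₁, z.p₁, z.q₂, z.p₂) : ℝ × ℝ × ℝ × ℝ × ℝ)‖ ≤ ρ := by
    intro ε hε z hz
    have h1 := (abs_le.1 (hεV ε hε z.q₁ z.q₂ hz.1.le hz.2.1.le)).1
    have h2 := hz.2.2
    rw [ham] at h2
    have h3 := S.isWell_V₁.nonneg z.q₁
    have h4 := S.isWell_V₂.nonneg z.q₂
    have hp₁ : |z.p₁| ≤ P := Real.le_sqrt_of_sq_le (by
      rw [sq_abs]; nlinarith [sq_nonneg z.p₂])
    have hp₂ : |z.p₂| ≤ P := Real.le_sqrt_of_sq_le (by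
      rw [sq_abs]; nlinarith [sq_nonneg z.p₁])
    have hBρ : B ≤ ρ := (le_max_left _ _).trans (le_max_right _ _)
    have hPρ : P ≤ ρ := (le_max_right _ _).trans (le_max_right _ _)
    exact max_le (hε.trans (le_max_left _ _)) (max_le (hz.1.le.trans hBρ)
      (max_le (hp₁.trans hPρ) (max_le (hz.2.1.le.trans hBρ) (hp₂.trans hPρ))))
  let f : ℝ × ℝ × ℝ × ℝ × ℝ → ℝ × ℝ × ℝ × ℝ × ℝ := fun v =>
    (0, v.2.2.1, -deriv S.V₁ v.2.1 - v.1 * S.d₁Vc v.2.1 v.2.2.2.1, v.2.2.2.2,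
      -deriv S.V₂ v.2.2.2.1 - v.1 * S.d₂Vc v.2.1 v.2.2.2.1)
  have hpair : ContDiff ℝ r fun v : ℝ × ℝ × ℝ × ℝ × ℝ => (v.2.1, v.2.2.2.1) := by fun_prop
  have hf : ContDiff ℝ r f := by
    have h1 : ContDiff ℝ r fun v : ℝ × ℝ × ℝ × ℝ × ℝ => deriv S.V₁ v.2.1 :=
      S.contDiff_deriv_V₁.comp (by fun_prop)
    have h2 : ContDiff ℝ r fun v : ℝ × ℝ × ℝ × ℝ × ℝ => deriv S.V₂ v.2.2.2.1 :=
      S.contDiff_deriv_V₂.comp (by fun_prop)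
    have h3 : ContDiff ℝ r fun v : ℝ × ℝ × ℝ × ℝ × ℝ => S.d₁Vc v.2.1 v.2.2.2.1 :=
      S.contDiff_d₁Vc.comp hpair
    have h4 : ContDiff ℝ r fun v : ℝ × ℝ × ℝ × ℝ × ℝ => S.d₂Vc v.2.1 v.2.2.2.1 :=
      S.contDiff_d₂Vc.comp hpair
    simp only [f]
    fun_prop
  let g : ℝ × ℝ × ℝ × ℝ × ℝ → ℝ := fun v => v.2.2.2.2 * S.d₂Vc v.2.1 v.2.2.2.1
  have hg : ContDiff ℝ r g := by
    have h4 : ContDiff ℝ r fun v : ℝ × ℝ × ℝ × ℝ × ℝ => S.d₂Vc v.2.1 v.2.2.2.1 :=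
      S.contDiff_d₂Vc.comp hpair
    simp only [g]
    fun_prop
  obtain ⟨χ, K, Φ, k, h1, hK, hΦ, hk, hΦ0, hk0, hdΦ, hdk⟩ := exists_cutoff_flow hr hf hg ρ
  have hd1 : ∀ t v, HasDerivAt (fun s => (Φ s v).1) 0 t := fun t v => by
    refine (hasFDerivAt_fst.comp_hasDerivAt t (hdΦ t v) :).congr_deriv ?_
    simp [f]
  have hd' : ∀ t v, HasDerivAt (fun s => (Φ s v).2) (χ (Φ t v) • (f (Φ t v)).2) t := fun t v =>
    (hasFDerivAt_snd.comp_hasDerivAt t (hdΦ t v) :)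
  have hd2 : ∀ t v, HasDerivAt (fun s => (Φ s v).2.1) (χ (Φ t v) * (f (Φ t v)).2.1) t := fun t v =>
    (hasFDerivAt_fst.comp_hasDerivAt t (hd' t v) :)
  have hd'' : ∀ t v, HasDerivAt (fun s => (Φ s v).2.2) (χ (Φ t v) • (f (Φ t v)).2.2) t :=
    fun t v => (hasFDerivAt_snd.comp_hasDerivAt t (hd' t v) :)
  have hd3 : ∀ t v, HasDerivAt (fun s => (Φ s v).2.2.1) (χ (Φ t v) * (f (Φ t v)).2.2.1) t :=
    fun t v => (hasFDerivAt_fst.comp_hasDerivAt t (hd'' t v) :)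
  have hd''' : ∀ t v, HasDerivAt (fun s => (Φ s v).2.2.2) (χ (Φ t v) • (f (Φ t v)).2.2.2) t :=
    fun t v => (hasFDerivAt_snd.comp_hasDerivAt t (hd'' t v) :)
  have hd4 : ∀ t v, HasDerivAt (fun s => (Φ s v).2.2.2.1) (χ (Φ t v) * (f (Φ t v)).2.2.2.1) t :=
    fun t v => (hasFDerivAt_fst.comp_hasDerivAt t (hd''' t v) :)
  have hd5 : ∀ t v, HasDerivAt (fun s => (Φ s v).2.2.2.2) (χ (Φ t v) * (f (Φ t v)).2.2.2.2) t :=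
    fun t v => (hasFDerivAt_snd.comp_hasDerivAt t (hd''' t v) :)
  have hΦ1 : ∀ t v, (Φ t v).1 = v.1 := fun t v => by
    have := is_const_of_deriv_eq_zero (f := fun s => (Φ s v).1)
      (fun t => (hd1 t v).differentiableAt) (fun t => (hd1 t v).deriv) t 0
    simpa [hΦ0] using this
  let φ : ℝ → ℝ → PhasePt → PhasePt := fun t ε z =>
    let v := Φ t (ε, z.q₁, z.p₁, z.q₂, z.p₂)
    ⟨v.2.1, v.2.2.1, v.2.2.2.1, v.2.2.2.2⟩
  have hφ0 : ∀ ε z, φ 0 ε z = z := fun ε z => by simp [φ, hΦ0]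
  have hΦφ : ∀ t ε z, Φ t (ε, z.q₁, z.p₁, z.q₂, z.p₂) =
      (ε, (φ t ε z).q₁, (φ t ε z).p₁, (φ t ε z).q₂, (φ t ε z).p₂) := fun t ε z => by
    refine Prod.ext (hΦ1 t _) rfl
  have hham : ∀ ε z t, S.ham ε (φ t ε z) = S.ham ε z := by
    intro ε z t
    have hd : ∀ t, HasDerivAt (fun t => S.ham ε (φ t ε z)) 0 t := by
      intro t
      have := S.hasDerivWithinAt_ham ε (z := fun t => φ t ε z) (s := univ) (t := t)
        (hd2 t _).hasDerivWithinAt (hd3 t _).hasDerivWithinAt (hd4 t _).hasDerivWithinAt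
        (hd5 t _).hasDerivWithinAt
      rw [hasDerivWithinAt_univ] at this
      refine this.congr_deriv ?_
      rw [hΦφ]
      simp only [f, force₁_eq, force₂_eq]
      ring
    have := is_const_of_deriv_eq_zero (fun t => (hd t).differentiableAt) (fun t => (hd t).deriv) t 0
    simpa [hφ0] using this
  -- the energy surface does not meet the boundary of the box
  have hmem : ∀ ε, |ε| ≤ ε₀ → ∀ z ∈ S.dom E B ε, ∀ t, φ t ε z ∈ S.dom E B ε := by
    intro ε hε z hz t
    have hc₁ : Continuous fun t => (φ t ε z).q₁ :=
      continuous_iff_continuousAt.2 fun t => (hd2 t _).continuousAt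
    have hc₂ : Continuous fun t => (φ t ε z).q₂ :=
      continuous_iff_continuousAt.2 fun t => (hd4 t _).continuousAt
    have hmax : ∀ t, max |(φ t ε z).q₁| |(φ t ε z).q₂| < B := by
      by_contra hcon
      push Not at hcon
      obtain ⟨s, hs⟩ := hcon
      have hcm : Continuous fun t => max |(φ t ε z).q₁| |(φ t ε z).q₂| := by fun_prop
      obtain ⟨u, hu⟩ := mem_range_of_exists_le_of_exists_ge hcm
        ⟨0, by simpa [hφ0] using ⟨hz.1.le, hz.2.1.le⟩⟩ ⟨s, hs⟩
      simp only at hu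
      have hb₁ : |(φ u ε z).q₁| ≤ B := hu ▸ le_max_left _ _
      have hb₂ : |(φ u ε z).q₂| ≤ B := hu ▸ le_max_right _ _
      have h3 := (abs_le.1 (hεV ε hε _ _ hb₁ hb₂)).1
      have h4 := (hham ε z u).trans_le hz.2.2
      have h5 := S.isWell_V₁.nonneg (φ u ε z).q₁
      have h6 := S.isWell_V₂.nonneg (φ u ε z).q₂
      rw [ham] at h4
      rcases max_choice |(φ u ε z).q₁| |(φ u ε z).q₂| with h | h
      · have := hBV₁ _ (h.symm.trans hu)
        nlinarith [sq_nonneg (φ u ε z).p₁, sq_nonneg (φ u ε z).p₂]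
      · have := hBV₂ _ (h.symm.trans hu)
        nlinarith [sq_nonneg (φ u ε z).p₁, sq_nonneg (φ u ε z).p₂]
    exact ⟨(le_max_left _ _).trans_lt (hmax t), (le_max_right _ _).trans_lt (hmax t),
      (hham ε z t).trans_le hz.2.2⟩
  have hχ : ∀ ε, |ε| ≤ ε₀ → ∀ z ∈ S.dom E B ε, ∀ t,
      χ (Φ t (ε, z.q₁, z.p₁, z.q₂, z.p₂)) = 1 := fun ε hε z hz t => by
    rw [hΦφ]
    exact h1 _ (hbdd ε hε _ (hmem ε hε z hz t))
  refine ⟨⟨φ, fun t ε z => k t (ε, z.q₁, z.p₁, z.q₂, z.p₂), B, ε₀, M, le_max_left _ _, hε₀, hM, hVc,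
    hd₁, hΦ.snd.fst, hΦ.snd.snd.fst, hΦ.snd.snd.snd.fst, hk, hφ0, fun ε z => hk0 _, hmem,
    fun ε _ z _ t => hham ε z t, ?_, ?_, ?_, ?_, ?_, ?_⟩⟩
  · intro ε hε z hz t
    refine (hd2 t _).congr_deriv ?_
    rw [hχ ε hε z hz t, one_mul, hΦφ]
  · intro ε hε z hz t
    refine (hd3 t _).congr_deriv ?_
    rw [hχ ε hε z hz t, one_mul, hΦφ]
    rfl
  · intro ε hε z hz t
    refine (hd4 t _).congr_deriv ?_
    rw [hχ ε hε z hz t, one_mul, hΦφ]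
  · intro ε hε z hz t
    refine (hd5 t _).congr_deriv ?_
    rw [hχ ε hε z hz t, one_mul, hΦφ]
    rfl
  · intro ε hε z hz t
    refine (hdk t _).congr_deriv ?_
    rw [hχ ε hε z hz t, one_smul, hΦφ]
  · intro ε hε a b z hc1 hc2 hc3 hc4 h'1 h'2 h'3 h'4 hz t ht
    have hd : ∀ t ∈ Ico a b, HasDerivWithinAt
        (fun t => ((ε, (z t).q₁, (z t).p₁, (z t).q₂, (z t).p₂) : ℝ × ℝ × ℝ × ℝ × ℝ))
        ((fun v => χ v • f v) (ε, (z t).q₁, (z t).p₁, (z t).q₂, (z t).p₂)) (Ici t) t := by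
      intro t ht
      simp only
      rw [h1 _ (hbdd ε hε _ (hz t ht)), one_smul]
      exact (hasDerivWithinAt_const t (Ici t) ε).prodMk ((h'1 t ht).prodMk ((h'2 t ht).prodMk
        ((h'3 t ht).prodMk (h'4 t ht))))
    have := ODE_solution_unique (v := fun _ v => χ v • f v) (K := K) (fun _ => hK)
      (continuousOn_const.prodMk (hc1.prodMk (hc2.prodMk (hc3.prodMk hc4)))) hd
      (g := fun t => Φ (t - a) (ε, (z a).q₁, (z a).p₁, (z a).q₂, (z a).p₂))
      (fun t _ => ((hdΦ (t - a) _).comp_sub_const t a).continuousAt.continuousWithinAt)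
      (fun t _ => ((hdΦ (t - a) _).comp_sub_const t a).hasDerivWithinAt) (by simp [hΦ0])
    have h2 := this ht
    simp only [hΦφ, Prod.mk.injEq, true_and] at h2
    exact PhasePt.ext h2.1 h2.2.1 h2.2.2.1 h2.2.2.2

end WallSystem

/-! ### Trajectories of the wall system -/

namespace WallSystem

variable {r : ℕ} {S : WallSystem r} {E R : ℝ}

/-- The smallness of `ε` under which the trajectories of the wall system are described by those of
the wall-free flow: the energy surface does not meet the boundary of the box `|q₁|, |q₂| < R`, the
wall repels, and a trajectory at rest in an equilibrium of the first degree of freedom cannot reach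
the wall in one descent. -/
structure FreeFlow.IsSmall (F : S.FreeFlow E R) (ε : ℝ) : Prop where
  nonneg : 0 ≤ ε
  le : |ε| ≤ F.ε₀
  box : ∀ x y, S.w ≤ x → |x| ≤ R → |y| ≤ R → (|x| = R ∨ |y| = R) →
    E < S.V₁ x + S.V₂ y + ε * S.Vc (x, y)
  wall : ∀ y, |y| ≤ R → 0 < -deriv S.V₁ S.w - ε * S.d₁Vc S.w y
  slow : ∀ x y, |x| ≤ R → |y| ≤ R → deriv S.V₁ x + ε * S.d₁Vc x y = 0 →
    S.V₁ x + ε * F.M * (2 * R) < S.V₁ S.w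

lemma continuous_force₁ (ε : ℝ) : Continuous fun v : ℝ × ℝ =>
    -deriv S.V₁ v.1 - ε * S.d₁Vc v.1 v.2 :=
  (S.isWell_V₁.continuous_deriv.comp continuous_fst).neg.sub
    (continuous_const.mul S.contDiff_d₁Vc.continuous)

namespace IsWallArc

variable {ε T : ℝ} {z : ℝ → PhasePt}

lemma deriv_right_q₂ (hz : S.IsWallArc ε T z) {t : ℝ} (ht : t ∈ Ico 0 T) :
    HasDerivWithinAt (fun s => (z s).q₂) (z t).p₂ (Ici t) t :=
  ((hz.ode_q₂ t ⟨ht.1, ht.2.le⟩).mono (Icc_subset_Icc_left ht.1)).mono_of_mem_nhdsWithin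
    (Icc_mem_nhdsGE ht.2)

lemma deriv_right_p₂ (hz : S.IsWallArc ε T z) {t : ℝ} (ht : t ∈ Ico 0 T) :
    HasDerivWithinAt (fun s => (z s).p₂) (S.force₂ ε (z t)) (Ici t) t :=
  ((hz.ode_p₂ t ⟨ht.1, ht.2.le⟩).mono (Icc_subset_Icc_left ht.1)).mono_of_mem_nhdsWithin
    (Icc_mem_nhdsGE ht.2)

lemma deriv_right_q₁ (hz : S.IsWallArc ε T z) {t : ℝ} (ht : t ∈ Ico 0 T) :
    HasDerivWithinAt (fun s => (z s).q₁) (z t).p₁ (Ici t) t := by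
  have ht' : t ∈ Icc 0 T := ⟨ht.1, ht.2.le⟩
  refine HasDerivWithinAt.mono_of_mem_nhdsWithin ?_ (Icc_mem_nhdsGE ht.2)
  rcases (hz.right_of_wall t ht').eq_or_lt with h | h
  · exact hz.after_q₁ t ht' h.symm
  · exact (hz.ode_q₁ t ht' h).mono (Icc_subset_Icc_left ht.1)

lemma deriv_right_p₁ (hz : S.IsWallArc ε T z) {t : ℝ} (ht : t ∈ Ico 0 T) :
    HasDerivWithinAt (fun s => (z s).p₁) (S.force₁ ε (z t)) (Ici t) t := by
  have ht' : t ∈ Icc 0 T := ⟨ht.1, ht.2.le⟩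
  refine HasDerivWithinAt.mono_of_mem_nhdsWithin ?_ (Icc_mem_nhdsGE ht.2)
  rcases (hz.right_of_wall t ht').eq_or_lt with h | h
  · exact hz.after_p₁ t ht' h.symm
  · exact (hz.ode_p₁ t ht' h).mono (Icc_subset_Icc_left ht.1)

lemma continuousOn_ham (hz : S.IsWallArc ε T z) :
    ContinuousOn (fun t => S.ham ε (z t)) (Icc 0 T) := by
  have hq₂ : ContinuousOn (fun t => (z t).q₂) (Icc 0 T) := fun t ht =>
    (hz.ode_q₂ t ht).continuousWithinAt
  have hp₂ : ContinuousOn (fun t => (z t).p₂) (Icc 0 T) := fun t ht =>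
    (hz.ode_p₂ t ht).continuousWithinAt
  -- the reflections preserve `p₁²`
  have hp₁ : ContinuousOn (fun t => (z t).p₁ ^ 2) (Icc 0 T) := by
    intro t ht
    rcases (hz.right_of_wall t ht).eq_or_lt with h | h
    · have h1 : ContinuousWithinAt (fun t => (z t).p₁ ^ 2) (Ico 0 t) t := by
        have := (hz.reflect t ht h.symm).pow 2
        rwa [neg_sq] at this
      have h2 : ContinuousWithinAt (fun t => (z t).p₁ ^ 2) (Icc t T) t :=
        (hz.after_p₁ t ht h.symm).continuousWithinAt.pow 2
      exact (h1.union h2).mono fun s hs => (lt_or_ge s t).imp (fun h => ⟨hs.1, h⟩)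
        fun h => ⟨h, hs.2⟩
    · exact (hz.ode_p₁ t ht h).continuousWithinAt.pow 2
  have hV₁ := S.isWell_V₁.contDiff.continuous.comp_continuousOn hz.cont_q₁
  have hV₂ := S.isWell_V₂.contDiff.continuous.comp_continuousOn hq₂
  have hVc := S.contDiff_Vc.continuous.comp_continuousOn (hz.cont_q₁.prodMk hq₂)
  exact (((hp₁.div_const 2).add hV₁).add (((hp₂.pow 2).div_const 2).add hV₂)).add
    (continuousOn_const.mul hVc)

lemma ham_eq (hz : S.IsWallArc ε T z) {t : ℝ} (ht : t ∈ Icc 0 T) :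
    S.ham ε (z t) = S.ham ε (z 0) := by
  refine constant_of_has_deriv_right_zero hz.continuousOn_ham (fun t ht => ?_) t ht
  exact (S.hasDerivWithinAt_ham ε (hz.deriv_right_q₁ ht) (hz.deriv_right_p₁ ht)
    (hz.deriv_right_q₂ ht) (hz.deriv_right_p₂ ht)).congr_deriv (by ring)

lemma mem_box {F : S.FreeFlow E R} (hε : F.IsSmall ε) (hz : S.IsWallArc ε T z)
    (h0 : z 0 ∈ S.sect ε E R) {t : ℝ} (ht : t ∈ Icc 0 T) : |(z t).q₁| < R ∧ |(z t).q₂| < R := by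
  by_contra hcon
  have hcon' : R ≤ max |(z t).q₁| |(z t).q₂| := by
    by_contra h
    exact hcon (max_lt_iff.1 (not_le.1 h))
  have hsub : Icc 0 t ⊆ Icc 0 T := Icc_subset_Icc_right ht.2
  have hc : ContinuousOn (fun t => max |(z t).q₁| |(z t).q₂|) (Icc 0 t) :=
    (hz.cont_q₁.mono hsub).abs.sup
      (ContinuousOn.abs fun s hs => ((hz.ode_q₂ s (hsub hs)).continuousWithinAt.mono hsub))
  obtain ⟨u, hu, huR⟩ := intermediate_value_Icc ht.1 hc
    ⟨(max_lt h0.2.1 h0.2.2.1).le, hcon'⟩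
  have huT := hsub hu
  simp only at huR
  have h1 := hε.box _ _ (hz.right_of_wall u huT) (huR ▸ le_max_left _ _) (huR ▸ le_max_right _ _)
    ((max_choice |(z u).q₁| |(z u).q₂|).imp (fun h => h.symm.trans huR)
      fun h => h.symm.trans huR)
  have h2 := (hz.ham_eq huT).trans h0.2.2.2.2.2
  rw [ham] at h2
  nlinarith [sq_nonneg (z u).p₁, sq_nonneg (z u).p₂]

lemma mem_dom {F : S.FreeFlow E R} (hε : F.IsSmall ε) (hz : S.IsWallArc ε T z)
    (h0 : z 0 ∈ S.sect ε E R) {t : ℝ} (ht : t ∈ Icc 0 T) : z t ∈ S.dom E F.B ε := by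
  obtain ⟨h1, h2⟩ := hz.mem_box hε h0 ht
  refine ⟨h1.trans_le F.R_le, h2.trans_le F.R_le, ?_⟩
  rw [hz.ham_eq ht, h0.2.2.2.2.2]
  linarith

/-- While the momentum is nonnegative, the position does not decrease. -/
lemma q₁_le_of_p₁_nonneg (hz : S.IsWallArc ε T z) {a b : ℝ} (ha : 0 ≤ a) (hab : a ≤ b)
    (hb : b ≤ T) (hp : ∀ t ∈ Ico a b, 0 ≤ (z t).p₁) : (z a).q₁ ≤ (z b).q₁ :=
  image_le_of_deriv_right_le_deriv_boundary (f := fun _ => (z a).q₁) (f' := fun _ => 0)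
    continuousOn_const (fun _ _ => hasDerivWithinAt_const _ _ _) le_rfl
    (hz.cont_q₁.mono (Icc_subset_Icc ha hb))
    (fun _ ht => hz.deriv_right_q₁ ⟨ha.trans ht.1, ht.2.trans_le hb⟩) hp (right_mem_Icc.2 hab)

lemma p₁_nonneg_of_contact (hz : S.IsWallArc ε T z) {t : ℝ} (ht : t ∈ Ico 0 T)
    (hw : (z t).q₁ = S.w) : 0 ≤ (z t).p₁ := by
  have h1 := (hasDerivWithinAt_iff_tendsto_slope' (s := Ioi t) (by simp)).1
    ((hz.deriv_right_q₁ ht).mono Ioi_subset_Ici_self)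
  refine ge_of_tendsto h1 ?_
  filter_upwards [Ioo_mem_nhdsGT ht.2] with s hs
  rw [slope_def_field, hw]
  exact div_nonneg (sub_nonneg.2 (hz.right_of_wall s ⟨ht.1.trans hs.1.le, hs.2.le⟩))
    (sub_nonneg.2 hs.1.le)

/-- A trajectory leaves the wall immediately after a contact, even a tangential one. -/
lemma exists_after_contact {F : S.FreeFlow E R} (hε : F.IsSmall ε) (hz : S.IsWallArc ε T z)
    (h0 : z 0 ∈ S.sect ε E R) {t : ℝ} (ht : t ∈ Ico 0 T) (hw : (z t).q₁ = S.w) :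
    ∃ b, t < b ∧ b ≤ T ∧ ∀ s ∈ Ioo t b, S.w < (z s).q₁ ∧ 0 < (z s).p₁ := by
  have hp : ∃ b, t < b ∧ b ≤ T ∧ ∀ s ∈ Ioo t b, 0 < (z s).p₁ := by
    have hev : ∀ᶠ s in 𝓝[>] t, 0 < (z s).p₁ := by
      have hd := (hz.deriv_right_p₁ ht).mono Ioi_subset_Ici_self
      rcases (hz.p₁_nonneg_of_contact ht hw).eq_or_lt with h | h
      · have hf : 0 < S.force₁ ε (z t) := by
          rw [force₁_eq, hw]
          exact hε.wall _ (hz.mem_box hε h0 ⟨ht.1, ht.2.le⟩).2.le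
        have h1 := (hasDerivWithinAt_iff_tendsto_slope' (s := Ioi t) (by simp)).1 hd
        filter_upwards [h1.eventually (lt_mem_nhds hf), self_mem_nhdsWithin] with s hs hs'
        rw [slope_def_field, ← h, sub_zero] at hs
        exact (div_pos_iff_of_pos_right (sub_pos.2 hs')).1 hs
      · exact hd.continuousWithinAt.eventually (lt_mem_nhds h)
    obtain ⟨b, hb, hb'⟩ := mem_nhdsGT_iff_exists_Ioo_subset.1 hev
    exact ⟨min b T, lt_min hb ht.2, min_le_right _ _, fun s hs =>
      hb' ⟨hs.1, hs.2.trans_le (min_le_left _ _)⟩⟩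
  obtain ⟨b, htb, hbT, hb⟩ := hp
  refine ⟨b, htb, hbT, fun s hs => ⟨?_, hb s hs⟩⟩
  have hsT : s ∈ Icc 0 T := ⟨ht.1.trans hs.1.le, hs.2.le.trans hbT⟩
  refine lt_of_le_of_ne (hz.right_of_wall s hsT) fun heq => ?_
  -- otherwise the trajectory stays at the wall, so that its momentum vanishes
  have hconst : ∀ u ∈ Ioo t s, (z u).q₁ = S.w := fun u hu => le_antisymm (by
    rw [heq]
    exact hz.q₁_le_of_p₁_nonneg (ht.1.trans hu.1.le) hu.2.le hsT.2 fun v hv =>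
      (hb v ⟨hu.1.trans_le hv.1, hv.2.trans hs.2⟩).le)
    (hz.right_of_wall u ⟨ht.1.trans hu.1.le, hu.2.le.trans hsT.2⟩)
  obtain ⟨u, hu⟩ := nonempty_Ioo.2 hs.1
  have hd := hz.deriv_right_q₁ (t := u) ⟨ht.1.trans hu.1.le, hu.2.trans_le hsT.2⟩
  have hd' : HasDerivWithinAt (fun s => (z s).q₁) 0 (Ici u) u := by
    refine (hasDerivWithinAt_const u (Ici u) S.w).congr_of_eventuallyEq ?_ (hconst u hu)
    filter_upwards [Ico_mem_nhdsGE hu.2] with v hv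
    exact hconst v ⟨hu.1.trans_le hv.1, hv.2⟩
  have := (uniqueDiffWithinAt_Ici u).eq_deriv _ hd hd'
  exact (hb u ⟨hu.1, hu.2.trans hs.2⟩).ne' this

/-- Between two contacts with the wall, a trajectory follows the wall-free flow, and at the second
contact the momentum `p₁` is reversed. -/
lemma eq_flow {F : S.FreeFlow E R} (hε : F.IsSmall ε) (hz : S.IsWallArc ε T z)
    (h0 : z 0 ∈ S.sect ε E R) {a b : ℝ} (ha : 0 ≤ a) (hab : a < b) (hb : b ≤ T)
    (hfree : ∀ t ∈ Ioo a b, S.w < (z t).q₁) :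
    (∀ t ∈ Ico a b, z t = F.φ (t - a) ε (z a)) ∧
      (z b).q₁ = (F.φ (b - a) ε (z a)).q₁ ∧ (z b).q₂ = (F.φ (b - a) ε (z a)).q₂ ∧
      (z b).p₂ = (F.φ (b - a) ε (z a)).p₂ ∧
      (S.w < (z b).q₁ → (z b).p₁ = (F.φ (b - a) ε (z a)).p₁) ∧
      ((z b).q₁ = S.w → (z b).p₁ = -(F.φ (b - a) ε (z a)).p₁) := by
  have hsub : Icc a b ⊆ Icc 0 T := Icc_subset_Icc ha hb
  have hsub' : Ico a b ⊆ Ico 0 T := Ico_subset_Ico ha hb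
  have hdom := hz.mem_dom hε h0 (t := a) ⟨ha, hab.le.trans hb⟩
  have hflow : ∀ t ∈ Ico a b, z t = F.φ (t - a) ε (z a) := by
    intro t ht
    have hst : Icc a t ⊆ Icc 0 T := Icc_subset_Icc ha (ht.2.le.trans hb)
    have hst' : Ico a t ⊆ Ico 0 T := Ico_subset_Ico ha (ht.2.le.trans hb)
    refine F.unique ε hε.le a t z (hz.cont_q₁.mono hst) (fun s hs => ?_)
      (fun s hs => (hz.ode_q₂ s (hst hs)).continuousWithinAt.mono hst)
      (fun s hs => (hz.ode_p₂ s (hst hs)).continuousWithinAt.mono hst)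
      (fun s hs => hz.deriv_right_q₁ (hst' hs)) (fun s hs => hz.deriv_right_p₁ (hst' hs))
      (fun s hs => hz.deriv_right_q₂ (hst' hs)) (fun s hs => hz.deriv_right_p₂ (hst' hs))
      (fun s hs => hz.mem_dom hε h0 (hst (Ico_subset_Icc_self hs))) t ⟨ht.1, le_rfl⟩
    rcases hs.1.eq_or_lt with rfl | h
    · exact (hz.deriv_right_p₁ (hsub' ⟨le_rfl, hab⟩)).continuousWithinAt.mono Icc_subset_Ici_self
    · exact (hz.ode_p₁ s (hst hs) (hfree s ⟨h, hs.2.trans_lt ht.2⟩)).continuousWithinAt.mono hst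
  have hbT : b ∈ Icc 0 T := ⟨ha.trans hab.le, hb⟩
  have hne : (𝓝[Ico a b] b).NeBot := by
    rw [← mem_closure_iff_nhdsWithin_neBot, closure_Ico hab.ne]
    exact right_mem_Icc.2 hab.le
  have hsubI : Ico a b ⊆ Icc 0 T := Ico_subset_Icc_self.trans hsub
  -- comparison of limits from the left
  have hlim : ∀ (f g : ℝ → ℝ) (x : ℝ), Tendsto f (𝓝[Ico a b] b) (𝓝 x) → ContinuousAt g b →
      (∀ t ∈ Ico a b, f t = g t) → x = g b := fun f g x hf hg hfg =>
    tendsto_nhds_unique hf ((hg.tendsto.mono_left nhdsWithin_le_nhds).congr' (by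
      filter_upwards [self_mem_nhdsWithin] with t ht
      exact (hfg t ht).symm))
  have hd1 := ((F.deriv_q₁ ε hε.le _ hdom (b - a)).comp_sub_const b a).continuousAt
  have hd2 := ((F.deriv_p₁ ε hε.le _ hdom (b - a)).comp_sub_const b a).continuousAt
  have hd3 := ((F.deriv_q₂ ε hε.le _ hdom (b - a)).comp_sub_const b a).continuousAt
  have hd4 := ((F.deriv_p₂ ε hε.le _ hdom (b - a)).comp_sub_const b a).continuousAt
  refine ⟨hflow, ?_, ?_, ?_, fun hw => ?_, fun hw => ?_⟩
  · exact hlim _ _ _ ((hz.cont_q₁ b hbT).mono hsubI) hd1 fun t ht => by rw [hflow t ht]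
  · exact hlim _ _ _ ((hz.ode_q₂ b hbT).continuousWithinAt.mono hsubI) hd3
      fun t ht => by rw [hflow t ht]
  · exact hlim _ _ _ ((hz.ode_p₂ b hbT).continuousWithinAt.mono hsubI) hd4
      fun t ht => by rw [hflow t ht]
  · exact hlim _ _ _ ((hz.ode_p₁ b hbT hw).continuousWithinAt.mono hsubI) hd2
      fun t ht => by rw [hflow t ht]
  · have h1 := (hz.reflect b hbT hw).mono_left (nhdsWithin_mono b (Ico_subset_Ico_left ha))
    have h2 := hlim _ _ _ h1 hd2 fun t ht => by rw [hflow t ht]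
    linarith

/-- A trajectory stays off the wall as long as the wall-free flow does. -/
lemma free_of_flow {F : S.FreeFlow E R} (hε : F.IsSmall ε) (hz : S.IsWallArc ε T z)
    (h0 : z 0 ∈ S.sect ε E R) {a c : ℝ} (ha : 0 ≤ a) {b₀ : ℝ} (hb₀ : a < b₀)
    (hstart : ∀ t ∈ Ioo a b₀, t ≤ T → S.w < (z t).q₁)
    (hflow : ∀ s ∈ Ioo 0 c, S.w < (F.φ s ε (z a)).q₁) {t : ℝ} (ht : a < t) (htT : t ≤ T)
    (htc : t < a + c) : S.w < (z t).q₁ := by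
  by_contra hcon
  have hw : (z t).q₁ = S.w :=
    le_antisymm (not_lt.1 hcon) (hz.right_of_wall t ⟨ha.trans ht.le, htT⟩)
  set m := (a + min b₀ t) / 2 with hm
  have hmin : a < min b₀ t := lt_min hb₀ ht
  have ham : a < m := by linarith
  have hmb : m < b₀ := by linarith [min_le_left b₀ t]
  have hmt : m < t := by linarith [min_le_right b₀ t]
  have hsub : Icc m t ⊆ Icc 0 T := Icc_subset_Icc (ha.trans ham.le) htT
  have hK : IsCompact (Icc m t ∩ (fun s => (z s).q₁) ⁻¹' {S.w}) :=
    isCompact_Icc.of_isClosed_subset ((hz.cont_q₁.mono hsub).preimage_isClosed_of_isClosed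
      isClosed_Icc isClosed_singleton) inter_subset_left
  obtain ⟨u, ⟨hu, huw⟩, hmin⟩ := hK.exists_isLeast ⟨t, ⟨hmt.le, le_rfl⟩, hw⟩
  have huw : (z u).q₁ = S.w := huw
  have hau : a < u := ham.trans_le hu.1
  have h1 := (hz.eq_flow hε h0 ha hau (hu.2.trans htT) fun s hs => by
    rcases lt_or_ge s m with h | h
    · exact hstart s ⟨hs.1, h.trans hmb⟩ (hs.2.le.trans (hu.2.trans htT))
    · refine lt_of_le_of_ne (hz.right_of_wall s ⟨ha.trans hs.1.le, hs.2.le.trans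
        (hu.2.trans htT)⟩) fun heq => ?_
      exact (hmin ⟨⟨h, hs.2.le.trans hu.2⟩, heq.symm⟩).not_gt hs.2).2.1
  have h2 := hflow (u - a) ⟨by linarith, by linarith [hu.2]⟩
  rw [← h1, huw] at h2
  exact h2.false

/-- Where the force points to the right, a trajectory off the wall with nonnegative momentum does
not reach the wall. -/
lemma lt_q₁_of_p₁_nonneg (hz : S.IsWallArc ε T z) {a b t : ℝ} (ha : 0 ≤ a) (hb : b ≤ T)
    (hfree : ∀ t ∈ Ioo a b, S.w < (z t).q₁) (hforce : ∀ t ∈ Ioo a b, 0 < S.force₁ ε (z t))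
    (ht : t ∈ Ioo a b) (hp : 0 ≤ (z t).p₁) : S.w < (z b).q₁ := by
  refine (hfree t ht).trans_le (hz.q₁_le_of_p₁_nonneg (ha.trans ht.1.le) ht.2.le hb fun u hu => ?_)
  have hsub : Icc t u ⊆ Icc 0 T := Icc_subset_Icc (ha.trans ht.1.le) (hu.2.le.trans hb)
  refine hp.trans (image_le_of_deriv_right_le_deriv_boundary (f := fun _ => (z t).p₁)
    (f' := fun _ => 0) continuousOn_const (fun _ _ => hasDerivWithinAt_const _ _ _) le_rfl
    (B := fun u => (z u).p₁) (B' := fun u => S.force₁ ε (z u)) (fun s hs => ?_) (fun s hs => ?_)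
    (fun s hs => ?_) (right_mem_Icc.2 hu.1))
  · exact (hz.ode_p₁ s (hsub hs) (hfree s ⟨ht.1.trans_le hs.1,
      hs.2.trans_lt hu.2⟩)).continuousWithinAt.mono hsub
  · exact hz.deriv_right_p₁ ⟨(ha.trans ht.1.le).trans hs.1, (hs.2.trans hu.2).trans_le hb⟩
  · exact (hforce s ⟨ht.1.trans_le hs.1, hs.2.trans hu.2⟩).le

/-- Before a contact with the wall which precedes the first return to the section, the momentum
`p₁` is negative ever since the start: the trajectory reaches the wall in its first descent. -/
lemma p₁_neg_of_contact {F : S.FreeFlow E R} (hε : F.IsSmall ε) (hz : S.IsWallArc ε T z)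
    (h0 : z 0 ∈ S.sect ε E R) (hT : 0 < T) (hns : ∀ t ∈ Ioc 0 T, z t ∉ S.sect ε E R)
    (hw : (z T).q₁ = S.w) : ∀ t ∈ Ioo 0 T, (z t).p₁ < 0 := by
  have hTT : T ∈ Icc 0 T := ⟨hT.le, le_rfl⟩
  have hcq₂ : ContinuousOn (fun t => (z t).q₂) (Icc 0 T) := fun t ht =>
    (hz.ode_q₂ t ht).continuousWithinAt
  -- near the contact time the force points to the right
  obtain ⟨a, ha, haforce⟩ : ∃ a ∈ Ico 0 T, ∀ t ∈ Ioo a T, 0 < S.force₁ ε (z t) := by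
    have hc : ContinuousWithinAt (fun t => S.force₁ ε (z t)) (Icc 0 T) T :=
      (S.continuous_force₁ ε).continuousAt.comp_continuousWithinAt
        ((hz.cont_q₁ T hTT).prodMk (hcq₂ T hTT))
    have hf : 0 < S.force₁ ε (z T) := by
      rw [force₁_eq, hw]
      exact hε.wall _ (hz.mem_box hε h0 hTT).2.le
    have h1 : ∀ᶠ t in 𝓝[<] T, 0 < S.force₁ ε (z t) :=
      (hc.mono_of_mem_nhdsWithin (Icc_mem_nhdsLT hT)).eventually (lt_mem_nhds hf)
    obtain ⟨a, ha, ha'⟩ := mem_nhdsLT_iff_exists_Ioo_subset.1 h1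
    exact ⟨max a 0, ⟨le_max_right _ _, max_lt ha hT⟩, fun t ht =>
      ha' ⟨(le_max_left _ _).trans_lt ht.1, ht.2⟩⟩
  have hfree : ∀ t ∈ Ioo a T, S.w < (z t).q₁ := by
    intro s hs
    by_contra hcon
    have hsT : s ∈ Ico 0 T := ⟨ha.1.trans hs.1.le, hs.2⟩
    have hsw : (z s).q₁ = S.w :=
      le_antisymm (not_lt.1 hcon) (hz.right_of_wall s ⟨hsT.1, hsT.2.le⟩)
    obtain ⟨b, hsb, hbT, hb⟩ := hz.exists_after_contact hε h0 hsT hsw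
    set m := (s + b) / 2
    have hm : s < m ∧ m < b := ⟨by simp only [m]; linarith, by simp only [m]; linarith⟩
    have hsub : Icc m T ⊆ Icc 0 T := Icc_subset_Icc_left (hsT.1.trans hm.1.le)
    have hK : IsCompact (Icc m T ∩ (fun s => (z s).q₁) ⁻¹' {S.w}) :=
      isCompact_Icc.of_isClosed_subset ((hz.cont_q₁.mono hsub).preimage_isClosed_of_isClosed
        isClosed_Icc isClosed_singleton) inter_subset_left
    obtain ⟨u, ⟨hu, huw⟩, hmin⟩ := hK.exists_isLeast ⟨T, ⟨(hm.2.trans_le hbT).le, le_rfl⟩, hw⟩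
    have huw : (z u).q₁ = S.w := huw
    have hmu : m < u := lt_of_le_of_ne hu.1 fun h =>
      (hb m ⟨hm.1, hm.2⟩).1.ne' (h ▸ huw)
    have := hz.lt_q₁_of_p₁_nonneg hsT.1 hu.2 (fun t ht => ?_)
      (fun t ht => haforce t ⟨hs.1.trans ht.1, ht.2.trans_le hu.2⟩) ⟨hm.1, hmu⟩
      (hb m ⟨hm.1, hm.2⟩).2.le
    · exact this.ne' huw
    · rcases lt_or_ge t b with h | h
      · exact (hb t ⟨ht.1, h⟩).1
      · refine lt_of_le_of_ne (hz.right_of_wall t ⟨hsT.1.trans ht.1.le, ht.2.le.trans hu.2⟩)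
          fun heq => ?_
        exact (hmin ⟨⟨hm.2.le.trans h, ht.2.le.trans hu.2⟩, heq.symm⟩).not_gt ht.2
  have hnear : ∀ t ∈ Ioo a T, (z t).p₁ < 0 := fun t ht => by
    by_contra h
    exact (hz.lt_q₁_of_p₁_nonneg ha.1 le_rfl hfree haforce ht (not_lt.1 h)).ne' hw
  intro t₀ ht₀
  by_contra hcon
  -- the last time `s` before the contact with nonnegative momentum
  set A := {t | t ∈ Ico t₀ T ∧ 0 ≤ (z t).p₁} with hA
  have hAne : A.Nonempty := ⟨t₀, ⟨le_rfl, ht₀.2⟩, not_lt.1 hcon⟩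
  have hAle : ∀ t ∈ A, t ≤ a := fun t ht => by
    by_contra h
    exact (hnear t ⟨not_le.1 h, ht.1.2⟩).not_ge ht.2
  have hbdd : BddAbove A := ⟨a, hAle⟩
  set s := sSup A with hs
  have hst₀ : t₀ ≤ s := le_csSup hbdd ⟨⟨le_rfl, ht₀.2⟩, not_lt.1 hcon⟩
  have hsT : s < T := (csSup_le hAne hAle).trans_lt ha.2
  have hs0 : 0 < s := ht₀.1.trans_le hst₀
  have hsI : s ∈ Icc 0 T := ⟨hs0.le, hsT.le⟩
  have hafter : ∀ t ∈ Ioo s T, (z t).p₁ < 0 := fun t ht => by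
    by_contra h
    exact (le_csSup hbdd ⟨⟨hst₀.trans ht.1.le, ht.2⟩, not_lt.1 h⟩).not_gt ht.1
  have hsw : S.w < (z s).q₁ := by
    refine lt_of_le_of_ne (hz.right_of_wall s hsI) fun heq => ?_
    obtain ⟨b, hsb, hbT, hb⟩ := hz.exists_after_contact hε h0 ⟨hs0.le, hsT⟩ heq.symm
    obtain ⟨u, hu⟩ := nonempty_Ioo.2 hsb
    exact (hb u hu).2.not_gt (hafter u ⟨hu.1, hu.2.trans_le hbT⟩)
  have hsfree : ∀ t ∈ Ioo s T, S.w < (z t).q₁ := fun t ht => by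
    refine lt_of_le_of_ne (hz.right_of_wall t ⟨hs0.le.trans ht.1.le, ht.2.le⟩) fun heq => ?_
    exact (hafter t ht).not_ge
      (hz.p₁_nonneg_of_contact ⟨hs0.le.trans ht.1.le, ht.2⟩ heq.symm)
  have hcp := (hz.ode_p₁ s hsI hsw).continuousWithinAt
  have hps : (z s).p₁ = 0 := by
    refine le_antisymm ?_ ?_
    · have h1 : Tendsto (fun t => (z t).p₁) (𝓝[>] s) (𝓝 (z s).p₁) :=
        hcp.mono_of_mem_nhdsWithin (Icc_mem_nhdsGT_of_mem ⟨hs0.le, hsT⟩)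
      refine le_of_tendsto h1 ?_
      filter_upwards [Ioo_mem_nhdsGT hsT] with t ht
      exact (hafter t ht).le
    · have h1 : s ∈ closure A := csSup_mem_closure hAne hbdd
      have h2 : A ⊆ Icc 0 T := fun t ht => ⟨ht₀.1.le.trans ht.1.1, ht.1.2.le⟩
      have : (𝓝[A] s).NeBot := mem_closure_iff_nhdsWithin_neBot.1 h1
      refine ge_of_tendsto (hcp.mono h2) ?_
      filter_upwards [self_mem_nhdsWithin] with t ht
      exact ht.2
  have hfs : S.force₁ ε (z s) = 0 := by
    refine le_antisymm ?_ ?_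
    · have h1 := (hasDerivWithinAt_iff_tendsto_slope' (s := Ioi s) (by simp)).1
        ((hz.deriv_right_p₁ ⟨hs0.le, hsT⟩).mono Ioi_subset_Ici_self)
      refine le_of_tendsto h1 ?_
      filter_upwards [Ioo_mem_nhdsGT hsT] with t ht
      rw [slope_def_field, hps, sub_zero]
      exact div_nonpos_of_nonpos_of_nonneg (hafter t ht).le (by linarith [ht.1])
    · by_contra h
      obtain ⟨hb1, hb2⟩ := hz.mem_box hε h0 hsI
      exact hns s ⟨hs0, hsT.le⟩ ⟨hsw.le, hb1, hb2, hps, not_le.1 h,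
        (hz.ham_eq hsI).trans h0.2.2.2.2.2⟩
  -- the descent from `s` to the wall contradicts the smallness of the energy at `s`
  obtain ⟨hfl, hq, -⟩ := hz.eq_flow hε h0 hs0.le hsT le_rfl hsfree
  have hdom := hz.mem_dom hε h0 hsI
  obtain ⟨hb1, hb2⟩ := hz.mem_box hε h0 hsI
  have hd := energy_drift S.isWell_V₁ (sub_nonneg.2 hsT.le) (ν := ε * F.M)
    (fun u _ => F.deriv_q₁ ε hε.le _ hdom u) (fun u _ => F.deriv_p₁ ε hε.le _ hdom u)
    (fun u _ => by
      obtain ⟨h1, h2, -⟩ := F.mem ε hε.le _ hdom u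
      rw [force₁_eq, show ∀ x y : ℝ, -x - y + x = -y from fun x y => by ring, abs_neg, abs_mul,
        abs_of_nonneg hε.nonneg]
      exact mul_le_mul_of_nonneg_left (F.d₁Vc_le _ _ h1.le h2.le) hε.nonneg)
    (fun u hu => by
      have := hafter (s + u) ⟨by linarith [hu.1], by linarith [hu.2]⟩
      rw [hfl (s + u) ⟨by linarith [hu.1], by linarith [hu.2]⟩, add_sub_cancel_left] at this
      exact this.le)
  rw [F.zero, hps, ← hq, hw] at hd
  have h1 := hε.slow _ _ hb1.le hb2.le (by rw [force₁_eq] at hfs; linarith)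
  have h2 := (abs_le.1 hd).2
  have hwR : |S.w| < R := by
    have := (hz.mem_box hε h0 hTT).1
    rwa [hw] at this
  have h3 : ε * F.M * ((z s).q₁ - S.w) ≤ ε * F.M * (2 * R) := by
    refine mul_le_mul_of_nonneg_left ?_ (mul_nonneg hε.nonneg F.M_pos.le)
    linarith [(abs_lt.1 hb1).2, (abs_lt.1 hwR).1]
  nlinarith [sq_nonneg (F.φ (T - s) ε (z s)).p₁]

end IsWallArc

end WallSystem

/-! ### Contacts with the wall and return paths -/

section Piecewise

variable {f g : ℝ → ℝ} {a d t : ℝ}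

lemma hasDerivAt_ite_of_lt (ht : t < a) (hf : HasDerivAt f d t) :
    HasDerivAt (fun s => if s < a then f s else g s) d t :=
  hf.congr_of_eventuallyEq (by
    filter_upwards [gt_mem_nhds ht] with s hs
    exact if_pos hs)

lemma hasDerivAt_ite_of_gt (ht : a < t) (hg : HasDerivAt g d t) :
    HasDerivAt (fun s => if s < a then f s else g s) d t :=
  hg.congr_of_eventuallyEq (by
    filter_upwards [lt_mem_nhds ht] with s hs
    exact if_neg hs.not_gt)

lemma hasDerivWithinAt_ite_right (hg : HasDerivAt g d a) :
    HasDerivWithinAt (fun s => if s < a then f s else g s) d (Ici a) a :=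
  hg.hasDerivWithinAt.congr (fun _ hs => if_neg (not_lt.2 hs)) (if_neg (lt_irrefl a))

lemma hasDerivAt_ite_of_eq (hf : HasDerivAt f d a) (hg : HasDerivAt g d a) (hfg : f a = g a) :
    HasDerivAt (fun s => if s < a then f s else g s) d a := by
  have h1 : HasDerivWithinAt (fun s => if s < a then f s else g s) d (Iio a) a :=
    hf.hasDerivWithinAt.congr (fun s hs => if_pos hs) (by rw [if_neg (lt_irrefl a), hfg])
  have h2 := h1.union (hasDerivWithinAt_ite_right (f := f) hg)
  rwa [Iio_union_Ici, hasDerivWithinAt_univ] at h2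

end Piecewise

/-- The elastic reflection `p₁ ↦ -p₁`. -/
def PhasePt.flip (z : PhasePt) : PhasePt := ⟨z.q₁, -z.p₁, z.q₂, z.p₂⟩

@[simp] lemma PhasePt.flip_q₁ (z : PhasePt) : z.flip.q₁ = z.q₁ := rfl
@[simp] lemma PhasePt.flip_p₁ (z : PhasePt) : z.flip.p₁ = -z.p₁ := rfl
@[simp] lemma PhasePt.flip_q₂ (z : PhasePt) : z.flip.q₂ = z.q₂ := rfl
@[simp] lemma PhasePt.flip_p₂ (z : PhasePt) : z.flip.p₂ = z.p₂ := rfl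

namespace WallSystem

variable {r : ℕ} {S : WallSystem r} {E R ε : ℝ}

lemma force₁_flip (z : PhasePt) : S.force₁ ε z.flip = S.force₁ ε z := rfl

lemma ham_flip (z : PhasePt) : S.ham ε z.flip = S.ham ε z := by simp [ham]

lemma flip_mem_dom {B : ℝ} {z : PhasePt} (hz : z ∈ S.dom E B ε) : z.flip ∈ S.dom E B ε :=
  ⟨hz.1, hz.2.1, (ham_flip z).trans_le hz.2.2⟩

namespace FreeFlow

variable {F : S.FreeFlow E R}

lemma IsSmall.lt_q₁_of_sect (hε : F.IsSmall ε) {z : PhasePt} (hz : z ∈ S.sect ε E R) :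
    S.w < z.q₁ := by
  refine lt_of_le_of_ne hz.1 fun h => ?_
  have h1 := hz.2.2.2.2.1
  have h2 := hε.wall z.q₂ hz.2.2.1.le
  rw [force₁_eq, ← h] at h1
  linarith

lemma sect_subset_dom (F : S.FreeFlow E R) {z : PhasePt} (hz : z ∈ S.sect ε E R) :
    z ∈ S.dom E F.B ε :=
  ⟨hz.2.1.trans_le F.R_le, hz.2.2.1.trans_le F.R_le, by rw [hz.2.2.2.2.2]; linarith⟩

lemma abs_force₁_add_le (F : S.FreeFlow E R) (hε : |ε| ≤ F.ε₀) {z : PhasePt}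
    (hz : z ∈ S.dom E F.B ε) (t : ℝ) :
    |S.force₁ ε (F.φ t ε z) + deriv S.V₁ (F.φ t ε z).q₁| ≤ |ε| * F.M := by
  obtain ⟨h1, h2, -⟩ := F.mem ε hε _ hz t
  rw [force₁_eq, show ∀ x y : ℝ, -x - y + x = -y from fun x y => by ring, abs_neg, abs_mul]
  exact mul_le_mul_of_nonneg_left (F.d₁Vc_le _ _ h1.le h2.le) (abs_nonneg ε)

/-- The trajectory which follows the wall-free flow up to the time `a`, is reflected, and follows
the wall-free flow again. -/
def bounce (F : S.FreeFlow E R) (ε a : ℝ) (z : PhasePt) (t : ℝ) : PhasePt :=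
  if t < a then F.φ t ε z else F.φ (t - a) ε (F.φ a ε z).flip

lemma bounce_of_lt {a t : ℝ} {z : PhasePt} (h : t < a) : F.bounce ε a z t = F.φ t ε z := if_pos h

lemma bounce_of_le {a t : ℝ} {z : PhasePt} (h : a ≤ t) :
    F.bounce ε a z t = F.φ (t - a) ε (F.φ a ε z).flip := if_neg h.not_gt

/-- The reflected trajectory is one of the wall system if `a` is its only contact with the wall; at
a turning point with `p₁ = 0` the reflection is void. -/
lemma isWallArc_bounce (hε : F.IsSmall ε) {z : PhasePt} (hz : z ∈ S.sect ε E R) {a b : ℝ}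
    (ha : 0 < a) (h1 : ∀ t ∈ Ioo 0 a, S.w < (F.φ t ε z).q₁)
    (h2 : (F.φ a ε z).q₁ = S.w ∨ S.w < (F.φ a ε z).q₁ ∧ (F.φ a ε z).p₁ = 0)
    (h3 : ∀ s ∈ Ioc 0 b, S.w < (F.φ s ε (F.φ a ε z).flip).q₁) :
    S.IsWallArc ε (a + b) (F.bounce ε a z) := by
  have hdom := F.sect_subset_dom hz
  have hdom' := flip_mem_dom (F.mem ε hε.le _ hdom a)
  set m := (F.φ a ε z).flip with hm
  have hma : F.bounce ε a z a = m := by rw [bounce_of_le le_rfl, sub_self, F.zero]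
  have f1 := F.deriv_q₁ ε hε.le _ hdom
  have f2 := F.deriv_p₁ ε hε.le _ hdom
  have f3 := F.deriv_q₂ ε hε.le _ hdom
  have f4 := F.deriv_p₂ ε hε.le _ hdom
  have g1 := fun t => (F.deriv_q₁ ε hε.le _ hdom' (t - a)).comp_sub_const t a
  have g2 := fun t => (F.deriv_p₁ ε hε.le _ hdom' (t - a)).comp_sub_const t a
  have g3 := fun t => (F.deriv_q₂ ε hε.le _ hdom' (t - a)).comp_sub_const t a
  have g4 := fun t => (F.deriv_p₂ ε hε.le _ hdom' (t - a)).comp_sub_const t a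
  have e1 : (fun t => (F.bounce ε a z t).q₁) =
      fun t => if t < a then (F.φ t ε z).q₁ else (F.φ (t - a) ε m).q₁ :=
    funext fun t => apply_ite PhasePt.q₁ _ _ _
  have e2 : (fun t => (F.bounce ε a z t).p₁) =
      fun t => if t < a then (F.φ t ε z).p₁ else (F.φ (t - a) ε m).p₁ :=
    funext fun t => apply_ite PhasePt.p₁ _ _ _
  have e3 : (fun t => (F.bounce ε a z t).q₂) =
      fun t => if t < a then (F.φ t ε z).q₂ else (F.φ (t - a) ε m).q₂ :=
    funext fun t => apply_ite PhasePt.q₂ _ _ _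
  have e4 : (fun t => (F.bounce ε a z t).p₂) =
      fun t => if t < a then (F.φ t ε z).p₂ else (F.φ (t - a) ε m).p₂ :=
    funext fun t => apply_ite PhasePt.p₂ _ _ _
  have hfree : ∀ t ∈ Icc 0 (a + b), t ≠ a → S.w < (F.bounce ε a z t).q₁ := by
    intro t ht hta
    rcases hta.lt_or_gt with h | h
    · rw [bounce_of_lt h]
      rcases ht.1.eq_or_lt with rfl | h0
      · rw [F.zero]; exact hε.lt_q₁_of_sect hz
      · exact h1 t ⟨h0, h⟩
    · rw [bounce_of_le h.le]
      exact h3 (t - a) ⟨by linarith, by linarith [ht.2]⟩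
  have hcontact : ∀ t ∈ Icc 0 (a + b), (F.bounce ε a z t).q₁ = S.w → t = a := fun t ht hw => by
    by_contra h
    exact (hfree t ht h).ne' hw
  have hsm : ∀ t ∈ Icc 0 (a + b), S.w < (F.bounce ε a z t).q₁ →
      HasDerivAt (fun s => (F.bounce ε a z s).q₁) (F.bounce ε a z t).p₁ t ∧
      HasDerivAt (fun s => (F.bounce ε a z s).p₁) (S.force₁ ε (F.bounce ε a z t)) t := by
    intro t ht hw
    rw [e1, e2]
    rcases lt_trichotomy t a with h | rfl | h
    · rw [bounce_of_lt h]
      exact ⟨hasDerivAt_ite_of_lt h (f1 t), hasDerivAt_ite_of_lt h (f2 t)⟩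
    · rw [hma] at hw ⊢
      have hp : (F.φ t ε z).p₁ = 0 := (h2.resolve_left fun h => hw.ne' h).2
      refine ⟨hasDerivAt_ite_of_eq ((f1 t).congr_deriv (by simp [hm, hp])) ?_ ?_,
        hasDerivAt_ite_of_eq (f2 t) ?_ ?_⟩
      · simpa [F.zero] using g1 t
      · simp [F.zero, hm]
      · simpa [F.zero] using g2 t
      · simp [F.zero, hm, hp]
    · rw [bounce_of_le h.le]
      exact ⟨hasDerivAt_ite_of_gt h (g1 t), hasDerivAt_ite_of_gt h (g2 t)⟩
  have hsm' : ∀ t, HasDerivAt (fun s => (F.bounce ε a z s).q₂) (F.bounce ε a z t).p₂ t ∧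
      HasDerivAt (fun s => (F.bounce ε a z s).p₂) (S.force₂ ε (F.bounce ε a z t)) t := by
    intro t
    rw [e3, e4]
    rcases lt_trichotomy t a with h | rfl | h
    · rw [bounce_of_lt h]
      exact ⟨hasDerivAt_ite_of_lt h (f3 t), hasDerivAt_ite_of_lt h (f4 t)⟩
    · rw [hma]
      refine ⟨hasDerivAt_ite_of_eq (f3 t) ?_ ?_, hasDerivAt_ite_of_eq (f4 t) ?_ ?_⟩
      · simpa [F.zero] using g3 t
      · simp [F.zero, hm]
      · simpa [F.zero] using g4 t
      · simp [F.zero, hm]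
    · rw [bounce_of_le h.le]
      exact ⟨hasDerivAt_ite_of_gt h (g3 t), hasDerivAt_ite_of_gt h (g4 t)⟩
  have hca : Continuous fun t => (F.bounce ε a z t).q₁ := by
    rw [e1]
    refine continuous_iff_continuousAt.2 fun t => ?_
    have hF : Continuous fun t => (F.φ t ε z).q₁ :=
      continuous_iff_continuousAt.2 fun t => (f1 t).continuousAt
    have hG : Continuous fun t => (F.φ (t - a) ε m).q₁ :=
      continuous_iff_continuousAt.2 fun t => (g1 t).continuousAt
    refine (Continuous.if (fun t ht => ?_) hF hG).continuousAt
    have : t ∈ frontier (Iio a) := ht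
    rw [frontier_Iio] at this
    rw [mem_singleton_iff.1 this]
    simp [F.zero, hm]
  refine ⟨fun t ht => ?_, hca.continuousOn, fun t _ => (hsm' t).1.hasDerivWithinAt,
    fun t _ => (hsm' t).2.hasDerivWithinAt, fun t ht hw => (hsm t ht hw).1.hasDerivWithinAt,
    fun t ht hw => (hsm t ht hw).2.hasDerivWithinAt, fun t ht hw => ?_, fun t ht hw => ?_,
    fun t ht hw => ?_⟩
  · by_cases h : t = a
    · rw [h, hma]
      exact h2.elim (fun h => h.ge) fun h => h.1.le
    · exact (hfree t ht h).le
  · obtain rfl := hcontact t ht hw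
    rw [hma, e1]
    exact (hasDerivWithinAt_ite_right (by simpa [F.zero] using g1 t)).mono Icc_subset_Ici_self
  · obtain rfl := hcontact t ht hw
    rw [hma, e2]
    exact (hasDerivWithinAt_ite_right (by simpa [F.zero] using g2 t)).mono Icc_subset_Ici_self
  · obtain rfl := hcontact t ht hw
    rw [hma, hm, PhasePt.flip_p₁, neg_neg]
    refine ((f2 t).continuousAt.tendsto.mono_left nhdsWithin_le_nhds).congr' ?_
    filter_upwards [self_mem_nhdsWithin] with s hs
    rw [bounce_of_lt hs.2]

lemma strictAntiOn_q₁ (hε : |ε| ≤ F.ε₀) {z : PhasePt} (hz : z ∈ S.dom E F.B ε) {a : ℝ}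
    (h : ∀ t ∈ Ioo 0 a, (F.φ t ε z).p₁ < 0) :
    StrictAntiOn (fun t => (F.φ t ε z).q₁) (Icc 0 a) :=
  strictAntiOn_of_deriv_neg (convex_Icc 0 a)
    (fun t _ => (F.deriv_q₁ ε hε _ hz t).continuousAt.continuousWithinAt) fun t ht => by
      rw [interior_Icc] at ht
      rw [(F.deriv_q₁ ε hε _ hz t).deriv]
      exact h t ht

lemma strictMonoOn_q₁ (hε : |ε| ≤ F.ε₀) {z : PhasePt} (hz : z ∈ S.dom E F.B ε) {a : ℝ}
    (h : ∀ t ∈ Ioo 0 a, 0 < (F.φ t ε z).p₁) :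
    StrictMonoOn (fun t => (F.φ t ε z).q₁) (Icc 0 a) :=
  strictMonoOn_of_deriv_pos (convex_Icc 0 a)
    (fun t _ => (F.deriv_q₁ ε hε _ hz t).continuousAt.continuousWithinAt) fun t ht => by
      rw [interior_Icc] at ht
      rw [(F.deriv_q₁ ε hε _ hz t).deriv]
      exact h t ht

/-- The wall is met, before the first return, exactly at the end of a descent of the wall-free
flow. -/
lemma meetsWall_iff (hε : F.IsSmall ε) {z : PhasePt} (hz : z ∈ S.sect ε E R) (v : ℝ) :
    S.MeetsWall ε E R z v ↔ ∃ T > 0, (∀ t ∈ Ioo 0 T, (F.φ t ε z).p₁ < 0) ∧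
      (F.φ T ε z).q₁ = S.w ∧ (F.φ T ε z).p₁ = -v := by
  constructor
  · rintro ⟨T, hT, x, hx, rfl, hns, hw, hv⟩
    have hneg := hx.p₁_neg_of_contact hε hz hT hns hw
    have hfree : ∀ t ∈ Ioo 0 T, S.w < (x t).q₁ := fun t ht => by
      refine lt_of_le_of_ne (hx.right_of_wall t ⟨ht.1.le, ht.2.le⟩) fun heq => ?_
      exact (hneg t ht).not_ge (hx.p₁_nonneg_of_contact ⟨ht.1.le, ht.2⟩ heq.symm)
    obtain ⟨h1, h2, -, -, -, h3⟩ := hx.eq_flow hε hz le_rfl hT le_rfl hfree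
    rw [sub_zero] at h2 h3
    refine ⟨T, hT, fun t ht => ?_, h2 ▸ hw, ?_⟩
    · have := h1 t ⟨ht.1.le, ht.2⟩
      rw [sub_zero] at this
      rw [← this]
      exact hneg t ht
    · have := h3 hw
      linarith
  · rintro ⟨T, hT, hneg, hw, hv⟩
    have hanti := strictAntiOn_q₁ hε.le (F.sect_subset_dom hz) hneg
    have harc : S.IsWallArc ε T (F.bounce ε T z) := by
      have := F.isWallArc_bounce hε hz (b := 0) hT (fun t ht => by
        rw [← hw]
        exact hanti ⟨ht.1.le, ht.2.le⟩ ⟨hT.le, le_rfl⟩ ht.2) (Or.inl hw)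
        (fun s hs => absurd hs.1 hs.2.not_gt)
      rwa [add_zero] at this
    have h0 : F.bounce ε T z 0 = z := by rw [bounce_of_lt hT, F.zero]
    have hTT : F.bounce ε T z T = (F.φ T ε z).flip := by rw [bounce_of_le le_rfl, sub_self, F.zero]
    refine ⟨T, hT, _, harc, h0, fun t ht hs => ?_, by rw [hTT]; exact hw, by
      rw [hTT, PhasePt.flip_p₁, hv, neg_neg]⟩
    rcases ht.2.eq_or_lt with rfl | h
    · have := hε.lt_q₁_of_sect hs
      rw [hTT, PhasePt.flip_q₁, hw] at this
      exact this.false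
    · have h1 := hs.2.2.2.1
      rw [bounce_of_lt h] at h1
      exact (hneg t ⟨ht.1, h⟩).ne h1

/-- The trajectory of `z` descends during the time `a`, turns around in front of the wall or is
reflected, and ascends to the section during the time `b`. -/
structure IsReturnPath (F : S.FreeFlow E R) (ε : ℝ) (z : PhasePt) (a b : ℝ) : Prop where
  a_pos : 0 < a
  b_pos : 0 < b
  descent : ∀ t ∈ Ioo 0 a, (F.φ t ε z).p₁ < 0
  turn : (F.φ a ε z).q₁ = S.w ∨ S.w < (F.φ a ε z).q₁ ∧ (F.φ a ε z).p₁ = 0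
  force : 0 < S.force₁ ε (F.φ a ε z)
  ascent : ∀ s ∈ Ioo 0 b, 0 < (F.φ s ε (F.φ a ε z).flip).p₁
  end_p₁ : (F.φ b ε (F.φ a ε z).flip).p₁ = 0
  end_force : S.force₁ ε (F.φ b ε (F.φ a ε z).flip) < 0

namespace IsReturnPath

variable {z : PhasePt} {a b : ℝ}

lemma w_le (P : F.IsReturnPath ε z a b) : S.w ≤ (F.φ a ε z).q₁ :=
  P.turn.elim (fun h => h.ge) fun h => h.1.le

lemma lt_q₁_descent (P : F.IsReturnPath ε z a b) (hε : F.IsSmall ε) (hz : z ∈ S.sect ε E R) :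
    ∀ t ∈ Ioo 0 a, S.w < (F.φ t ε z).q₁ := fun _ ht =>
  P.w_le.trans_lt (strictAntiOn_q₁ hε.le (F.sect_subset_dom hz) P.descent ⟨ht.1.le, ht.2.le⟩
    ⟨P.a_pos.le, le_rfl⟩ ht.2)

lemma lt_q₁_ascent (P : F.IsReturnPath ε z a b) (hε : F.IsSmall ε) (hz : z ∈ S.sect ε E R) :
    ∀ s ∈ Ioc 0 b, S.w < (F.φ s ε (F.φ a ε z).flip).q₁ := fun s hs => by
  have := strictMonoOn_q₁ hε.le (flip_mem_dom (F.mem ε hε.le _ (F.sect_subset_dom hz) a)) P.ascent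
    ⟨le_rfl, P.b_pos.le⟩ ⟨hs.1.le, hs.2⟩ hs.1
  simp only [F.zero, PhasePt.flip_q₁] at this
  exact P.w_le.trans_lt this

lemma isWallArc (P : F.IsReturnPath ε z a b) (hε : F.IsSmall ε) (hz : z ∈ S.sect ε E R) :
    S.IsWallArc ε (a + b) (F.bounce ε a z) :=
  F.isWallArc_bounce hε hz P.a_pos (P.lt_q₁_descent hε hz) P.turn (P.lt_q₁_ascent hε hz)

lemma bounce_end (P : F.IsReturnPath ε z a b) :
    F.bounce ε a z (a + b) = F.φ b ε (F.φ a ε z).flip := by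
  rw [bounce_of_le (by linarith [P.b_pos]), add_sub_cancel_left]

lemma end_mem (P : F.IsReturnPath ε z a b) (hε : F.IsSmall ε) (hz : z ∈ S.sect ε E R) :
    F.φ b ε (F.φ a ε z).flip ∈ S.sect ε E R := by
  have harc := P.isWallArc hε hz
  have h0 : F.bounce ε a z 0 = z := by rw [bounce_of_lt P.a_pos, F.zero]
  have hab : a + b ∈ Icc 0 (a + b) := ⟨by linarith [P.a_pos, P.b_pos], le_rfl⟩
  obtain ⟨h1, h2⟩ := harc.mem_box hε (h0.symm ▸ hz) hab
  have h3 := harc.ham_eq hab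
  rw [P.bounce_end] at h1 h2 h3
  rw [h0, hz.2.2.2.2.2] at h3
  exact ⟨(P.lt_q₁_ascent hε hz b ⟨P.b_pos, le_rfl⟩).le, h1, h2, P.end_p₁, P.end_force, h3⟩

lemma isFirstReturn (P : F.IsReturnPath ε z a b) (hε : F.IsSmall ε) (hz : z ∈ S.sect ε E R) :
    S.IsFirstReturn ε E R z (F.φ b ε (F.φ a ε z).flip) := by
  refine ⟨a + b, by linarith [P.a_pos, P.b_pos], _, P.isWallArc hε hz,
    by rw [bounce_of_lt P.a_pos, F.zero], P.bounce_end, P.end_mem hε hz, fun t ht hs => ?_⟩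
  have h1 := hs.2.2.2.1
  rcases lt_trichotomy t a with h | rfl | h
  · rw [bounce_of_lt h] at h1
    exact (P.descent t ⟨ht.1, h⟩).ne h1
  · have h2 := hs.2.2.2.2.1
    rw [bounce_of_le le_rfl, sub_self, F.zero, force₁_flip] at h2
    exact h2.not_gt P.force
  · rw [bounce_of_le h.le] at h1
    exact (P.ascent (t - a) ⟨by linarith, by linarith [ht.2]⟩).ne' h1

/-- The return point is unique, since the trajectories of the wall system are. -/
lemma eq_of_isFirstReturn (P : F.IsReturnPath ε z a b) (hε : F.IsSmall ε)
    (hz : z ∈ S.sect ε E R) {z' : PhasePt} (h : S.IsFirstReturn ε E R z z') :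
    z' = F.φ b ε (F.φ a ε z).flip := by
  obtain ⟨T, hT, x, hx, rfl, rfl, hmem, hns⟩ := h
  have hTT : T ∈ Icc 0 T := ⟨hT.le, le_rfl⟩
  have hopen : ∀ t ∈ Ico 0 T, S.w < (x t).q₁ →
      ∃ b₀, t < b₀ ∧ ∀ s ∈ Ioo t b₀, s ≤ T → S.w < (x s).q₁ := by
    intro t ht hw
    have h1 : ∀ᶠ s in 𝓝[>] t, S.w < (x s).q₁ :=
      (((hx.deriv_right_q₁ ht).mono Ioi_subset_Ici_self).continuousWithinAt).eventually
        (lt_mem_nhds hw)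
    obtain ⟨b₀, hb₀, hb₀'⟩ := mem_nhdsGT_iff_exists_Ioo_subset.1 h1
    exact ⟨b₀, hb₀, fun s hs _ => hb₀' hs⟩
  obtain ⟨b₀, hb₀, hb₀'⟩ := hopen 0 ⟨le_rfl, hT⟩ (hε.lt_q₁_of_sect hz)
  have hfree : ∀ t, 0 < t → t ≤ T → t < a → S.w < (x t).q₁ := fun t h1 h2 h3 =>
    hx.free_of_flow hε hz le_rfl hb₀ hb₀' (P.lt_q₁_descent hε hz) h1 h2 (by simpa using h3)
  have haT : a < T := by
    by_contra hcon
    rcases (not_lt.1 hcon).eq_or_lt with h | h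
    · subst h
      obtain ⟨-, h2, h3, -⟩ := hx.eq_flow hε hz le_rfl hT le_rfl
        fun t ht => hfree t ht.1 ht.2.le ht.2
      have h4 := hmem.2.2.2.2.1
      rw [sub_zero] at h2 h3
      rw [force₁_eq, h2, h3] at h4
      exact h4.not_gt P.force
    · obtain ⟨-, -, -, -, h2, -⟩ := hx.eq_flow hε hz le_rfl hT le_rfl
        fun t ht => hfree t ht.1 ht.2.le (ht.2.trans h)
      have h3 := h2 (hfree T hT le_rfl h)
      rw [hmem.2.2.2.1, sub_zero] at h3
      exact (P.descent T ⟨hT, h⟩).ne h3.symm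
  have hxa : x a = (F.φ a ε (x 0)).flip := by
    obtain ⟨-, h1, h2, h3, h4, h5⟩ := hx.eq_flow hε hz le_rfl P.a_pos haT.le
      fun t ht => hfree t ht.1 (ht.2.le.trans haT.le) ht.2
    rw [sub_zero] at h1 h2 h3 h4 h5
    refine PhasePt.ext h1 ?_ h2 h3
    rcases P.turn with h | ⟨h, hp⟩
    · exact h5 (h1.trans h)
    · rw [h4 (h1 ▸ h), PhasePt.flip_p₁, hp, neg_zero]
  have haI : a ∈ Ico 0 T := ⟨P.a_pos.le, haT⟩
  obtain ⟨b₁, hb₁, hb₁'⟩ : ∃ b₁, a < b₁ ∧ ∀ s ∈ Ioo a b₁, s ≤ T → S.w < (x s).q₁ := by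
    rcases (hx.right_of_wall a ⟨haI.1, haI.2.le⟩).eq_or_lt with h | h
    · obtain ⟨b₁, h1, -, h2⟩ := hx.exists_after_contact hε hz haI h.symm
      exact ⟨b₁, h1, fun s hs _ => (h2 s hs).1⟩
    · exact hopen a haI h
  have hfree' : ∀ t, a < t → t ≤ T → t < a + b → S.w < (x t).q₁ := fun t h1 h2 h3 =>
    hx.free_of_flow hε hz P.a_pos.le hb₁ hb₁' (fun s hs => by
      rw [hxa]
      exact P.lt_q₁_ascent hε hz s ⟨hs.1, hs.2.le⟩) h1 h2 h3
  have hbT : a + b ≤ T := by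
    by_contra hcon
    have hlt := not_le.1 hcon
    obtain ⟨-, -, -, -, h2, -⟩ := hx.eq_flow hε hz P.a_pos.le haT le_rfl
      fun t ht => hfree' t ht.1 ht.2.le (ht.2.trans hlt)
    have h3 := h2 (hfree' T haT le_rfl hlt)
    rw [hmem.2.2.2.1, hxa] at h3
    exact (P.ascent (T - a) ⟨by linarith, by linarith⟩).ne h3
  obtain ⟨-, h1, h2, h3, h4, -⟩ := hx.eq_flow hε hz P.a_pos.le (b := a + b)
    (by linarith [P.b_pos]) hbT fun t ht => hfree' t ht.1 (ht.2.le.trans hbT) ht.2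
  rw [add_sub_cancel_left, hxa] at h1 h2 h3 h4
  have hend : x (a + b) = F.φ b ε (F.φ a ε (x 0)).flip :=
    PhasePt.ext h1 (h4 (h1 ▸ P.lt_q₁_ascent hε hz b ⟨P.b_pos, le_rfl⟩)) h2 h3
  rcases hbT.eq_or_lt with h | h
  · rw [← h, hend]
  · refine absurd ?_ (hns (a + b) ⟨by linarith [P.a_pos, P.b_pos], h⟩)
    rw [hend]
    exact P.end_mem hε hz

lemma existsUnique_isFirstReturn (P : F.IsReturnPath ε z a b) (hε : F.IsSmall ε)
    (hz : z ∈ S.sect ε E R) : ∃! z', S.IsFirstReturn ε E R z z' :=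
  ⟨_, P.isFirstReturn hε hz, fun _ h => P.eq_of_isFirstReturn hε hz h⟩

end IsReturnPath

/-- For small `ε`, every point of the section with `q₁ ≥ η` descends to a turning point of the
wall-free flow, where the force points to the right. -/
lemma exists_descent (F : S.FreeFlow E R) {η : ℝ} (hη : 0 < η) :
    ∃ c > 0, c ≤ -S.w ∧ ∃ ε₁ > 0, ∀ ε, |ε| ≤ ε₁ → |ε| ≤ F.ε₀ ∧
      (∀ z ∈ S.dom E F.B ε, z.q₁ ≤ -c → 0 < S.force₁ ε z) ∧
      ∀ z ∈ S.dom E F.B ε, z.p₁ = 0 → S.force₁ ε z < 0 → η ≤ z.q₁ →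
        ∃ τ > 0, (F.φ τ ε z).p₁ = 0 ∧ (∀ t ∈ Ioo 0 τ, (F.φ t ε z).p₁ < 0) ∧
          (F.φ τ ε z).q₁ ≤ -c ∧ 0 < S.force₁ ε (F.φ τ ε z) := by
  obtain ⟨c, hc, hcw, ν, hν, hder, H⟩ :=
    exists_turning S.isWell_V₁ hη (neg_pos.2 S.w_neg) F.B
  refine ⟨c, hc, hcw, min F.ε₀ (ν / F.M), lt_min F.ε₀_pos (div_pos hν F.M_pos), fun ε hε => ?_⟩
  have hε₀ : |ε| ≤ F.ε₀ := hε.trans (min_le_left _ _)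
  have hεν : |ε| * F.M ≤ ν := (le_div_iff₀ F.M_pos).1 (hε.trans (min_le_right _ _))
  refine ⟨hε₀, fun z hz hq => ?_, fun z hz hp hf hq => ?_⟩
  · have h1 := F.abs_force₁_add_le hε₀ hz 0
    rw [F.zero] at h1
    linarith [(abs_le.1 (h1.trans hεν)).1, (hder z.q₁ hz.1.le).2 hq]
  · exact H (fun t => (F.φ t ε z).q₁) (fun t => (F.φ t ε z).p₁)
      (fun t => S.force₁ ε (F.φ t ε z)) (F.deriv_q₁ ε hε₀ z hz) (F.deriv_p₁ ε hε₀ z hz)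
      (fun t => (F.abs_force₁_add_le hε₀ hz t).trans hεν)
      (fun t => (F.mem ε hε₀ z hz t).1.le) (by simpa [F.zero] using hq)
      (exists_forall_Ioo_neg (F.deriv_p₁ ε hε₀ z hz 0) (by simpa [F.zero] using hf)
        (by simpa [F.zero] using hp))

/-- For small `ε`, a trajectory which starts to the right from `q₁ ≤ -η` turns around where the
force points to the left. This is the mirror image of a descent. -/
lemma exists_ascent (F : S.FreeFlow E R) {η : ℝ} (hη : 0 < η) :
    ∃ ε₁ > 0, ∀ ε, |ε| ≤ ε₁ → |ε| ≤ F.ε₀ ∧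
      ∀ z ∈ S.dom E F.B ε, 0 ≤ z.p₁ → 0 < S.force₁ ε z → z.q₁ ≤ -η →
        ∃ τ > 0, (F.φ τ ε z).p₁ = 0 ∧ (∀ t ∈ Ioo 0 τ, 0 < (F.φ t ε z).p₁) ∧
          S.force₁ ε (F.φ τ ε z) < 0 := by
  obtain ⟨c, hc, -, ν, hν, -, H⟩ := exists_turning S.isWell_V₁.neg hη one_pos F.B
  refine ⟨min F.ε₀ (ν / F.M), lt_min F.ε₀_pos (div_pos hν F.M_pos), fun ε hε => ?_⟩
  have hε₀ : |ε| ≤ F.ε₀ := hε.trans (min_le_left _ _)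
  have hεν : |ε| * F.M ≤ ν := (le_div_iff₀ F.M_pos).1 (hε.trans (min_le_right _ _))
  refine ⟨hε₀, fun z hz hp hf hq => ?_⟩
  have hd := (F.deriv_p₁ ε hε₀ z hz)
  obtain ⟨τ, h1, h2, h3, -, h5⟩ := H (fun t => -(F.φ t ε z).q₁) (fun t => -(F.φ t ε z).p₁)
    (fun t => -S.force₁ ε (F.φ t ε z)) (fun t => (F.deriv_q₁ ε hε₀ z hz t).fun_neg)
    (fun t => (hd t).fun_neg)
    (fun t => by
      rw [deriv_comp_neg, neg_neg, ← neg_add, abs_neg]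
      exact (F.abs_force₁_add_le hε₀ hz t).trans hεν)
    (fun t => by simpa using (F.mem ε hε₀ z hz t).1.le) (by simpa [F.zero] using le_neg.1 hq) (by
      rcases hp.eq_or_lt with h | h
      · exact exists_forall_Ioo_neg (hd 0).fun_neg (by simpa [F.zero] using hf)
          (by simpa [F.zero] using h.symm)
      · have h0 : 0 < (F.φ 0 ε z).p₁ := by rwa [F.zero]
        obtain ⟨δ, hδ, h'⟩ :=
          Metric.eventually_nhds_iff.1 ((hd 0).continuousAt.eventually (lt_mem_nhds h0))
        refine ⟨δ, hδ, fun t ht => neg_neg_of_pos (h' ?_)⟩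
        rw [Real.dist_eq, sub_zero, abs_of_pos ht.1]
        exact ht.2)
  exact ⟨τ, h1, neg_eq_zero.1 h2, fun t ht => neg_neg_iff_pos.1 (h3 t ht), neg_pos.1 h5⟩

/-- For small `ε`, every point of the section with `q₁ ≥ η` returns. -/
lemma exists_isReturnPath (F : S.FreeFlow E R) {η : ℝ} (hη : 0 < η) :
    ∃ ε₁ > 0, ∀ ε, |ε| ≤ ε₁ → F.IsSmall ε → ∀ z ∈ S.sect ε E R, η ≤ z.q₁ →
      ∃ a b, F.IsReturnPath ε z a b := by
  obtain ⟨c, hc, hcw, ε₁, hε₁, H₁⟩ := F.exists_descent hη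
  obtain ⟨ε₂, hε₂, H₂⟩ := F.exists_ascent hc
  refine ⟨min ε₁ ε₂, lt_min hε₁ hε₂, fun ε hε hs z hz hq => ?_⟩
  obtain ⟨hε₀, hforce, H₁⟩ := H₁ ε (hε.trans (min_le_left _ _))
  obtain ⟨-, H₂⟩ := H₂ ε (hε.trans (min_le_right _ _))
  have hdom := F.sect_subset_dom hz
  obtain ⟨τ, hτ, hτp, hτneg, hτq, -⟩ := H₁ z hdom hz.2.2.2.1 hz.2.2.2.2.1 hq
  obtain ⟨a, ha, haτ, hturn, haq⟩ : ∃ a, 0 < a ∧ a ≤ τ ∧ ((F.φ a ε z).q₁ = S.w ∨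
      S.w < (F.φ a ε z).q₁ ∧ (F.φ a ε z).p₁ = 0) ∧ (F.φ a ε z).q₁ ≤ -c := by
    rcases lt_or_ge S.w (F.φ τ ε z).q₁ with h | h
    · exact ⟨τ, hτ, le_rfl, Or.inr ⟨h, hτp⟩, hτq⟩
    · have hw := hs.lt_q₁_of_sect hz
      obtain ⟨a, ha, haw⟩ := intermediate_value_Icc' hτ.le
        (fun t _ => (F.deriv_q₁ ε hε₀ z hdom t).continuousAt.continuousWithinAt)
        ⟨h, by rw [F.zero]; exact hw.le⟩
      refine ⟨a, lt_of_le_of_ne ha.1 fun h0 => ?_, ha.2, Or.inl haw, ?_⟩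
      · simp only [← h0, F.zero] at haw
        exact hw.ne' haw
      · simp only at haw
        rw [haw]
        linarith
  have hneg : ∀ t ∈ Ioo 0 a, (F.φ t ε z).p₁ < 0 := fun t ht => hτneg t ⟨ht.1, ht.2.trans_le haτ⟩
  have hma := F.mem ε hε₀ z hdom a
  have hfa := hforce _ hma haq
  have hpa : (F.φ a ε z).p₁ ≤ 0 := by
    rcases haτ.eq_or_lt with h | h
    · rw [h]; exact hτp.le
    · exact (hτneg a ⟨ha, h⟩).le
  obtain ⟨b, hb, hbp, hbpos, hbf⟩ := H₂ _ (flip_mem_dom hma) (by simpa using hpa)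
    (by rwa [force₁_flip]) (by simpa using haq)
  exact ⟨a, b, ha, hb, hneg, hturn, hfa, hbpos, hbp, hbf⟩

end FreeFlow

end WallSystem

/-! ### Perturbed roots and closeness to a constant -/

lemma exists_bound_of_periodic {X : Type*} [TopologicalSpace X] {f : ℝ × X → ℝ} {K : Set X}
    {c : ℝ} (hc : 0 < c) (hK : IsCompact K) (hf : ContinuousOn f (univ ×ˢ K))
    (hper : ∀ x ∈ K, Function.Periodic (fun θ => f (θ, x)) c) :
    ∃ C, ∀ θ, ∀ x ∈ K, |f (θ, x)| ≤ C := by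
  obtain ⟨C, hC⟩ := (isCompact_Icc (a := 0) (b := c)).prod hK |>.exists_bound_of_continuousOn
    (hf.mono (prod_mono (subset_univ _) le_rfl))
  refine ⟨C, fun θ x hx => ?_⟩
  obtain ⟨θ', hθ', h⟩ := (hper x hx).exists_mem_Ico₀ hc θ
  have := hC (θ', x) ⟨Ico_subset_Icc_self hθ', hx⟩
  rwa [← h, Real.norm_eq_abs] at this

/-- The equation `h = h₀ + ε κ`, with `κ` depending smoothly on the angle, on `ε` and on `h`, has a
unique solution near `h₀` if `ε` is small. -/
lemma exists_perturbed_root {n : ℕ} (hn : n ≠ 0) {κ : (ℝ × ℝ) × ℝ → ℝ} {h₀ δ ε₁ c : ℝ} (hc : 0 < c)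
    (hδ : 0 < δ) (hε₁ : 0 < ε₁)
    (hκ : ContDiffOn ℝ n κ ((univ ×ˢ Ioo (-ε₁) ε₁) ×ˢ Ioo (h₀ - δ) (h₀ + δ)))
    (hper : ∀ ε ∈ Ioo (-ε₁) ε₁, ∀ h ∈ Ioo (h₀ - δ) (h₀ + δ),
      Function.Periodic (fun θ => κ ((θ, ε), h)) c) :
    ∃ ε₂ > 0, ε₂ ≤ ε₁ ∧ ∃ g : ℝ × ℝ → ℝ, ∀ θ, ∀ ε ∈ Ioo (-ε₂) ε₂,
      g (θ, ε) ∈ Ioo (h₀ - δ / 2) (h₀ + δ / 2) ∧ g (θ, ε) = h₀ + ε * κ ((θ, ε), g (θ, ε)) ∧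
      g (θ + c, ε) = g (θ, ε) ∧ ContDiffAt ℝ n g (θ, ε) ∧
      ∀ h ∈ Icc (h₀ - δ / 2) (h₀ + δ / 2),
        (h < h₀ + ε * κ ((θ, ε), h) ↔ h < g (θ, ε)) ∧
        (h = h₀ + ε * κ ((θ, ε), h) ↔ h = g (θ, ε)) := by
  set D : Set ((ℝ × ℝ) × ℝ) := (univ ×ˢ Ioo (-ε₁) ε₁) ×ˢ Ioo (h₀ - δ) (h₀ + δ)
  have hD : IsOpen D := (isOpen_univ.prod isOpen_Ioo).prod isOpen_Ioo
  have hn' : (n : WithTop ℕ∞) ≠ 0 := by exact_mod_cast hn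
  have hn1 : (1 : WithTop ℕ∞) ≤ n := by exact_mod_cast Nat.one_le_iff_ne_zero.2 hn
  set K : Set (ℝ × ℝ) := Icc (-(ε₁ / 2)) (ε₁ / 2) ×ˢ Icc (h₀ - δ / 2) (h₀ + δ / 2) with hKdef
  have hK : IsCompact K := isCompact_Icc.prod isCompact_Icc
  have hKε : ∀ x ∈ K, x.1 ∈ Ioo (-ε₁) ε₁ := fun x hx =>
    ⟨by linarith [hx.1.1], by linarith [hx.1.2]⟩
  have hKh : ∀ x ∈ K, x.2 ∈ Ioo (h₀ - δ) (h₀ + δ) := fun x hx =>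
    ⟨by linarith [hx.2.1], by linarith [hx.2.2]⟩
  have hmaps : MapsTo (fun x : ℝ × ℝ × ℝ => ((x.1, x.2.1), x.2.2)) (univ ×ˢ K) D := fun x hx =>
    ⟨⟨trivial, hKε x.2 hx.2⟩, hKh x.2 hx.2⟩
  have hcont : Continuous fun x : ℝ × ℝ × ℝ => ((x.1, x.2.1), x.2.2) := by fun_prop
  obtain ⟨C₀, hC₀⟩ := exists_bound_of_periodic (f := fun x => κ ((x.1, x.2.1), x.2.2)) hc hK
    (hκ.continuousOn.comp hcont.continuousOn hmaps) fun x hx => hper x.1 (hKε x hx) x.2 (hKh x hx)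
  have hder : ∀ p ∈ D, HasDerivAt (fun h => κ (p.1, h)) (fderiv ℝ κ p (0, 1)) p.2 := fun p hp =>
    (((hκ.contDiffAt (hD.mem_nhds hp)).differentiableAt hn').hasFDerivAt.comp_hasDerivAt p.2
      ((hasDerivAt_const p.2 p.1).prodMk (hasDerivAt_id p.2)) :)
  have hcd : ContinuousOn (fun p : (ℝ × ℝ) × ℝ => deriv (fun h => κ (p.1, h)) p.2) D :=
    ((hκ.continuousOn_fderiv_of_isOpen hD hn1).clm_apply continuousOn_const).congr
      fun p hp => (hder p hp).deriv
  obtain ⟨C₁, hC₁⟩ := exists_bound_of_periodic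
    (f := fun x : ℝ × ℝ × ℝ => deriv (fun h => κ ((x.1, x.2.1), h)) x.2.2) hc hK
    (hcd.comp hcont.continuousOn hmaps) fun x hx θ => by
      refine Filter.EventuallyEq.deriv_eq ?_
      filter_upwards [Ioo_mem_nhds (hKh x hx).1 (hKh x hx).2] with h hh
      exact hper x.1 (hKε x hx) h hh θ
  have hC₀' : 0 ≤ C₀ := (abs_nonneg _).trans (hC₀ 0 (0, h₀)
    ⟨⟨by simp; linarith, by simp; linarith⟩, by simp; linarith, by simp; linarith⟩)
  have hC₁' : 0 ≤ C₁ := (abs_nonneg _).trans (hC₁ 0 (0, h₀)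
    ⟨⟨by simp; linarith, by simp; linarith⟩, by simp; linarith, by simp; linarith⟩)
  -- the second bound keeps the root within `δ / 2` of `h₀`, the third makes `h - h₀ - ε κ` increase
  set ε₂ := min (ε₁ / 2) (min (δ / 2 / (C₀ + 1)) (1 / (C₁ + 1)))
  have hε₂ : 0 < ε₂ := lt_min (by linarith) (lt_min (by positivity) (by positivity))
  have hεK : ∀ ε ∈ Ioo (-ε₂) ε₂, ∀ h ∈ Icc (h₀ - δ / 2) (h₀ + δ / 2), (ε, h) ∈ K :=
    fun ε hε h hh => ⟨⟨by linarith [hε.1, min_le_left (ε₁ / 2) (min (δ / 2 / (C₀ + 1))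
      (1 / (C₁ + 1)))], hε.2.le.trans (min_le_left _ _)⟩, hh⟩
  have hεD : ∀ p ∈ (univ ×ˢ Ioo (-ε₂) ε₂ : Set (ℝ × ℝ)), ∀ h ∈ Icc (h₀ - δ / 2) (h₀ + δ / 2),
      (p, h) ∈ D := fun p hp h hh => hmaps (x := (p.1, p.2, h)) ⟨trivial, hεK p.2 hp.2 h hh⟩
  have hsmall₀ : ∀ ε ∈ Ioo (-ε₂) ε₂, ∀ θ, ∀ h ∈ Icc (h₀ - δ / 2) (h₀ + δ / 2),
      |ε * κ ((θ, ε), h)| < δ / 2 := fun ε hε θ h hh => by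
    have h1 : |ε| < δ / 2 / (C₀ + 1) :=
      (abs_lt.2 hε).trans_le ((min_le_right _ _).trans (min_le_left _ _))
    rw [lt_div_iff₀ (by positivity)] at h1
    rw [abs_mul]
    have h2 := mul_le_mul_of_nonneg_left (hC₀ θ _ (hεK ε hε h hh)) (abs_nonneg ε)
    simp only at h2
    nlinarith [abs_nonneg ε]
  have hsmall₁ : ∀ ε ∈ Ioo (-ε₂) ε₂, ∀ θ, ∀ h ∈ Icc (h₀ - δ / 2) (h₀ + δ / 2),
      ε * deriv (fun h => κ ((θ, ε), h)) h < 1 := fun ε hε θ h hh => by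
    have h1 : |ε| < 1 / (C₁ + 1) :=
      (abs_lt.2 hε).trans_le ((min_le_right _ _).trans (min_le_right _ _))
    rw [lt_div_iff₀ (by positivity)] at h1
    have h2 := mul_le_mul_of_nonneg_left (hC₁ θ _ (hεK ε hε h hh)) (abs_nonneg ε)
    rw [← abs_mul] at h2
    simp only at h2
    linarith [le_abs_self (ε * deriv (fun h => κ ((θ, ε), h)) h), abs_nonneg ε]
  have hpr : ∀ p ∈ (univ ×ˢ Ioo (-ε₂) ε₂ : Set (ℝ × ℝ)), ∀ h ∈ Icc (h₀ - δ / 2) (h₀ + δ / 2),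
      HasDerivAt (fun h => h - h₀ - p.2 * κ (p, h))
        (1 - p.2 * deriv (fun h => κ (p, h)) h) h := fun p hp h hh =>
    (((hasDerivAt_id h).sub_const h₀).sub
      ((hder (p, h) (hεD p hp h hh)).differentiableAt.hasDerivAt.const_mul p.2) :)
  obtain ⟨g, hg⟩ := exists_contDiffAt_root hn
    (F := fun x : (ℝ × ℝ) × ℝ => x.2 - h₀ - x.1.2 * κ x)
    (U := univ ×ˢ Ioo (-ε₂) ε₂) (isOpen_univ.prod isOpen_Ioo)
    (a := h₀ - δ / 2) (b := h₀ + δ / 2) (by linarith)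
    (fun p hp h hh => by
      have h1 := hκ.contDiffAt (hD.mem_nhds (hεD p hp h (Ioo_subset_Icc_self hh)))
      fun_prop)
    (fun p hp h hh => (hpr p hp h hh).continuousAt.continuousWithinAt)
    (fun p hp h hh => by
      rw [(hpr p hp h (Ioo_subset_Icc_self hh)).deriv]
      linarith [hsmall₁ p.2 hp.2 p.1 h (Ioo_subset_Icc_self hh)])
    (fun p hp => by
      have := (abs_lt.1 (hsmall₀ p.2 hp.2 p.1 (h₀ - δ / 2) ⟨le_rfl, by linarith⟩)).1
      simp only
      linarith)
    (fun p hp => by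
      have := (abs_lt.1 (hsmall₀ p.2 hp.2 p.1 (h₀ + δ / 2) ⟨by linarith, le_rfl⟩)).2
      simp only
      linarith)
  refine ⟨ε₂, hε₂, (min_le_left _ _).trans (by linarith), g, fun θ ε hε => ?_⟩
  obtain ⟨h1, h2, h3, h4⟩ := hg (θ, ε) ⟨trivial, hε⟩
  simp only at h2 h4
  refine ⟨h1, by linarith, ?_, h3, fun h hh => ⟨?_, ?_⟩⟩
  · obtain ⟨h5, h6, -, -⟩ := hg (θ + c, ε) ⟨trivial, hε⟩
    have h7 := hεK ε hε _ (Ioo_subset_Icc_self h5)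
    have h8 := hper ε (hKε _ h7) _ (hKh _ h7) θ
    simp only at h6 h8
    rw [h8] at h6
    exact (h4 _ (Ioo_subset_Icc_self h5)).2.1 h6
  · rw [← (h4 h hh).1]
    constructor <;> intro <;> linarith
  · rw [← (h4 h hh).2]
    constructor <;> intro <;> linarith

/-- An `ε`-small perturbation `h₀ + ε K (θ, ε)` of a constant stays `ε`-close to a constant, with
all its derivatives in `θ`, after a composition with a smooth function. -/
lemma exists_periodicCrClose {r : ℕ} (hr : r ≠ 0) {L : ℝ → ℝ} {a b h₀ δ ε₂ : ℝ} (hδ : 0 ≤ δ)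
    (hL : ContDiffOn ℝ r L (Ioo a b)) (hsub : Icc (h₀ - δ) (h₀ + δ) ⊆ Ioo a b) {K : ℝ × ℝ → ℝ}
    (hε₂ : 0 < ε₂) (hK : ContDiffOn ℝ r K (univ ×ˢ Ioo (-ε₂) ε₂))
    (hper : ∀ ε ∈ Ioo (-ε₂) ε₂, Function.Periodic (fun θ => K (θ, ε)) (2 * Real.pi))
    (hmem : ∀ θ, ∀ ε ∈ Ioo (-ε₂) ε₂, h₀ + ε * K (θ, ε) ∈ Icc (h₀ - δ) (h₀ + δ)) :
    ∃ C, ∀ ε ∈ Icc 0 (ε₂ / 2),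
      PeriodicCrClose r (fun θ => L (h₀ + ε * K (θ, ε))) (L h₀) (C * ε) := by
  obtain ⟨m, rfl⟩ := Nat.exists_eq_succ_of_ne_zero hr
  have hpi : 0 < 2 * Real.pi := by positivity
  set U : Set (ℝ × ℝ) := univ ×ˢ Ioo (-ε₂) ε₂
  have hU : IsOpen U := isOpen_univ.prod isOpen_Ioo
  have hsubI : Icc 0 (ε₂ / 2) ⊆ Ioo (-ε₂) ε₂ := fun ε hε => ⟨by linarith [hε.1], by linarith [hε.2]⟩
  have hLd : ContDiffOn ℝ m (deriv L) (Ioo a b) :=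
    ((contDiffOn_succ_iff_deriv_of_isOpen isOpen_Ioo).1 (by exact_mod_cast hL)).2.2
  have hLD : ∀ x ∈ Ioo a b, HasDerivAt L (deriv L x) x := fun x hx =>
    ((hL.contDiffAt (isOpen_Ioo.mem_nhds hx)).differentiableAt (by norm_cast)).hasDerivAt
  have hin : ContDiffOn ℝ (m + 1 : ℕ) (fun x : ℝ × ℝ => h₀ + x.2 * K x) U := by fun_prop
  have hKd := contDiffOn_deriv_fst isOpen_Ioo hK
  -- the derivative in `θ` is `ε W`
  set W : ℝ × ℝ → ℝ := fun x => deriv L (h₀ + x.2 * K x) * deriv (fun θ => K (θ, x.2)) x.1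
  have hW : ContDiffOn ℝ m W U :=
    (hLd.comp (hin.of_le (by norm_cast; omega)) fun x hx => hsub (hmem x.1 x.2 hx.2)).mul hKd
  have hWper : ∀ ε ∈ Ioo (-ε₂) ε₂, Function.Periodic (fun θ => W (θ, ε)) (2 * Real.pi) := by
    intro ε hε θ
    have h1 := (hper ε hε).iteratedDeriv 1 θ
    have h2 := hper ε hε θ
    simp only [iteratedDeriv_one] at h1
    simp only at h2
    simp only [W, h1, h2]
  have hderK : ∀ ε ∈ Ioo (-ε₂) ε₂, ∀ θ,
      HasDerivAt (fun θ => K (θ, ε)) (deriv (fun θ => K (θ, ε)) θ) θ := fun ε hε θ => by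
    have h1 : ContDiffAt ℝ (m + 1 : ℕ) K (θ, ε) := hK.contDiffAt (hU.mem_nhds ⟨trivial, hε⟩)
    have h2 : ContDiffAt ℝ (m + 1 : ℕ) (fun θ : ℝ => ((θ, ε) : ℝ × ℝ)) θ := by fun_prop
    exact ((h1.comp θ h2).differentiableAt (by norm_cast)).hasDerivAt
  obtain ⟨C₀, hC₀⟩ := exists_bound_of_periodic hpi (isCompact_Icc (a := 0) (b := ε₂ / 2))
    (hK.continuousOn.mono (prod_mono le_rfl hsubI)) fun ε hε => hper ε (hsubI hε)
  obtain ⟨C₁, hC₁⟩ := isCompact_Icc.exists_bound_of_continuousOn (hLd.continuousOn.mono hsub)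
  have hC : ∀ k : ℕ, ∃ C, k ≤ m → ∀ θ, ∀ ε ∈ Icc 0 (ε₂ / 2),
      |iteratedDeriv k (fun θ => W (θ, ε)) θ| ≤ C := by
    intro k
    by_cases hk : k ≤ m
    · have h1 := contDiffOn_iteratedDeriv_fst isOpen_Ioo k (m := m - k) (W := W)
        (by rwa [Nat.sub_add_cancel hk])
      obtain ⟨C, hC⟩ := exists_bound_of_periodic hpi (isCompact_Icc (a := 0) (b := ε₂ / 2))
        (h1.continuousOn.mono (prod_mono le_rfl hsubI))
        fun ε hε => (hWper ε (hsubI hε)).iteratedDeriv k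
      exact ⟨C, fun _ => hC⟩
    · exact ⟨0, fun h => absurd h hk⟩
  choose C hC using hC
  set C' := max (C₁ * C₀) (∑ k ∈ Finset.range (m + 1), |C k|)
  refine ⟨C', fun ε hε => ⟨fun θ => ?_, ?_, fun k hk θ => ?_⟩⟩
  · have := hper ε (hsubI hε) θ
    simp only at this ⊢
    rw [this]
  · have hε' := hsubI hε
    refine contDiff_iff_contDiffAt.2 fun θ => ?_
    have h1 : ContDiffAt ℝ (m + 1 : ℕ) K (θ, ε) := hK.contDiffAt (hU.mem_nhds ⟨trivial, hε'⟩)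
    have h2 : ContDiffAt ℝ (m + 1 : ℕ) (fun θ : ℝ => ((θ, ε) : ℝ × ℝ)) θ := by fun_prop
    have h3 := h1.comp θ h2
    have h4 : ContDiffAt ℝ (m + 1 : ℕ) (fun θ : ℝ => h₀ + ε * K (θ, ε)) θ :=
      contDiffAt_const.add (contDiffAt_const.mul h3)
    exact (hL.contDiffAt (isOpen_Ioo.mem_nhds (hsub (hmem θ ε hε')))).comp θ h4
  · have hε' := hsubI hε
    rcases k with _ | k
    · rw [iteratedDeriv_zero]
      have h1 := (convex_Icc (h₀ - δ) (h₀ + δ)).norm_image_sub_le_of_norm_deriv_le (f := L)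
        (fun x hx => (hLD x (hsub hx)).differentiableAt) hC₁ (x := h₀) (y := h₀ + ε * K (θ, ε))
        ⟨by linarith, by linarith⟩ (hmem θ ε hε')
      rw [Real.norm_eq_abs, add_sub_cancel_left, norm_mul, Real.norm_eq_abs, Real.norm_eq_abs,
        abs_of_nonneg hε.1] at h1
      have hC₁0 : 0 ≤ C₁ := (norm_nonneg _).trans (hC₁ h₀ ⟨by linarith, by linarith⟩)
      calc |L (h₀ + ε * K (θ, ε)) - L h₀| ≤ C₁ * (ε * |K (θ, ε)|) := h1
        _ ≤ C₁ * (ε * C₀) := by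
          have := hC₀ θ ε hε
          have := hε.1
          gcongr
        _ = C₁ * C₀ * ε := by ring
        _ ≤ C' * ε := mul_le_mul_of_nonneg_right (le_max_left _ _) hε.1
    · have h1 : deriv (fun x => L (h₀ + ε * K (x, ε)) - L h₀) = fun θ => ε * W (θ, ε) := by
        funext θ
        have h2 := ((hderK ε hε' θ).const_mul ε).const_add h₀
        have h3 : HasDerivAt (fun θ => L (h₀ + ε * K (θ, ε))) _ θ :=
          (hLD _ (hsub (hmem θ ε hε'))).comp θ h2
        rw [(h3.sub_const (L h₀)).deriv]
        simp only [W]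
        ring
      rw [iteratedDeriv_succ', h1, iteratedDeriv_const_mul_field, abs_mul, abs_of_nonneg hε.1,
        mul_comm]
      have hk' : k ∈ Finset.range (m + 1) := Finset.mem_range.2 (by omega)
      refine mul_le_mul_of_nonneg_right ?_ hε.1
      calc |iteratedDeriv k (fun θ => W (θ, ε)) θ| ≤ C k := hC k (by omega) θ ε hε
        _ ≤ |C k| := le_abs_self _
        _ ≤ ∑ k ∈ Finset.range (m + 1), |C k| :=
          Finset.single_le_sum (f := fun k => |C k|) (fun _ _ => abs_nonneg _) hk'
        _ ≤ C' := le_max_right _ _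

/-! ### The section near the tangency energy -/

namespace WallSystem

variable {r : ℕ} {S : WallSystem r} {E R ε : ℝ}

lemma V₁_w_pos (S : WallSystem r) : 0 < S.V₁ S.w := S.isWell_V₁.pos S.w_neg.ne

lemma abs_w_lt (hE : S.V₁ S.w < E)
    (hR : ∀ q₁ q₂ : ℝ, S.w ≤ q₁ → S.V₁ q₁ + S.V₂ q₂ ≤ E → |q₁| < R ∧ |q₂| < R) : |S.w| < R :=
  (hR S.w 0 le_rfl (by rw [S.V₂_zero, add_zero]; exact hE.le)).1

lemma lt_V₁_R (hE : S.V₁ S.w < E)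
    (hR : ∀ q₁ q₂ : ℝ, S.w ≤ q₁ → S.V₁ q₁ + S.V₂ q₂ ≤ E → |q₁| < R ∧ |q₂| < R) : E < S.V₁ R := by
  have h1 := (abs_nonneg _).trans_lt (abs_w_lt hE hR)
  by_contra hcon
  have h2 := (hR R 0 (by linarith [S.w_neg]) (by rw [S.V₂_zero, add_zero]; exact not_lt.1 hcon)).1
  rw [abs_of_pos h1] at h2
  exact h2.false

lemma ham_eq_add (z : PhasePt) : S.ham ε z =
    z.p₁ ^ 2 / 2 + S.V₁ z.q₁ + energy₁ S.V₂ z.q₂ z.p₂ + ε * S.Vc (z.q₁, z.q₂) := rfl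

namespace FreeFlow

variable {F : S.FreeFlow E R}

lemma eventually_mul_lt (F : S.FreeFlow E R) {d : ℝ} (hd : 0 < d) :
    ∀ᶠ ε in 𝓝 (0 : ℝ), |ε| * F.M < d := by
  have h : Continuous fun ε : ℝ => |ε| * F.M := by fun_prop
  exact h.continuousAt.eventually (gt_mem_nhds (by simpa using hd))

lemma eventually_abs_le (F : S.FreeFlow E R) : ∀ᶠ ε in 𝓝 (0 : ℝ), |ε| ≤ F.ε₀ := by
  filter_upwards [continuous_abs.continuousAt.eventually
    (gt_mem_nhds (by simpa using F.ε₀_pos : |(0 : ℝ)| < F.ε₀))] with ε hε using hε.le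

lemma abs_mul_Vc_le (F : S.FreeFlow E R) (ε : ℝ) {x y : ℝ} (hx : |x| ≤ R) (hy : |y| ≤ R) :
    |ε * S.Vc (x, y)| ≤ |ε| * F.M := by
  rw [abs_mul]
  exact mul_le_mul_of_nonneg_left (F.Vc_le _ _ (hx.trans F.R_le) (hy.trans F.R_le)) (abs_nonneg ε)

lemma abs_mul_d₁Vc_le (F : S.FreeFlow E R) (ε : ℝ) {x y : ℝ} (hx : |x| ≤ R) (hy : |y| ≤ R) :
    |ε * S.d₁Vc x y| ≤ |ε| * F.M := by
  rw [abs_mul]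
  exact mul_le_mul_of_nonneg_left (F.d₁Vc_le _ _ (hx.trans F.R_le) (hy.trans F.R_le)) (abs_nonneg ε)

lemma eventually_isSmall (F : S.FreeFlow E R) (hE : S.V₁ S.w < E)
    (hR : ∀ q₁ q₂ : ℝ, S.w ≤ q₁ → S.V₁ q₁ + S.V₂ q₂ ≤ E → |q₁| < R ∧ |q₂| < R) :
    ∀ᶠ ε in 𝓝 (0 : ℝ), 0 ≤ ε → F.IsSmall ε := by
  have hw := abs_w_lt hE hR
  have hw0 := V₁_w_pos S
  have hR0 : 0 < R := (abs_nonneg _).trans_lt hw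
  obtain ⟨m, hm, hmK⟩ : ∃ m, E < m ∧ ∀ x y, S.w ≤ x → |x| ≤ R → |y| ≤ R → (|x| = R ∨ |y| = R) →
      m ≤ S.V₁ x + S.V₂ y := by
    set K : Set (ℝ × ℝ) := {v | S.w ≤ v.1 ∧ |v.1| ≤ R ∧ |v.2| ≤ R ∧ (|v.1| = R ∨ |v.2| = R)}
    have hK : IsCompact K := by
      refine (isCompact_closedBall (0 : ℝ × ℝ) R).of_isClosed_subset ?_ fun v hv => by
        rw [mem_closedBall_zero_iff]
        exact max_le hv.2.1 hv.2.2.1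
      have h1 : Continuous fun v : ℝ × ℝ => |v.1| := by fun_prop
      have h2 : Continuous fun v : ℝ × ℝ => |v.2| := by fun_prop
      exact (isClosed_le continuous_const continuous_fst).inter
        ((isClosed_le h1 continuous_const).inter ((isClosed_le h2 continuous_const).inter
          ((isClosed_eq h1 continuous_const).union (isClosed_eq h2 continuous_const))))
    have hc : Continuous fun v : ℝ × ℝ => S.V₁ v.1 + S.V₂ v.2 :=
      (S.isWell_V₁.contDiff.continuous.comp continuous_fst).add
        (S.isWell_V₂.contDiff.continuous.comp continuous_snd)
    obtain ⟨m, hm, h⟩ := hK.exists_forall_le' hc.continuousOn (a := E) fun v hv => by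
      by_contra hcon
      obtain ⟨h1, h2⟩ := hR v.1 v.2 hv.1 (not_lt.1 hcon)
      exact hv.2.2.2.elim h1.ne h2.ne
    exact ⟨m, hm, fun x y h1 h2 h3 h4 => h (x, y) ⟨h1, h2, h3, h4⟩⟩
  obtain ⟨c, hc, hcV⟩ := S.isWell_V₁.exists_lt_of_abs_le (half_pos hw0)
  obtain ⟨ν, hν, hνV⟩ := S.isWell_V₁.exists_lt_abs_deriv hc R
  filter_upwards [F.eventually_abs_le, F.eventually_mul_lt (sub_pos.2 hm),
    F.eventually_mul_lt (neg_pos.2 (S.isWell_V₁.deriv_neg S.w_neg)), F.eventually_mul_lt hν,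
    F.eventually_mul_lt (div_pos (half_pos hw0) (by positivity : 0 < 2 * R))]
      with ε h1 h2 h3 h4 h5 h0
  refine ⟨h0, h1, fun x y hx hxR hyR hxy => ?_, fun y hy => ?_, fun x y hxR hyR hxy => ?_⟩
  · linarith [hmK x y hx hxR hyR hxy, (abs_le.1 (F.abs_mul_Vc_le ε hxR hyR)).1]
  · linarith [(abs_le.1 (F.abs_mul_d₁Vc_le ε hw.le hy)).2]
  · have h6 := abs_le.1 (F.abs_mul_d₁Vc_le ε hxR hyR)
    have h7 := hνV x hxR
    have h8 : S.V₁ x < S.V₁ S.w / 2 := by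
      refine hcV x (abs_le.2 ⟨?_, ?_⟩)
      · by_contra hcon
        linarith [h7.2 (not_le.1 hcon).le]
      · by_contra hcon
        linarith [h7.1 (not_le.1 hcon).le]
    rw [lt_div_iff₀ (by positivity), abs_of_nonneg h0] at h5
    linarith

/-- The wall-free trajectory of `z` descends up to the time `τ`, when it reaches a turning point of
the first degree of freedom, to the left of the origin. -/
structure IsDescent (F : S.FreeFlow E R) (ε : ℝ) (z : PhasePt) (τ : ℝ) : Prop where
  pos : 0 < τ
  end_p₁ : (F.φ τ ε z).p₁ = 0
  descent : ∀ t ∈ Ioo 0 τ, (F.φ t ε z).p₁ < 0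
  end_neg : (F.φ τ ε z).q₁ < 0
  end_force : 0 < S.force₁ ε (F.φ τ ε z)

/-- The contact of the trajectory with the wall, before its first return to the section, is decided
by the position of the turning point of the wall-free trajectory. -/
lemma IsDescent.touches_iff {z : PhasePt} {τ : ℝ} (D : F.IsDescent ε z τ) (hε : F.IsSmall ε)
    (hz : z ∈ S.sect ε E R) :
    (S.Touches ε E R z ↔ (F.φ τ ε z).q₁ = S.w) ∧ (S.Impacts ε E R z ↔ (F.φ τ ε z).q₁ < S.w) := by
  have hdom := F.sect_subset_dom hz
  have hanti := strictAntiOn_q₁ hε.le hdom D.descent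
  have hT : ∀ T > 0, (∀ t ∈ Ioo 0 T, (F.φ t ε z).p₁ < 0) → T ≤ τ := fun T hT h => by
    by_contra hcon
    exact (h τ ⟨D.pos, not_le.1 hcon⟩).ne D.end_p₁
  refine ⟨?_, ?_⟩
  · rw [Touches, meetsWall_iff hε hz]
    constructor
    · rintro ⟨T, hT0, h1, h2, h3⟩
      rcases (hT T hT0 h1).eq_or_lt with rfl | h
      · exact h2
      · exact absurd (h3.trans neg_zero) (D.descent T ⟨hT0, h⟩).ne
    · exact fun h => ⟨τ, D.pos, D.descent, h, by rw [D.end_p₁, neg_zero]⟩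
  · simp only [Impacts, meetsWall_iff hε hz]
    constructor
    · rintro ⟨v, hv, T, hT0, h1, h2, h3⟩
      rcases (hT T hT0 h1).eq_or_lt with rfl | h
      · exact absurd (neg_eq_zero.1 (h3.symm.trans D.end_p₁)) hv
      · rw [← h2]
        exact hanti ⟨hT0.le, h.le⟩ ⟨D.pos.le, le_rfl⟩ h
    · intro h
      obtain ⟨T, hT', hTw⟩ := intermediate_value_Ioo' D.pos.le
        (fun t _ => (F.deriv_q₁ ε hε.le _ hdom t).continuousAt.continuousWithinAt)
        ⟨h, by rw [F.zero]; exact hε.lt_q₁_of_sect hz⟩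
      exact ⟨-(F.φ T ε z).p₁, (neg_pos.2 (D.descent T hT')).ne', T, hT'.1,
        fun t ht => D.descent t ⟨ht.1, ht.2.trans hT'.2⟩, hTw, (neg_neg _).symm⟩

/-- The change of the energy of the first degree of freedom during a descent. -/
lemma energy_drift (hε : |ε| ≤ F.ε₀) {z : PhasePt} (hz : z ∈ S.dom E F.B ε) (hp : z.p₁ = 0) {T : ℝ}
    (hT : 0 ≤ T) (hneg : ∀ t ∈ Ioo 0 T, (F.φ t ε z).p₁ < 0) :
    |(F.φ T ε z).p₁ ^ 2 / 2 + S.V₁ (F.φ T ε z).q₁ - S.V₁ z.q₁| ≤ |ε| * F.M * (2 * F.B) := by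
  have h1 := _root_.energy_drift S.isWell_V₁ hT (fun u _ => F.deriv_q₁ ε hε z hz u)
    (fun u _ => F.deriv_p₁ ε hε z hz u) (fun u _ => F.abs_force₁_add_le hε hz u)
    fun u hu => (hneg u hu).le
  simp only [F.zero, hp] at h1
  have h2 := abs_lt.1 hz.1
  have h3 := abs_lt.1 (F.mem ε hε z hz T).1
  refine (by simpa using h1 : _ ≤ _).trans (mul_le_mul_of_nonneg_left (by linarith)
    (mul_nonneg (abs_nonneg _) F.M_pos.le))

/-- The energy of the second degree of freedom changes by `-ε k`. -/
lemma energy₂_add (hε : |ε| ≤ F.ε₀) {z : PhasePt} (hz : z ∈ S.dom E F.B ε) (t : ℝ) :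
    energy₁ S.V₂ (F.φ t ε z).q₂ (F.φ t ε z).p₂ + ε * F.k t ε z = energy₁ S.V₂ z.q₂ z.p₂ := by
  have hd : ∀ t, HasDerivAt (fun t =>
      energy₁ S.V₂ (F.φ t ε z).q₂ (F.φ t ε z).p₂ + ε * F.k t ε z) 0 t := fun t => by
    refine ((hasDerivAt_energy₁ S.isWell_V₂ (F.deriv_q₂ ε hε z hz t)
      (F.deriv_p₂ ε hε z hz t)).add ((F.deriv_k ε hε z hz t).const_mul ε)).congr_deriv ?_
    rw [force₂_eq]
    ring
  have := is_const_of_deriv_eq_zero (fun t => (hd t).differentiableAt) (fun t => (hd t).deriv) t 0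
  simpa [F.zero, F.k_zero] using this

/-- The potential energy at the turning point. -/
lemma IsDescent.V₁_end {z : PhasePt} {τ : ℝ} (D : F.IsDescent ε z τ) (hε : |ε| ≤ F.ε₀)
    (hz : z ∈ S.dom E F.B ε) (hE : S.ham ε z = E) :
    S.V₁ (F.φ τ ε z).q₁ = E - energy₁ S.V₂ z.q₂ z.p₂ +
      ε * (F.k τ ε z - S.Vc ((F.φ τ ε z).q₁, (F.φ τ ε z).q₂)) := by
  have h1 := (F.ham_eq ε hε z hz τ).trans hE
  have h2 := F.energy₂_add hε hz τ
  rw [ham_eq_add, D.end_p₁] at h1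
  linarith

lemma IsDescent.abs_V₁_end_sub_le {z : PhasePt} {τ : ℝ} (D : F.IsDescent ε z τ) (hε : |ε| ≤ F.ε₀)
    (hz : z ∈ S.sect ε E R) :
    |S.V₁ (F.φ τ ε z).q₁ - (E - energy₁ S.V₂ z.q₂ z.p₂)| ≤ |ε| * F.M * (2 * F.B + 1) := by
  have h1 := F.energy_drift hε (F.sect_subset_dom hz) hz.2.2.2.1 D.pos.le D.descent
  have h2 := hz.2.2.2.2.2
  have h3 := abs_le.1 (F.abs_mul_Vc_le ε hz.2.1.le hz.2.2.1.le)
  rw [ham_eq_add, hz.2.2.2.1] at h2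
  rw [D.end_p₁] at h1
  have h1 := abs_le.1 h1
  rw [abs_le]
  constructor <;> linarith

/-- Where the energy of the second degree of freedom is within `δ` of its value `E - V₁ w` at a
tangency in the unperturbed system, the points of the section have `q₁ ∈ (α, R)`, and `q₁` is the
only root of the energy equation there. Points of the section with `q₁ < α` do not reach the wall,
and in a descent the energy of the first degree of freedom changes by less than `δ / 2`. -/
structure IsWindow (F : S.FreeFlow E R) (α δ ε : ℝ) : Prop where
  le : |ε| ≤ F.ε₀
  left : ∀ y, |y| ≤ R → ∀ h < E - S.V₁ S.w + δ, S.V₁ α + ε * S.Vc (α, y) < E - h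
  right : ∀ y, |y| ≤ R → ∀ h, E - S.V₁ S.w - δ < h → E - h < S.V₁ R + ε * S.Vc (R, y)
  force_neg : ∀ x y, α ≤ x → |x| ≤ R → |y| ≤ R → 0 < deriv S.V₁ x + ε * S.d₁Vc x y
  le_q₁ : ∀ z ∈ S.sect ε E R, energy₁ S.V₂ z.q₂ z.p₂ < E - S.V₁ S.w + δ → α ≤ z.q₁
  le_q₁_of_meetsWall : ∀ z ∈ S.sect ε E R, F.IsSmall ε → ∀ v, S.MeetsWall ε E R z v → α ≤ z.q₁
  drift : |ε| * F.M * (2 * F.B + 1) < δ / 2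

lemma exists_isWindow (F : S.FreeFlow E R) (hE : S.V₁ S.w < E)
    (hR : ∀ q₁ q₂ : ℝ, S.w ≤ q₁ → S.V₁ q₁ + S.V₂ q₂ ≤ E → |q₁| < R ∧ |q₂| < R) {δ : ℝ} (hδ : 0 < δ)
    (hδw : δ ≤ S.V₁ S.w / 4) (hδE : δ ≤ E - S.V₁ S.w) :
    ∃ α > 0, α < R ∧ ∀ᶠ ε in 𝓝 (0 : ℝ), F.IsWindow α δ ε := by
  have hw0 := V₁_w_pos S
  have hR0 : 0 < R := (abs_nonneg _).trans_lt (abs_w_lt hE hR)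
  have hVR := lt_V₁_R hE hR
  have hB : 0 < 2 * F.B + 1 := by linarith [F.R_le]
  obtain ⟨α, hα, hαV⟩ := S.isWell_V₁.exists_lt_of_abs_le (half_pos hw0)
  have hαR : α < R := by
    by_contra hcon
    linarith [hαV R (by rw [abs_of_pos hR0]; exact not_lt.1 hcon)]
  obtain ⟨ν, hν, hνV⟩ := S.isWell_V₁.exists_lt_abs_deriv hα R
  refine ⟨α, hα, hαR, ?_⟩
  filter_upwards [F.eventually_abs_le, F.eventually_mul_lt (sub_pos.2 hVR), F.eventually_mul_lt hν,
    F.eventually_mul_lt (div_pos (half_pos hδ) hB),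
    F.eventually_mul_lt (by positivity : 0 < S.V₁ S.w / 4)] with ε h1 h2 h3 h4 h5
  rw [lt_div_iff₀ hB] at h4
  -- the section lies in `q₁ > -α`
  have hsect : ∀ z ∈ S.sect ε E R, -α < z.q₁ := fun z hz => by
    by_contra hcon
    have h6 := hz.2.2.2.2.1
    rw [force₁_eq] at h6
    linarith [(hνV z.q₁ hz.2.1.le).2 (not_lt.1 hcon),
      (abs_le.1 (F.abs_mul_d₁Vc_le ε hz.2.1.le hz.2.2.1.le)).2]
  refine ⟨h1, fun y hy h hh => ?_, fun y hy h hh => ?_, fun x y hx hxR hyR => ?_,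
    fun z hz hh => ?_, fun z hz hε v hv => ?_, h4⟩
  · have hαR' : |α| ≤ R := by rw [abs_of_pos hα]; exact hαR.le
    linarith [hαV α (abs_of_pos hα).le, (abs_le.1 (F.abs_mul_Vc_le ε hαR' hy)).2]
  · linarith [(abs_le.1 (F.abs_mul_Vc_le ε (abs_of_pos hR0).le hy)).1]
  · linarith [(hνV x hxR).1 hx, (abs_le.1 (F.abs_mul_d₁Vc_le ε hxR hyR)).1]
  · by_contra hcon
    have h6 := hαV z.q₁ (abs_le.2 ⟨(hsect z hz).le, (not_le.1 hcon).le⟩)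
    have h7 := hz.2.2.2.2.2
    rw [ham_eq_add, hz.2.2.2.1] at h7
    linarith [(abs_le.1 (F.abs_mul_Vc_le ε hz.2.1.le hz.2.2.1.le)).2]
  · by_contra hcon
    have h6 := hαV z.q₁ (abs_le.2 ⟨(hsect z hz).le, (not_le.1 hcon).le⟩)
    obtain ⟨T, hT, hneg, hw, -⟩ := (meetsWall_iff hε hz v).1 hv
    have h7 := (abs_le.1 (F.energy_drift h1 (F.sect_subset_dom hz) hz.2.2.2.1 hT.le hneg)).2
    rw [hw] at h7
    have h8 := mul_nonneg (abs_nonneg ε) F.M_pos.le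
    nlinarith [sq_nonneg (F.φ T ε z).p₁]

end FreeFlow

end WallSystem

lemma ActionAngle.eq_of_angleVar {V : ℝ → ℝ} {n : ℕ} {H : ℝ} (A : ActionAngle V n H) {x y θ : ℝ}
    (hH : energy₁ V x y ∈ Ioo 0 H) (hθ : angleVar V x y = (θ : Real.Angle)) :
    x = A.q θ (energy₁ V x y) ∧ y = A.p θ (energy₁ V x y) := by
  obtain ⟨s, h1, h2⟩ := A.surj x y hH
  have h3 := A.angle s _ hH
  rw [← h1, ← h2, hθ, Real.Angle.angle_eq_iff_two_pi_dvd_sub] at h3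
  obtain ⟨k, hk⟩ := h3
  have hq : Function.Periodic (fun s => A.q s (energy₁ V x y)) (2 * Real.pi) :=
    fun s => A.periodic_q s _ hH
  have hp : Function.Periodic (fun s => A.p s (energy₁ V x y)) (2 * Real.pi) :=
    fun s => A.periodic_p s _ hH
  have e : θ = s + k * (2 * Real.pi) := by linarith
  have h4 := hq.int_mul k s
  have h5 := hp.int_mul k s
  rw [← e] at h4 h5
  exact ⟨h1.trans h4.symm, h2.trans h5.symm⟩

namespace WallSystem

variable {r : ℕ} {S : WallSystem r} {E R ε : ℝ}

/-- The parameters `((θ, ε), h)`, with `h` near the tangency energy of the second degree of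
freedom. -/
def paramSet (S : WallSystem r) (E δ ε₁ : ℝ) : Set ((ℝ × ℝ) × ℝ) :=
  (univ ×ˢ Ioo (-ε₁) ε₁) ×ˢ Ioo (E - S.V₁ S.w - δ) (E - S.V₁ S.w + δ)

lemma isOpen_paramSet (S : WallSystem r) (E δ ε₁ : ℝ) : IsOpen (paramSet S E δ ε₁) :=
  (isOpen_univ.prod isOpen_Ioo).prod isOpen_Ioo

namespace FreeFlow

variable {F : S.FreeFlow E R}

lemma IsDescent.unique {z : PhasePt} {τ τ' : ℝ} (D : F.IsDescent ε z τ) (D' : F.IsDescent ε z τ') :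
    τ = τ' := by
  rcases lt_trichotomy τ τ' with h | h | h
  · exact absurd D.end_p₁ (D'.descent τ ⟨D.pos, h⟩).ne
  · exact h
  · exact absurd D'.end_p₁ (D.descent τ' ⟨D'.pos, h⟩).ne

/-- The points of the section near the tangency energy, parametrized by the angle and the energy of
the second degree of freedom. -/
lemma exists_start (hr : r ≠ 0) (A : ActionAngle S.V₂ r (E + 1))
    (hR : ∀ q₁ q₂ : ℝ, S.w ≤ q₁ → S.V₁ q₁ + S.V₂ q₂ ≤ E → |q₁| < R ∧ |q₂| < R) {α δ ε₁ : ℝ}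
    (hα : 0 < α) (hαR : α < R) (hδw : δ ≤ S.V₁ S.w / 4) (hδE : δ < E - S.V₁ S.w)
    (hW : ∀ ε ∈ Ioo (-ε₁) ε₁, F.IsWindow α δ ε) :
    ∃ Z : (ℝ × ℝ) × ℝ → PhasePt,
      ContDiffOn ℝ r (fun p => (p.1.2, (Z p).q₁, (Z p).p₁, (Z p).q₂, (Z p).p₂))
        (paramSet S E δ ε₁) ∧
      (∀ θ ε h, ((θ, ε), h) ∈ paramSet S E δ ε₁ →
        Z ((θ, ε), h) ∈ S.dom E F.B ε ∧ α ≤ (Z ((θ, ε), h)).q₁ ∧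
        (0 ≤ ε → Z ((θ, ε), h) ∈ S.sect ε E R) ∧ (Z ((θ, ε), h)).p₁ = 0 ∧
        S.force₁ ε (Z ((θ, ε), h)) < 0 ∧ S.ham ε (Z ((θ, ε), h)) = E ∧
        energy₁ S.V₂ (Z ((θ, ε), h)).q₂ (Z ((θ, ε), h)).p₂ = h ∧
        angleVar S.V₂ (Z ((θ, ε), h)).q₂ (Z ((θ, ε), h)).p₂ = θ ∧
        Z ((θ + 2 * Real.pi, ε), h) = Z ((θ, ε), h)) ∧
      ∀ ε ∈ Ioo (-ε₁) ε₁, ∀ z ∈ S.sect ε E R, ∀ θ : ℝ,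
        energy₁ S.V₂ z.q₂ z.p₂ ∈ Ioo (E - S.V₁ S.w - δ) (E - S.V₁ S.w + δ) →
        angleVar S.V₂ z.q₂ z.p₂ = θ → z = Z ((θ, ε), energy₁ S.V₂ z.q₂ z.p₂) := by
  have hw0 := V₁_w_pos S
  have hR0 : 0 < R := hα.trans hαR
  set h₀ := E - S.V₁ S.w with hh₀
  have hsub : Ioo (h₀ - δ) (h₀ + δ) ⊆ Ioo 0 (E + 1) := fun h hh =>
    ⟨by linarith [hh.1], by linarith [hh.2]⟩
  have hqR : ∀ θ, ∀ h ∈ Ioo (h₀ - δ) (h₀ + δ), |A.q θ h| < R := fun θ h hh => by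
    have h1 := A.energy θ h (hsub hh)
    refine (hR 0 _ S.w_neg.le ?_).2
    rw [energy₁] at h1
    rw [S.V₁_zero]
    nlinarith [sq_nonneg (A.p θ h), hh.2]
  have hU : IsOpen (paramSet S E δ ε₁) := isOpen_paramSet S E δ ε₁
  have hmaps : MapsTo (fun p : (ℝ × ℝ) × ℝ => (p.1.1, p.2)) (paramSet S E δ ε₁)
      (univ ×ˢ Ioo 0 (E + 1)) := fun p hp => ⟨trivial, hsub hp.2⟩
  have hproj : ContDiff ℝ r fun p : (ℝ × ℝ) × ℝ => (p.1.1, p.2) := by fun_prop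
  have hAq : ContDiffOn ℝ r (fun p : (ℝ × ℝ) × ℝ => A.q p.1.1 p.2) (paramSet S E δ ε₁) :=
    A.contDiffOn_q.comp hproj.contDiffOn hmaps
  have hAp : ContDiffOn ℝ r (fun p : (ℝ × ℝ) × ℝ => A.p p.1.1 p.2) (paramSet S E δ ε₁) :=
    A.contDiffOn_p.comp hproj.contDiffOn hmaps
  have hder : ∀ p : (ℝ × ℝ) × ℝ, ∀ y, HasDerivAt
      (fun y => S.V₁ y + p.1.2 * S.Vc (y, A.q p.1.1 p.2) - (E - p.2))
      (deriv S.V₁ y + p.1.2 * S.d₁Vc y (A.q p.1.1 p.2)) y := fun p y =>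
    ((S.isWell_V₁.hasDerivAt y).add
      ((S.hasDerivAt_Vc_fst y (A.q p.1.1 p.2)).differentiableAt.hasDerivAt.const_mul
        p.1.2)).sub_const _
  have hyR : ∀ y ∈ Icc α R, |y| ≤ R := fun y hy => by
    rw [abs_of_pos (hα.trans_le hy.1)]
    exact hy.2
  obtain ⟨a, ha⟩ := exists_contDiffAt_root hr
    (F := fun x : ((ℝ × ℝ) × ℝ) × ℝ =>
      S.V₁ x.2 + x.1.1.2 * S.Vc (x.2, A.q x.1.1.1 x.1.2) - (E - x.1.2)) hU hαR
    (fun p hp y _ => by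
      have h1 : ContDiffAt ℝ r (fun x : ((ℝ × ℝ) × ℝ) × ℝ => A.q x.1.1.1 x.1.2) (p, y) :=
        ContDiffAt.comp (g := fun p : (ℝ × ℝ) × ℝ => A.q p.1.1 p.2) (p, y)
          (hAq.contDiffAt (hU.mem_nhds hp)) contDiffAt_fst
      have h2 : ContDiffAt ℝ r (fun x : ((ℝ × ℝ) × ℝ) × ℝ => S.Vc (x.2, A.q x.1.1.1 x.1.2))
          (p, y) :=
        (S.contDiff_Vc.of_le (by norm_cast; omega)).contDiffAt.comp (p, y)
          (contDiffAt_snd.prodMk h1)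
      have h3 : ContDiffAt ℝ r (fun x : ((ℝ × ℝ) × ℝ) × ℝ => S.V₁ x.2) (p, y) :=
        (S.contDiff_V₁.of_le (by norm_cast; omega)).contDiffAt.comp (p, y) contDiffAt_snd
      fun_prop)
    (fun p _ y _ => (hder p y).continuousAt.continuousWithinAt)
    (fun p hp y hy => by
      rw [(hder p y).deriv]
      exact (hW p.1.2 hp.1.2).force_neg _ _ hy.1.le (hyR y (Ioo_subset_Icc_self hy))
        (hqR _ _ hp.2).le)
    (fun p hp => sub_neg.2 ((hW p.1.2 hp.1.2).left _ (hqR _ _ hp.2).le p.2 hp.2.2))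
    (fun p hp => sub_pos.2 ((hW p.1.2 hp.1.2).right _ (hqR _ _ hp.2).le p.2 hp.2.1))
  simp only at ha
  refine ⟨fun p => ⟨a p, 0, A.q p.1.1 p.2, A.p p.1.1 p.2⟩, ?_, fun θ ε h hp => ?_,
    fun ε hε z hz θ hh hθ => ?_⟩
  · have h1 : ContDiffOn ℝ r a (paramSet S E δ ε₁) := fun p hp =>
      (ha p hp).2.2.1.contDiffWithinAt
    simp only
    fun_prop
  · obtain ⟨h1, h2, -, h3⟩ := ha _ hp
    simp only at h2 h3 ⊢
    have h4 := hqR θ h hp.2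
    have h5 := hyR _ (Ioo_subset_Icc_self h1)
    have hf : S.force₁ ε ⟨a ((θ, ε), h), 0, A.q θ h, A.p θ h⟩ < 0 := by
      rw [force₁_eq]
      linarith [(hW ε hp.1.2).force_neg _ _ h1.1.le h5 h4.le]
    have hen := A.energy θ h (hsub hp.2)
    have hham : S.ham ε ⟨a ((θ, ε), h), 0, A.q θ h, A.p θ h⟩ = E := by
      rw [ham_eq_add]
      simp only
      rw [hen]
      linarith
    have haR : |a ((θ, ε), h)| < R := by
      rw [abs_of_pos (hα.trans h1.1)]
      exact h1.2
    refine ⟨⟨haR.trans_le F.R_le, h4.trans_le F.R_le, by linarith⟩, h1.1.le,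
      fun _ => ⟨S.w_neg.le.trans (hα.trans h1.1).le, haR, h4, rfl, hf, hham⟩, trivial, hf, hham,
      hen,
      A.angle θ h (hsub hp.2), ?_⟩
    obtain ⟨h6, h7, -, -⟩ := ha ((θ + 2 * Real.pi, ε), h) ⟨⟨trivial, hp.1.2⟩, hp.2⟩
    simp only [A.periodic_q θ h (hsub hp.2)] at h7
    rw [(h3 _ (Ioo_subset_Icc_self h6)).2.1 h7, A.periodic_q θ h (hsub hp.2),
      A.periodic_p θ h (hsub hp.2)]
  · obtain ⟨h1, h2⟩ := A.eq_of_angleVar (hsub hh) hθ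
    obtain ⟨-, -, -, h3⟩ := ha ((θ, ε), energy₁ S.V₂ z.q₂ z.p₂) ⟨⟨trivial, hε⟩, hh⟩
    have h4 := (hW ε hε).le_q₁ z hz hh.2
    have h5 := hz.2.2.2.2.2
    rw [ham_eq_add, hz.2.2.2.1] at h5
    refine PhasePt.ext ((h3 z.q₁ ⟨h4, (le_abs_self _).trans hz.2.1.le⟩).2.1 ?_) hz.2.2.2.1 h1 h2
    simp only
    rw [← h1]
    linarith

/-- Near the tangency energy, the potential energy at the turning point of the wall-free trajectory
is `E - h + ε κ`, with `κ` of class `C^r`. -/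
lemma exists_turning_energy (hr : r ≠ 0) {δ ε₁ α : ℝ} {Z : (ℝ × ℝ) × ℝ → PhasePt}
    (hε₁ : ∀ ε ∈ Ioo (-ε₁) ε₁, |ε| ≤ F.ε₀)
    (hZ : ContDiffOn ℝ r (fun p => (p.1.2, (Z p).q₁, (Z p).p₁, (Z p).q₂, (Z p).p₂))
      (paramSet S E δ ε₁))
    (hZ' : ∀ θ ε h, ((θ, ε), h) ∈ paramSet S E δ ε₁ →
        Z ((θ, ε), h) ∈ S.dom E F.B ε ∧ α ≤ (Z ((θ, ε), h)).q₁ ∧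
        (0 ≤ ε → Z ((θ, ε), h) ∈ S.sect ε E R) ∧ (Z ((θ, ε), h)).p₁ = 0 ∧
        S.force₁ ε (Z ((θ, ε), h)) < 0 ∧ S.ham ε (Z ((θ, ε), h)) = E ∧
        energy₁ S.V₂ (Z ((θ, ε), h)).q₂ (Z ((θ, ε), h)).p₂ = h ∧
        angleVar S.V₂ (Z ((θ, ε), h)).q₂ (Z ((θ, ε), h)).p₂ = θ ∧
        Z ((θ + 2 * Real.pi, ε), h) = Z ((θ, ε), h))
    (hD : ∀ ε ∈ Ioo (-ε₁) ε₁, ∀ z ∈ S.dom E F.B ε, z.p₁ = 0 → S.force₁ ε z < 0 → α ≤ z.q₁ →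
      ∃ τ, F.IsDescent ε z τ) :
    ∃ κ : (ℝ × ℝ) × ℝ → ℝ, ContDiffOn ℝ r κ (paramSet S E δ ε₁) ∧
      ∀ θ ε h, ((θ, ε), h) ∈ paramSet S E δ ε₁ →
        κ ((θ + 2 * Real.pi, ε), h) = κ ((θ, ε), h) ∧
        ∀ τ, F.IsDescent ε (Z ((θ, ε), h)) τ →
          S.V₁ (F.φ τ ε (Z ((θ, ε), h))).q₁ = E - h + ε * κ ((θ, ε), h) := by
  have hU : IsOpen (paramSet S E δ ε₁) := isOpen_paramSet S E δ ε₁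
  have hτ : ∀ p ∈ paramSet S E δ ε₁, ∃ τ, F.IsDescent p.1.2 (Z p) τ := fun p hp => by
    obtain ⟨h1, h2, -, h3, h4, -⟩ := hZ' p.1.1 p.1.2 p.2 hp
    exact hD p.1.2 hp.1.2 _ h1 h3 h4 h2
  have hτ' : ∀ p, ∃ τ, p ∈ paramSet S E δ ε₁ → F.IsDescent p.1.2 (Z p) τ := fun p => by
    by_cases hp : p ∈ paramSet S E δ ε₁
    · exact (hτ p hp).imp fun _ h _ => h
    · exact ⟨0, fun h => absurd h hp⟩
  choose τ hτ using hτ'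
  have hdom : ∀ p ∈ paramSet S E δ ε₁, Z p ∈ S.dom E F.B p.1.2 := fun p hp =>
    (hZ' p.1.1 p.1.2 p.2 hp).1
  have hargs : ContDiffOn ℝ r
      (fun x : ((ℝ × ℝ) × ℝ) × ℝ => (x.2, x.1.1.2, (Z x.1).q₁, (Z x.1).p₁, (Z x.1).q₂, (Z x.1).p₂))
      (paramSet S E δ ε₁ ×ˢ univ) :=
    contDiffOn_snd.prodMk (hZ.comp contDiffOn_fst fun x hx => hx.1)
  have hq₁ := F.contDiff_q₁.comp_contDiffOn hargs
  have hp₁ := F.contDiff_p₁.comp_contDiffOn hargs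
  have hq₂ := F.contDiff_q₂.comp_contDiffOn hargs
  have hk := F.contDiff_k.comp_contDiffOn hargs
  have hε : ContDiff ℝ r fun x : ((ℝ × ℝ) × ℝ) × ℝ => x.1.1.2 := by fun_prop
  have hF : ContinuousOn (fun x : ((ℝ × ℝ) × ℝ) × ℝ => S.force₁ x.1.1.2 (F.φ x.2 x.1.1.2 (Z x.1)))
      (paramSet S E δ ε₁ ×ˢ univ) :=
    (S.isWell_V₁.continuous_deriv.comp_continuousOn hq₁.continuousOn).neg.sub
      (hε.continuous.continuousOn.mul (S.contDiff_d₁Vc.continuous.comp_continuousOn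
        (hq₁.continuousOn.prodMk hq₂.continuousOn)))
  have hτC : ∀ p ∈ paramSet S E δ ε₁, ContDiffAt ℝ r τ p := fun p hp =>
    contDiffAt_firstZero hr hU hp₁ hF
      (fun p hp t => F.deriv_p₁ _ (hε₁ _ hp.1.2) _ (hdom p hp) t)
      (fun p hp => by
        have := (hZ' p.1.1 p.1.2 p.2 hp).2.2.2.1
        simpa [F.zero] using this)
      (fun p hp => by
        simp only [F.zero]
        exact (hZ' p.1.1 p.1.2 p.2 hp).2.2.2.2.1)
      (fun p hp => ⟨(hτ p hp).pos, (hτ p hp).end_p₁, (hτ p hp).end_force, (hτ p hp).descent⟩) hp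
  have hτO : ContDiffOn ℝ r (fun p => (p, τ p)) (paramSet S E δ ε₁) :=
    contDiffOn_id.prodMk fun p hp => (hτC p hp).contDiffWithinAt
  have hmaps : MapsTo (fun p => (p, τ p)) (paramSet S E δ ε₁) (paramSet S E δ ε₁ ×ˢ univ) :=
    fun p hp => ⟨hp, trivial⟩
  refine ⟨fun p => F.k (τ p) p.1.2 (Z p) -
    S.Vc ((F.φ (τ p) p.1.2 (Z p)).q₁, (F.φ (τ p) p.1.2 (Z p)).q₂), ?_, fun θ ε h hp => ⟨?_, ?_⟩⟩
  · exact (hk.comp hτO hmaps).sub ((S.contDiff_Vc.of_le (by norm_cast; omega)).comp_contDiffOn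
      ((hq₁.comp hτO hmaps).prodMk (hq₂.comp hτO hmaps)))
  · have hp' : ((θ + 2 * Real.pi, ε), h) ∈ paramSet S E δ ε₁ := ⟨⟨trivial, hp.1.2⟩, hp.2⟩
    have h1 := hτ _ hp'
    have h2 := (hZ' θ ε h hp).2.2.2.2.2.2.2.2
    simp only [h2] at h1 ⊢
    rw [h1.unique (hτ _ hp)]
  · intro τ' D
    obtain ⟨h1, -, -, -, -, h2, h3, -⟩ := hZ' θ ε h hp
    rw [D.V₁_end (hε₁ ε hp.1.2) h1 h2, h3, D.unique (hτ _ hp)]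

end FreeFlow

end WallSystem

/-! ### The tangency energy -/

namespace WallSystem

namespace FreeFlow

variable {r : ℕ} {S : WallSystem r} {E R ε : ℝ} {F : S.FreeFlow E R}

/-- The tangency energy `T θ` of the second degree of freedom: a point of the section with the angle
`θ` impacts the wall, touches it or misses it according to the position of its energy `h` with
respect to `T θ`. -/
structure IsTangencyEnergy (F : S.FreeFlow E R) (ε : ℝ) (T : ℝ → ℝ) : Prop where
  isSmall : F.IsSmall ε
  impacts : ∀ z ∈ S.sect ε E R, ∀ θ : ℝ, angleVar S.V₂ z.q₂ z.p₂ = θ →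
    energy₁ S.V₂ z.q₂ z.p₂ < T θ → S.Impacts ε E R z ∧ ¬ S.Touches ε E R z
  misses : ∀ z ∈ S.sect ε E R, ∀ θ : ℝ, angleVar S.V₂ z.q₂ z.p₂ = θ →
    T θ < energy₁ S.V₂ z.q₂ z.p₂ → ¬ S.Impacts ε E R z ∧ ¬ S.Touches ε E R z
  touches : ∀ z ∈ S.sect ε E R, ∀ θ : ℝ, angleVar S.V₂ z.q₂ z.p₂ = θ →
    energy₁ S.V₂ z.q₂ z.p₂ = T θ → S.Touches ε E R z
  returns : ∀ z ∈ S.sect ε E R, ∀ θ : ℝ, angleVar S.V₂ z.q₂ z.p₂ = θ →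
    energy₁ S.V₂ z.q₂ z.p₂ ≤ T θ → ∃ a b, F.IsReturnPath ε z a b
  exists_mem : ∀ θ : ℝ, ∃ z ∈ S.sect ε E R, angleVar S.V₂ z.q₂ z.p₂ = θ ∧
    energy₁ S.V₂ z.q₂ z.p₂ = T θ

/-- For small `ε` the tangency energy exists and is `E - V₁ w + ε K (θ, ε)` with `K` of class
`C^r`: the turning point is on the wall if `V₁ w = E - h + ε κ`, which is solved for `h`. -/
lemma exists_isTangencyEnergy (hr : r ≠ 0) (F : S.FreeFlow E R) (A : ActionAngle S.V₂ r (E + 1))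
    (hE : S.V₁ S.w < E)
    (hR : ∀ q₁ q₂ : ℝ, S.w ≤ q₁ → S.V₁ q₁ + S.V₂ q₂ ≤ E → |q₁| < R ∧ |q₂| < R) :
    ∃ δ > 0, Icc (E - S.V₁ S.w - δ) (E - S.V₁ S.w + δ) ⊆ Ioo 0 (E + 1) ∧
      ∃ ε₀ > 0, ∃ K : ℝ × ℝ → ℝ, ContDiffOn ℝ r K (univ ×ˢ Ioo (-ε₀) ε₀) ∧
        (∀ ε ∈ Ioo (-ε₀) ε₀, Function.Periodic (fun θ => K (θ, ε)) (2 * Real.pi)) ∧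
        (∀ θ, ∀ ε ∈ Ioo (-ε₀) ε₀,
          E - S.V₁ S.w + ε * K (θ, ε) ∈ Icc (E - S.V₁ S.w - δ) (E - S.V₁ S.w + δ)) ∧
        ∀ ε ∈ Ico 0 ε₀, F.IsTangencyEnergy ε fun θ => E - S.V₁ S.w + ε * K (θ, ε) := by
  have hw0 := V₁_w_pos S
  set h₀ := E - S.V₁ S.w with hh₀
  have hh₀' : 0 < h₀ := sub_pos.2 hE
  -- near the tangency energy, `h` is away from `0` and `E - h` is away from `0`
  set δ := min (S.V₁ S.w / 4) (h₀ / 2)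
  have hδ : 0 < δ := lt_min (by linarith) (by linarith)
  have hδw : δ ≤ S.V₁ S.w / 4 := min_le_left _ _
  have hδh : δ ≤ h₀ / 2 := min_le_right _ _
  obtain ⟨α, hα, hαR, hW⟩ := F.exists_isWindow hE hR hδ hδw (by linarith)
  obtain ⟨c, hc, -, e₁, he₁, hdes⟩ := F.exists_descent hα
  obtain ⟨e₂, he₂, hret⟩ := F.exists_isReturnPath hα
  obtain ⟨e₃, he₃, hev⟩ := Metric.eventually_nhds_iff.1 (hW.and (F.eventually_isSmall hE hR))
  set ε₁ := min e₁ (min e₂ e₃)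
  have hε₁ : 0 < ε₁ := lt_min he₁ (lt_min he₂ he₃)
  have hI₁ : ∀ ε ∈ Ioo (-ε₁) ε₁, |ε| ≤ e₁ := fun ε hε => (abs_lt.2 hε).le.trans (min_le_left _ _)
  have hI₂ : ∀ ε ∈ Ioo (-ε₁) ε₁, |ε| ≤ e₂ := fun ε hε =>
    (abs_lt.2 hε).le.trans ((min_le_right _ _).trans (min_le_left _ _))
  have hI₃ : ∀ ε ∈ Ioo (-ε₁) ε₁, F.IsWindow α δ ε ∧ (0 ≤ ε → F.IsSmall ε) := fun ε hε => hev (by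
    rw [Real.dist_eq, sub_zero]
    exact (abs_lt.2 hε).trans_le ((min_le_right _ _).trans (min_le_right _ _)))
  obtain ⟨Z, hZ, hZ', hZu⟩ := F.exists_start hr A hR hα hαR hδw (by linarith)
    fun ε hε => (hI₃ ε hε).1
  have hD : ∀ ε ∈ Ioo (-ε₁) ε₁, ∀ z ∈ S.dom E F.B ε, z.p₁ = 0 → S.force₁ ε z < 0 → α ≤ z.q₁ →
      ∃ τ, F.IsDescent ε z τ := fun ε hε z hz h1 h2 h3 => by
    obtain ⟨τ, h4, h5, h6, h7, h8⟩ := (hdes ε (hI₁ ε hε)).2.2 z hz h1 h2 h3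
    exact ⟨τ, h4, h5, h6, by linarith, h8⟩
  obtain ⟨κ, hκ, hκ'⟩ := F.exists_turning_energy hr (fun ε hε => (hI₃ ε hε).1.le) hZ hZ' hD
  obtain ⟨ε₂, hε₂, hε₂₁, g, hg⟩ := exists_perturbed_root hr Real.two_pi_pos hδ hε₁ hκ
    fun ε hε h hh θ => (hκ' θ ε h ⟨⟨trivial, hε⟩, hh⟩).1
  have hsub : Ioo (-ε₂) ε₂ ⊆ Ioo (-ε₁) ε₁ := Ioo_subset_Ioo (by linarith) hε₂₁
  have hgI : ∀ θ, ∀ ε ∈ Ioo (-ε₂) ε₂, g (θ, ε) ∈ Ioo (h₀ - δ) (h₀ + δ) := fun θ ε hε => by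
    have := (hg θ ε hε).1
    exact ⟨by linarith [this.1], by linarith [this.2]⟩
  have hgK : ∀ θ, ∀ ε ∈ Ioo (-ε₂) ε₂, h₀ + ε * κ ((θ, ε), g (θ, ε)) = g (θ, ε) :=
    fun θ ε hε => (hg θ ε hε).2.1.symm
  refine ⟨δ, hδ, fun h hh => ⟨by linarith [hh.1], by linarith [hh.2]⟩, ε₂, hε₂,
    fun x => κ (x, g x), ?_, fun ε hε θ => ?_, fun θ ε hε => ?_, fun ε hε => ?_⟩
  · refine hκ.comp (contDiffOn_id.prodMk fun x hx => (hg x.1 x.2 hx.2).2.2.2.1.contDiffWithinAt)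
      fun x hx => ⟨⟨trivial, hsub hx.2⟩, hgI x.1 x.2 hx.2⟩
  · simp only
    rw [(hg θ ε hε).2.2.1]
    exact (hκ' θ ε _ ⟨⟨trivial, hsub hε⟩, hgI θ ε hε⟩).1
  · simp only
    rw [hgK θ ε hε]
    exact Ioo_subset_Icc_self (hgI θ ε hε)
  have hε' : ε ∈ Ioo (-ε₂) ε₂ := ⟨by linarith [hε.1], hε.2⟩
  obtain ⟨hwin, hsmall⟩ := hI₃ ε (hsub hε')
  have hsmall := hsmall hε.1
  -- the turning point lies behind the wall exactly below the tangency energy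
  have key : ∀ z ∈ S.sect ε E R, ∀ θ : ℝ, angleVar S.V₂ z.q₂ z.p₂ = θ → α ≤ z.q₁ →
      ∃ τ, F.IsDescent ε z τ ∧
        ((F.φ τ ε z).q₁ < S.w ↔ energy₁ S.V₂ z.q₂ z.p₂ < g (θ, ε)) ∧
        ((F.φ τ ε z).q₁ = S.w ↔ energy₁ S.V₂ z.q₂ z.p₂ = g (θ, ε)) := by
    intro z hz θ hθ hq
    obtain ⟨τ, D⟩ := hD ε (hsub hε') z (F.sect_subset_dom hz) hz.2.2.2.1 hz.2.2.2.2.1 hq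
    have e1 : S.V₁ S.w < S.V₁ (F.φ τ ε z).q₁ ↔ (F.φ τ ε z).q₁ < S.w :=
      S.isWell_V₁.strictAntiOn.lt_iff_gt S.w_neg.le D.end_neg.le
    have e2 : S.V₁ (F.φ τ ε z).q₁ = S.V₁ S.w ↔ (F.φ τ ε z).q₁ = S.w :=
      S.isWell_V₁.strictAntiOn.injOn.eq_iff D.end_neg.le S.w_neg.le
    have hgz := (hg θ ε hε').1
    have hdrift := abs_le.1 ((D.abs_V₁_end_sub_le hwin.le hz).trans hwin.drift.le)
    refine ⟨τ, D, ?_⟩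
    rw [← e1, ← e2]
    rcases lt_or_ge (energy₁ S.V₂ z.q₂ z.p₂) (h₀ - δ / 2) with h | h
    · have h1 : S.V₁ S.w < S.V₁ (F.φ τ ε z).q₁ := by linarith
      have h2 : energy₁ S.V₂ z.q₂ z.p₂ < g (θ, ε) := h.trans hgz.1
      exact ⟨iff_of_true h1 h2, iff_of_false h1.ne' h2.ne⟩
    rcases lt_or_ge (h₀ + δ / 2) (energy₁ S.V₂ z.q₂ z.p₂) with h' | h'
    · have h1 : S.V₁ (F.φ τ ε z).q₁ < S.V₁ S.w := by linarith
      have h2 : g (θ, ε) < energy₁ S.V₂ z.q₂ z.p₂ := hgz.2.trans h'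
      exact ⟨iff_of_false h1.not_gt h2.not_gt, iff_of_false h1.ne h2.ne'⟩
    · have hh : energy₁ S.V₂ z.q₂ z.p₂ ∈ Ioo (h₀ - δ) (h₀ + δ) := ⟨by linarith, by linarith⟩
      have hz' := hZu ε (hsub hε') z hz θ hh hθ
      have h1 := (hκ' θ ε (energy₁ S.V₂ z.q₂ z.p₂) ⟨⟨trivial, hsub hε'⟩, hh⟩).2 τ
        (by rwa [← hz'])
      rw [← hz'] at h1
      obtain ⟨h2, h3⟩ := (hg θ ε hε').2.2.2.2 _ ⟨h, h'⟩
      rw [← h2, ← h3]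
      exact ⟨⟨fun _ => by linarith, fun _ => by linarith⟩,
        ⟨fun _ => by linarith, fun _ => by linarith⟩⟩
  have hle : ∀ z ∈ S.sect ε E R, ∀ θ : ℝ, energy₁ S.V₂ z.q₂ z.p₂ ≤ g (θ, ε) → α ≤ z.q₁ :=
    fun z hz θ h => hwin.le_q₁ z hz (h.trans_lt (hgI θ ε hε').2)
  refine ⟨hsmall, fun z hz θ hθ h => ?_, fun z hz θ hθ h => ?_, fun z hz θ hθ h => ?_,
    fun z hz θ hθ h => ?_, fun θ => ?_⟩
  · simp only [hgK θ ε hε'] at h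
    obtain ⟨τ, D, h1, -⟩ := key z hz θ hθ (hle z hz θ h.le)
    obtain ⟨h3, h4⟩ := D.touches_iff hsmall hz
    rw [h3, h4]
    exact ⟨h1.2 h, (h1.2 h).ne⟩
  · simp only [hgK θ ε hε'] at h
    rcases le_or_gt α z.q₁ with hq | hq
    · obtain ⟨τ, D, h1, h2⟩ := key z hz θ hθ hq
      obtain ⟨h3, h4⟩ := D.touches_iff hsmall hz
      rw [h3, h4, h1, h2]
      exact ⟨h.not_gt, h.ne'⟩
    · exact ⟨fun ⟨v, _, hv⟩ => hq.not_ge (hwin.le_q₁_of_meetsWall z hz hsmall v hv),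
        fun hv => hq.not_ge (hwin.le_q₁_of_meetsWall z hz hsmall 0 hv)⟩
  · simp only [hgK θ ε hε'] at h
    obtain ⟨τ, D, -, h2⟩ := key z hz θ hθ (hle z hz θ h.le)
    rw [(D.touches_iff hsmall hz).1]
    exact h2.2 h
  · simp only [hgK θ ε hε'] at h
    exact hret ε (hI₂ ε (hsub hε')) hsmall z hz (hle z hz θ h)
  · simp only [hgK θ ε hε']
    obtain ⟨-, -, h1, -, -, -, h2, h3, -⟩ :=
      hZ' θ ε (g (θ, ε)) ⟨⟨trivial, hsub hε'⟩, hgI θ ε hε'⟩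
    exact ⟨_, h1 hε.1, h3, h2⟩

end FreeFlow

end WallSystem

/-! ### The singularity curve and its image -/

/-- The graph over the circle of a continuous periodic function is a dividing circle. -/
lemma isDividingCircle_cylinderGraph {f : ℝ → ℝ} (hf : Continuous f)
    (hper : Function.Periodic f (2 * Real.pi)) : IsDividingCircle (cylinderGraph f) := by
  let g : AddCircle (2 * Real.pi) → Real.Angle × ℝ := fun x => (x, hper.lift x)
  have hg : ∀ θ : ℝ, g (θ : AddCircle (2 * Real.pi)) = ((θ : Real.Angle), f θ) := fun θ =>
    Prod.ext rfl (hper.lift_coe θ)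
  have hgc : Continuous g := continuous_id.prodMk (continuous_coinduced_dom.2 hf)
  let e := AddCircle.homeomorphCircle'.symm
  refine ⟨g ∘ e, hgc.comp e.continuous, fun s t hst => e.injective (congrArg Prod.fst hst), ?_, ?_⟩
  · rw [e.surjective.range_comp]
    ext x
    constructor
    · rintro ⟨y, rfl⟩
      induction y using QuotientAddGroup.induction_on with
      | H θ => exact ⟨θ, (hg θ).symm⟩
    · rintro ⟨θ, rfl⟩
      exact ⟨θ, hg θ⟩
  · exact e.surjective.range_eq

lemma PeriodicCrClose.comp_neg {r : ℕ} {f : ℝ → ℝ} {c δ : ℝ} (h : PeriodicCrClose r f c δ) :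
    PeriodicCrClose r (fun θ => f (-θ)) c δ := by
  refine ⟨fun θ => ?_, h.2.1.comp contDiff_neg, fun k hk θ => ?_⟩
  · simp only
    rw [neg_add']
    exact h.1.sub_eq (-θ)
  · rw [iteratedDeriv_comp_neg k (fun x => f x - c) θ, smul_eq_mul, abs_mul, abs_pow, abs_neg,
      abs_one, one_pow, one_mul]
    exact h.2.2 k hk (-θ)

/-- The reversal of the momenta. -/
def PhasePt.reverse (z : PhasePt) : PhasePt := ⟨z.q₁, -z.p₁, z.q₂, -z.p₂⟩

@[simp] lemma PhasePt.reverse_reverse (z : PhasePt) : z.reverse.reverse = z := by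
  simp [PhasePt.reverse]

lemma energy₁_neg (V : ℝ → ℝ) (q p : ℝ) : energy₁ V q (-p) = energy₁ V q p := by simp [energy₁]

lemma ActionAngle.angleVar_neg {V : ℝ → ℝ} {n : ℕ} {H : ℝ} (A : ActionAngle V n H) {x y θ : ℝ}
    (hH : energy₁ V x y ∈ Ioo 0 H) (hθ : angleVar V x y = (θ : Real.Angle)) :
    angleVar V x (-y) = ((-θ : ℝ) : Real.Angle) := by
  obtain ⟨h1, h2⟩ := A.eq_of_angleVar hH hθ
  have h3 := A.angle (-θ) _ hH
  rwa [A.q_neg _ _ hH, A.p_neg _ _ hH, ← h1, ← h2] at h3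

namespace WallSystem

variable {r : ℕ} {S : WallSystem r} {E R ε : ℝ}

lemma ham_reverse (z : PhasePt) : S.ham ε z.reverse = S.ham ε z := by
  simp [ham, PhasePt.reverse]

lemma reverse_mem_sect {z : PhasePt} (hz : z ∈ S.sect ε E R) : z.reverse ∈ S.sect ε E R :=
  ⟨hz.1, hz.2.1, hz.2.2.1, neg_eq_zero.2 hz.2.2.2.1, hz.2.2.2.2.1,
    (ham_reverse z).trans hz.2.2.2.2.2⟩

lemma reverse_mem_dom {B : ℝ} {z : PhasePt} (hz : z ∈ S.dom E B ε) : z.reverse ∈ S.dom E B ε :=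
  ⟨hz.1, hz.2.1, (ham_reverse z).trans_le hz.2.2⟩

namespace FreeFlow

variable {F : S.FreeFlow E R}

/-- The wall-free flow is reversible. -/
lemma flow_reverse (hε : |ε| ≤ F.ε₀) {z : PhasePt} (hz : z ∈ S.dom E F.B ε) {T u : ℝ}
    (hu : u ∈ Icc 0 T) : F.φ u ε (F.φ T ε z).reverse = (F.φ (T - u) ε z).reverse := by
  have d1 := fun t => (F.deriv_q₁ ε hε z hz (T - t)).comp_const_sub T t
  have d2 := fun t => ((F.deriv_p₁ ε hε z hz (T - t)).comp_const_sub T t).fun_neg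
  have d3 := fun t => (F.deriv_q₂ ε hε z hz (T - t)).comp_const_sub T t
  have d4 := fun t => ((F.deriv_p₂ ε hε z hz (T - t)).comp_const_sub T t).fun_neg
  have := F.unique ε hε 0 T (fun t => (F.φ (T - t) ε z).reverse)
    (fun t _ => (d1 t).continuousAt.continuousWithinAt)
    (fun t _ => (d2 t).continuousAt.continuousWithinAt)
    (fun t _ => (d3 t).continuousAt.continuousWithinAt)
    (fun t _ => (d4 t).continuousAt.continuousWithinAt)
    (fun t _ => (d1 t).hasDerivWithinAt)
    (fun t _ => by
      have := (d2 t).hasDerivWithinAt (s := Ici t)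
      rwa [neg_neg] at this)
    (fun t _ => (d3 t).hasDerivWithinAt)
    (fun t _ => by
      have := (d4 t).hasDerivWithinAt (s := Ici t)
      rwa [neg_neg] at this)
    (fun t _ => reverse_mem_dom (F.mem ε hε z hz (T - t))) u hu
  simp only [sub_zero] at this
  exact this.symm

/-- A tangential trajectory up to its first return is one of the wall-free flow. Read backwards, it
is the tangential trajectory which leads from the reversed return point to the reversed initial
point. -/
lemma IsReturnPath.reverse {z : PhasePt} {a b : ℝ} (P : F.IsReturnPath ε z a b) (hε : F.IsSmall ε)
    (hz : z ∈ S.sect ε E R) (ht : S.Touches ε E R z) :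
    ∃ z' ∈ S.sect ε E R, S.IsFirstReturn ε E R z z'.reverse ∧ S.Touches ε E R z' ∧
      S.IsFirstReturn ε E R z' z.reverse := by
  have hdom := F.sect_subset_dom hz
  obtain ⟨T, hT, hneg, hw, hp⟩ := (meetsWall_iff hε hz 0).1 ht
  rw [neg_zero] at hp
  -- the descent ends at the contact
  obtain rfl : a = T := by
    rcases lt_trichotomy a T with h | h | h
    · have h1 := strictAntiOn_q₁ hε.le hdom hneg ⟨P.a_pos.le, h.le⟩ ⟨hT.le, le_rfl⟩ h
      simp only [hw] at h1
      rcases P.turn with h2 | ⟨-, h2⟩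
      · exact absurd h2 h1.ne'
      · exact absurd h2 (hneg a ⟨P.a_pos, h⟩).ne
    · exact h
    · exact absurd hp (P.descent T ⟨hT, h⟩).ne
  set y := F.φ a ε z with hy
  have hydom : y ∈ S.dom E F.B ε := F.mem ε hε.le z hdom a
  have hflip : y.flip = y := PhasePt.ext rfl (by rw [PhasePt.flip_p₁, hp, neg_zero]) rfl rfl
  have hflip' : y.reverse.flip = y.reverse :=
    PhasePt.ext rfl (by simp [PhasePt.reverse, hp]) rfl rfl
  have hend := P.end_mem hε hz
  have hret := P.isFirstReturn hε hz
  have hasc := P.ascent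
  rw [← hy, hflip] at hend hret hasc
  have hb : ∀ u ∈ Icc 0 b, F.φ u ε (F.φ b ε y).reverse = (F.φ (b - u) ε y).reverse :=
    fun u hu => F.flow_reverse hε.le hydom hu
  have ha : ∀ u ∈ Icc 0 a, F.φ u ε y.reverse = (F.φ (a - u) ε z).reverse :=
    fun u hu => F.flow_reverse hε.le hdom hu
  have hbb : F.φ b ε (F.φ b ε y).reverse = y.reverse := by
    rw [hb b ⟨P.b_pos.le, le_rfl⟩, sub_self, F.zero]
  have haa : F.φ a ε y.reverse = z.reverse := by
    rw [ha a ⟨hT.le, le_rfl⟩, sub_self, F.zero]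
  have hdes : ∀ t ∈ Ioo 0 b, (F.φ t ε (F.φ b ε y).reverse).p₁ < 0 := fun t ht => by
    rw [hb t ⟨ht.1.le, ht.2.le⟩]
    exact neg_neg_iff_pos.2 (hasc (b - t) ⟨by linarith [ht.2], by linarith [ht.1]⟩)
  have P' : F.IsReturnPath ε (F.φ b ε y).reverse b a := by
    refine ⟨P.b_pos, hT, hdes, Or.inl ?_, ?_, fun s hs => ?_, ?_, ?_⟩
    · rw [hbb]; exact hw
    · rw [hbb]; exact P.force
    · rw [hbb, hflip', ha s ⟨hs.1.le, hs.2.le⟩]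
      exact neg_pos.2 (hneg (a - s) ⟨by linarith [hs.2], by linarith [hs.1]⟩)
    · rw [hbb, hflip', haa]; exact neg_eq_zero.2 hz.2.2.2.1
    · rw [hbb, hflip', haa]; exact hz.2.2.2.2.1
  have hz' := reverse_mem_sect hend
  refine ⟨_, hz', by rwa [PhasePt.reverse_reverse], (meetsWall_iff hε hz' 0).2
    ⟨b, P.b_pos, hdes, by rw [hbb]; exact hw, by rw [hbb]; exact congrArg Neg.neg hp⟩, ?_⟩
  have := P'.isFirstReturn hε hz'
  rwa [hbb, hflip', haa] at this

namespace IsTangencyEnergy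

variable {T : ℝ → ℝ}

lemma touches_iff (hT : F.IsTangencyEnergy ε T) {z : PhasePt} (hz : z ∈ S.sect ε E R) {θ : ℝ}
    (hθ : angleVar S.V₂ z.q₂ z.p₂ = θ) :
    S.Touches ε E R z ↔ energy₁ S.V₂ z.q₂ z.p₂ = T θ := by
  refine ⟨fun h => ?_, hT.touches z hz θ hθ⟩
  rcases lt_trichotomy (energy₁ S.V₂ z.q₂ z.p₂) (T θ) with h' | h' | h'
  · exact absurd h (hT.impacts z hz θ hθ h').2
  · exact h'
  · exact absurd h (hT.misses z hz θ hθ h').2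

lemma singularityCurve_eq (hT : F.IsTangencyEnergy ε T) :
    S.singularityCurve ε E R = cylinderGraph fun θ => levelAction S.V₂ (T θ) := by
  ext x
  constructor
  · rintro ⟨z, ⟨hz, ht⟩, rfl⟩
    obtain ⟨θ, hθ⟩ := QuotientAddGroup.mk_surjective (angleVar S.V₂ z.q₂ z.p₂)
    have h1 := (hT.touches_iff hz hθ.symm).1 ht
    refine ⟨θ, Prod.ext hθ ?_⟩
    simp only [chart, actionVar, h1]
  · rintro ⟨θ, rfl⟩
    obtain ⟨z, hz, hθ, hh⟩ := hT.exists_mem θ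
    refine ⟨z, ⟨hz, hT.touches z hz θ hθ hh⟩, Prod.ext hθ ?_⟩
    simp only [chart, actionVar, hh]

lemma returnImage_eq (hT : F.IsTangencyEnergy ε T) {n : ℕ} {H : ℝ} (A : ActionAngle S.V₂ n H)
    (hTH : ∀ θ, T θ ∈ Ioo 0 H) :
    S.returnImage ε E R (S.singularityCurve ε E R) =
      cylinderGraph fun θ => levelAction S.V₂ (T (-θ)) := by
  -- a tangential trajectory from `z` ends at the reverse of a tangential point `z'`
  have hback : ∀ z ∈ S.sect ε E R, S.Touches ε E R z → ∃ z' ∈ S.sect ε E R,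
      (∀ x, S.IsFirstReturn ε E R z x → x = z'.reverse) ∧ S.Touches ε E R z' ∧
      S.IsFirstReturn ε E R z' z.reverse := by
    intro z hz ht
    obtain ⟨θ, hθ⟩ := QuotientAddGroup.mk_surjective (angleVar S.V₂ z.q₂ z.p₂)
    obtain ⟨a, b, P⟩ := hT.returns z hz θ hθ.symm ((hT.touches_iff hz hθ.symm).1 ht).le
    obtain ⟨z', h1, h2, h3, h4⟩ := P.reverse hT.isSmall hz ht
    exact ⟨z', h1, fun x hx => (P.eq_of_isFirstReturn hT.isSmall hz hx).trans
      (P.eq_of_isFirstReturn hT.isSmall hz h2).symm, h3, h4⟩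
  have hchart : ∀ z ∈ S.sect ε E R, S.Touches ε E R z → ∀ θ : ℝ,
      angleVar S.V₂ z.q₂ z.p₂ = θ →
      S.chart z.reverse = (((-θ : ℝ) : Real.Angle), levelAction S.V₂ (T θ)) := by
    intro z hz ht θ hθ
    have h1 := (hT.touches_iff hz hθ).1 ht
    refine Prod.ext (A.angleVar_neg (h1 ▸ hTH θ) hθ) ?_
    simp only [chart, actionVar, PhasePt.reverse, energy₁_neg, h1]
  ext x
  constructor
  · rintro ⟨z, hz, ⟨z₀, ⟨hz₀, ht₀⟩, h₀⟩, z', hz', rfl⟩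
    obtain ⟨θ, hθ⟩ := QuotientAddGroup.mk_surjective (angleVar S.V₂ z₀.q₂ z₀.p₂)
    have h1 := (hT.touches_iff hz₀ hθ.symm).1 ht₀
    have h2 : angleVar S.V₂ z.q₂ z.p₂ = θ := (congrArg Prod.fst h₀).symm.trans hθ.symm
    have h3 : levelAction S.V₂ (energy₁ S.V₂ z₀.q₂ z₀.p₂) =
        levelAction S.V₂ (energy₁ S.V₂ z.q₂ z.p₂) := congrArg Prod.snd h₀
    -- the action determines the energy
    have hpos : ∀ z : PhasePt, energy₁ S.V₂ z.q₂ z.p₂ ∈ Ici (0 : ℝ) := fun z =>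
      add_nonneg (by positivity) (S.isWell_V₂.nonneg _)
    have h4 := (strictMonoOn_levelAction S.isWell_V₂ S.V₂_coercive).injOn (hpos z₀) (hpos z) h3
    have ht := hT.touches z hz θ h2 (h4.symm.trans h1)
    obtain ⟨z₁, hz₁, h5, ht₁, -⟩ := hback z hz ht
    obtain ⟨ψ, hψ⟩ := QuotientAddGroup.mk_surjective (angleVar S.V₂ z₁.q₂ z₁.p₂)
    rw [h5 z' hz', hchart z₁ hz₁ ht₁ ψ hψ.symm]
    exact ⟨-ψ, by simp only [neg_neg]⟩
  · rintro ⟨θ, rfl⟩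
    obtain ⟨z, hz, hθ, hh⟩ := hT.exists_mem (-θ)
    have ht := hT.touches z hz (-θ) hθ hh
    obtain ⟨z₁, hz₁, -, ht₁, h6⟩ := hback z hz ht
    refine ⟨z₁, hz₁, ⟨z₁, ⟨hz₁, ht₁⟩, rfl⟩, z.reverse, h6, ?_⟩
    rw [hchart z hz ht (-θ) hθ, neg_neg]

end IsTangencyEnergy

end FreeFlow

end WallSystem

theorem mainTheorem4 {r : ℕ} (hr : 6 < r) (S : WallSystem r) (E R : ℝ) (hE : S.V₁ S.w < E)
    (hR : ∀ q₁ q₂ : ℝ, S.w ≤ q₁ → S.V₁ q₁ + S.V₂ q₂ ≤ E → |q₁| < R ∧ |q₂| < R) :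
    (∃ ε₀ > 0, ∃ C : ℝ, ∃ Itan Ibar : ℝ → ℝ → ℝ, ∀ ε ∈ Icc 0 ε₀,
      IsDividingCircle (S.singularityCurve ε E R) ∧
      (∀ z ∈ S.sect ε E R, ∀ θ : ℝ, (S.chart z).1 = (θ : Real.Angle) →
        ((S.chart z).2 < Itan ε θ → S.Impacts ε E R z ∧ ¬ S.Touches ε E R z) ∧
        (Itan ε θ < (S.chart z).2 → ¬ S.Impacts ε E R z ∧ ¬ S.Touches ε E R z) ∧
        ((S.chart z).2 ≤ Itan ε θ → ∃! z', S.IsFirstReturn ε E R z z')) ∧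
      S.singularityCurve ε E R = cylinderGraph (Itan ε) ∧
      S.returnImage ε E R (S.singularityCurve ε E R) = cylinderGraph (Ibar ε) ∧
      PeriodicCrClose r (Itan ε) (S.tangencyAction E) (C * ε) ∧
      PeriodicCrClose r (Ibar ε) (S.tangencyAction E) (C * ε) ∧
      (∀ θ, Ibar ε θ = Itan ε (-θ))) ∧
    (∀ η > 0, ∃ ε₁ > 0, ∀ ε ∈ Icc 0 ε₁, ∀ z ∈ S.sect ε E R, η ≤ z.q₁ →
      ∃! z', S.IsFirstReturn ε E R z z') := by
  have hr0 : r ≠ 0 := by omega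
  obtain ⟨F⟩ := S.nonempty_freeFlow hr0 E R
  refine ⟨?_, fun η hη => ?_⟩
  · obtain ⟨A⟩ := nonempty_actionAngle hr0 S.isWell_V₂ S.contDiff_V₂ S.V₂_coercive (E + 1)
    obtain ⟨δ, hδ, hsub, ε₀, hε₀, K, hK, hper, hmem, hT⟩ := F.exists_isTangencyEnergy hr0 A hE hR
    obtain ⟨C, hC⟩ :=
      exists_periodicCrClose hr0 hδ.le A.contDiffOn_action hsub hε₀ hK hper hmem
    refine ⟨ε₀ / 2, half_pos hε₀, C,
      fun ε θ => levelAction S.V₂ (E - S.V₁ S.w + ε * K (θ, ε)),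
      fun ε θ => levelAction S.V₂ (E - S.V₁ S.w + ε * K (-θ, ε)), fun ε hε => ?_⟩
    have hε' : ε ∈ Ioo (-ε₀) ε₀ := ⟨by linarith [hε.1], by linarith [hε.2]⟩
    have hTε := hT ε ⟨hε.1, hε'.2⟩
    have hclose := hC ε hε
    have hmono := strictMonoOn_levelAction S.isWell_V₂ S.V₂_coercive
    refine ⟨?_, fun z hz θ hθ => ?_, hTε.singularityCurve_eq,
      hTε.returnImage_eq A fun θ => hsub (hmem θ ε hε'), hclose, hclose.comp_neg, fun _ => rfl⟩
    · rw [hTε.singularityCurve_eq]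
      exact isDividingCircle_cylinderGraph hclose.2.1.continuous hclose.1
    · have h1 : energy₁ S.V₂ z.q₂ z.p₂ ∈ Ici (0 : ℝ) :=
        add_nonneg (by positivity) (S.isWell_V₂.nonneg _)
      have h2 : E - S.V₁ S.w + ε * K (θ, ε) ∈ Ici (0 : ℝ) := (hsub (hmem θ ε hε')).1.le
      refine ⟨fun h => hTε.impacts z hz θ hθ ((hmono.lt_iff_lt h1 h2).1 h),
        fun h => hTε.misses z hz θ hθ ((hmono.lt_iff_lt h2 h1).1 h), fun h => ?_⟩
      obtain ⟨a, b, P⟩ := hTε.returns z hz θ hθ ((hmono.le_iff_le h1 h2).1 h)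
      exact P.existsUnique_isFirstReturn hTε.isSmall hz
  · obtain ⟨e₁, he₁, h₁⟩ := F.exists_isReturnPath hη
    obtain ⟨e₂, he₂, h₂⟩ := Metric.eventually_nhds_iff.1 (F.eventually_isSmall hE hR)
    refine ⟨min e₁ (e₂ / 2), lt_min he₁ (half_pos he₂), fun ε hε z hz hq => ?_⟩
    have habs : |ε| = ε := abs_of_nonneg hε.1
    have hsmall := h₂ (y := ε) (by
      rw [Real.dist_eq, sub_zero, habs]
      linarith [hε.2.trans (min_le_right _ _)]) hε.1
    obtain ⟨a, b, P⟩ := h₁ ε (habs.trans_le (hε.2.trans (min_le_left _ _))) hsmall z hz hq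
    exact P.existsUnique_isFirstReturn hsmall hz

end
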